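/- Let $n \ge 6$ and let $OP_n$ be the CNF formula over the variables $P_{i,j}$ ($1\le i,j\le n$, $i\ne j$) that consists of the clauses $A(i,j,k)=\neg P_{i,j}\lor\neg P_{j,k}\lor P_{i,k}$ ($i,j,k$ distinct), $B(i,j)=\neg P_{i,j}\lor\neg P_{j,i}$ ($i\ne j$) and $D(j)=\bigvee_{i\ne j}P_{i,j}$. Consider the CDCL solver configured as follows. - Branching (VSIDS): all scores $q(x)$ are initially $0$; after each conflict, $q(x)\leftarrow b(x)+\delta\, q(x)$, where $b(x)=1$ if $x$ occurs in the clause learned from that conflict and $b(x)=0$ otherwise, with decay factor $0<\delta\le 1/2$. The solver decides an unassigned variable of highest score and sets it to false; ties are broken by column-major order $P_{2,1},\dots,P_{n,1},P_{1,2},\dots,P_{n,2},\dots,P_{1,n},\dots,P_{n-1,n}$. - Unit propagation: after a (re)start the unit clauses are asserted at decision level $0$; then assigned literals are taken up one at a time. A literal is propagated to saturation (for every clause that contains its complement and is unit, the unit literal is assigned) before another one is taken up. No literal is taken up and no decision is made while some clause is falsified, and no decision is made before all assigned literals have been propagated. The order of propagation is otherwise arbitrary, and a conflict that arises while a literal is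 being propagated may be noticed at once or only when that literal is saturated. - Learning: on a conflict at a positive decision level the solver learns the 1UIP clause (starting from the falsified clause, resolve along the trail, newest literal first, with the reasons of the implied literals until at most one literal of the current level is left; literals of lower levels, including level $0$, are kept). It then restarts from the empty assignment. No clause is ever deleted. On a conflict at decision level $0$ the solver stops with the answer UNSAT. Let $C(j,k)$ be the disjunction of the first $k$ variables in the list $P_{1,j},\dots,P_{j-1,j},P_{j+1,j},\dots,P_{n,j}$. Then every run of the solver on $OP_n$ terminates, and the clauses it learns are exactly the following, in this order: 1. (Head) $C(1,n-2),\ C(1,n-3)$; 2. (Descending Cascade) for each $j$ from $n-2$ down to $2$: $C(j,n-2),\ C(j,n-3),\ \dots,\ C(j,j-1)$; 3. (Tail) $C(1,n-4),\ C(1,n-5),\ \dots,\ C(1,2)$. After learning these clauses, the solver derives UNSAT by a conflict at decision level $0$. -/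

import Mathlib

/-! ### Clauses -/

/-- A literal is a variable with a polarity; `(v, true)` is `v` and `(v, false)` is `¬ v`. -/
abbrev Lit (V : Type) : Type := V × Bool

/-- The complementary literal. -/
def Lit.neg {V : Type} (l : Lit V) : Lit V := (l.1, !l.2)

/-- A clause is a finite set of literals, read as their disjunction. -/
abbrev Clause (V : Type) : Type := Finset (Lit V)

/-! ### The solver -/

namespace CDCL

/-- An input for the solver: a CNF formula, its variables, the strict order `before` that breaks
ties between variables of equal score, and the decay factor of VSIDS. -/
structure Config (V : Type) where
  formula : Finset (Clause V)
  vars : Finset V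
  before : V → V → Prop
  decay : ℝ

/-- An assigned literal with its decision level and its reason: the clause that became unit and
implied it, or `none` if the literal was decided. -/
structure Entry (V : Type) where
  lit : Lit V
  level : ℕ
  reason : Option (Clause V)

inductive Status where
  | running
  | sat
  | unsat

/-- A state of the solver. -/
structure State (V : Type) where
  /-- the learned clauses, in the order in which they were learned -/
  learned : List (Clause V)
  /-- the VSIDS scores -/
  score : V → ℝ
  /-- the assigned literals, the newest first -/
  trail : List (Entry V)
  /-- the assigned literals whose propagation has not been started -/
  pending : Finset (Lit V)
  /-- the literal that is being propagated; `none` from a (re)start until the first literal is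
  taken up, while the literals of the unit-length clauses are being assigned -/
  focus : Option (Lit V)
  /-- the current decision level -/
  level : ℕ
  status : Status

/-- The state in which the solver starts: nothing learned, all scores `0`, nothing assigned. -/
def start (V : Type) : State V :=
  { learned := [], score := fun _ => 0, trail := [], pending := ∅, focus := none,
    level := 0, status := Status.running }

section

variable {V : Type}

def IsTrue (s : State V) (l : Lit V) : Prop := ∃ e ∈ s.trail, e.lit = l

def IsFalse (s : State V) (l : Lit V) : Prop := IsTrue s l.neg

def Assigned (s : State V) (v : V) : Prop := IsTrue s (v, true) ∨ IsTrue s (v, false)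

/-- The clauses available to the solver; nothing is ever deleted. -/
def InDatabase (cfg : Config V) (s : State V) (c : Clause V) : Prop :=
  c ∈ cfg.formula ∨ c ∈ s.learned

def Falsified (s : State V) (c : Clause V) : Prop := ∀ l ∈ c, IsFalse s l

/-- The clause `c` is unit with unit literal `l`. -/
def IsUnitClause (s : State V) (c : Clause V) (l : Lit V) : Prop :=
  l ∈ c ∧ ¬ Assigned s l.1 ∧ ∀ l' ∈ c, l' ≠ l → IsFalse s l'

/-- The clauses examined while `focus` is being propagated: those that contain the complement of
the propagated literal, or the clauses of length one directly after a (re)start. -/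
def Examined (focus : Option (Lit V)) (c : Clause V) : Prop :=
  match focus with
  | none => c.card = 1
  | some x => x.neg ∈ c

/-- The literal in focus has been propagated to saturation. -/
def Saturated (cfg : Config V) (s : State V) : Prop :=
  ∀ c l, InDatabase cfg s c → Examined s.focus c → ¬ IsUnitClause s c l

def NoConflict (cfg : Config V) (s : State V) : Prop :=
  ∀ c, InDatabase cfg s c → ¬ Falsified s c

/-- `v` is the unassigned variable of highest score, ties being broken by `before`. -/
def IsBranchVar (cfg : Config V) (s : State V) (v : V) : Prop :=
  v ∈ cfg.vars ∧ ¬ Assigned s v ∧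
    ∀ w ∈ cfg.vars, ¬ Assigned s w → w ≠ v →
      s.score w < s.score v ∨ (s.score w = s.score v ∧ cfg.before v w)

variable [DecidableEq V]

/-- The literals of `c` that were made false at decision level `lvl`. -/
def atLevel (lvl : ℕ) (trail : List (Entry V)) (c : Clause V) : Clause V :=
  c.filter fun l => ∃ e ∈ trail, e.lit = l.neg ∧ e.level = lvl

/-- 1UIP conflict analysis at decision level `lvl`. Starting with the conflict clause `c`, walk back
along the trail (newest entry first) and resolve with the reasons of the implied literals whose
complements occur in the current clause, until at most one literal of level `lvl` is left.
Literals of lower levels, level `0` included, are kept. -/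
def firstUIP (lvl : ℕ) : List (Entry V) → Clause V → Clause V
  | [], c => c
  | e :: t, c =>
    if (atLevel lvl (e :: t) c).card ≤ 1 then c
    else
      match e.reason with
      | none => firstUIP lvl t c
      | some r =>
        if e.lit.neg ∈ c then firstUIP lvl t (c.erase e.lit.neg ∪ r.erase e.lit)
        else firstUIP lvl t c

/-- The VSIDS update after a conflict with learned clause `c`: decay every score by the factor `δ`,
then add `1` to the scores of the variables of `c`. -/
def bump (δ : ℝ) (c : Clause V) (q : V → ℝ) : V → ℝ :=
  fun v => (if v ∈ c.image Prod.fst then 1 else 0) + δ * q v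

/-- One step of the solver. The order in which pending literals are propagated and in which the
clauses are examined is left open, as is the moment at which a conflict that arises during the
propagation of a literal is noticed (at once, or only when that literal is saturated); but each
literal is propagated to saturation before another one is taken up, and no literal is taken up and
no decision is made while some clause is falsified. -/
inductive Step (cfg : Config V) : State V → State V → Prop
  /-- Assign the unit literal of a clause that is examined. -/
  | imply (s : State V) (c : Clause V) (l : Lit V) (running : s.status = Status.running)
      (hc : InDatabase cfg s c) (hx : Examined s.focus c) (hu : IsUnitClause s c l) :
      Step cfg s { s with
        trail := ⟨l, s.level, some c⟩ :: s.trail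
        pending := insert l s.pending }
  /-- Take up the propagation of a pending literal. -/
  | focus (s : State V) (x : Lit V) (running : s.status = Status.running)
      (hn : NoConflict cfg s) (hs : Saturated cfg s) (hx : x ∈ s.pending) :
      Step cfg s { s with
        pending := s.pending.erase x
        focus := some x }
  /-- Everything is propagated: open a new decision level and assign the branching variable to
  false. -/
  | branch (s : State V) (v : V) (running : s.status = Status.running)
      (hn : NoConflict cfg s) (hs : Saturated cfg s) (hp : s.pending = ∅)
      (hv : IsBranchVar cfg s v) :
      Step cfg s { s with
        trail := ⟨(v, false), s.level + 1, none⟩ :: s.trail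
        focus := some (v, false)
        level := s.level + 1 }
  /-- Conflict at a positive decision level: learn the 1UIP clause, update the scores, restart. -/
  | learn (s : State V) (c : Clause V) (running : s.status = Status.running)
      (hc : InDatabase cfg s c) (hf : Falsified s c) (hl : 0 < s.level) :
      Step cfg s
        { learned := s.learned ++ [firstUIP s.level s.trail c]
          score := bump cfg.decay (firstUIP s.level s.trail c) s.score
          trail := []
          pending := ∅
          focus := none
          level := 0
          status := Status.running }
  /-- Conflict at decision level `0`: the formula is unsatisfiable. -/
  | refute (s : State V) (c : Clause V) (running : s.status = Status.running)
      (hc : InDatabase cfg s c) (hf : Falsified s c) (hl : s.level = 0) :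
      Step cfg s { s with status := Status.unsat }
  /-- All variables are assigned without conflict: the formula is satisfiable. -/
  | model (s : State V) (running : s.status = Status.running)
      (hn : NoConflict cfg s) (hs : Saturated cfg s) (hp : s.pending = ∅)
      (hv : ∀ v ∈ cfg.vars, Assigned s v) :
      Step cfg s { s with status := Status.sat }

/-- The states that occur in the runs of the solver. -/
def Reachable (cfg : Config V) (s : State V) : Prop :=
  Relation.ReflTransGen (Step cfg) (start V) s

/-- The solver has stopped: no step is possible. -/
def Halted (cfg : Config V) (s : State V) : Prop := ∀ t, ¬ Step cfg s t

/-- No run of the solver goes on forever. -/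
def AlwaysHalts (cfg : Config V) : Prop :=
  ¬ ∃ run : ℕ → State V, run 0 = start V ∧ ∀ t, Step cfg (run t) (run (t + 1))

end

end CDCL

/-! ### The ordering principle -/

namespace OrderingPrinciple

/-- The variable `P_{i,j}` is the pair `(i, j)`: row `i`, column `j`. -/
abbrev Var : Type := ℕ × ℕ

def pos (i j : ℕ) : Lit Var := ((i, j), true)

def neg (i j : ℕ) : Lit Var := ((i, j), false)

def vars (n : ℕ) : Finset Var :=
  (Finset.Icc 1 n ×ˢ Finset.Icc 1 n).filter fun p => p.1 ≠ p.2

/-- The transitivity clause `A(i, j, k)`. -/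
def clauseA (i j k : ℕ) : Clause Var := {neg i j, neg j k, pos i k}

/-- The antisymmetry clause `B(i, j)`. -/
def clauseB (i j : ℕ) : Clause Var := {neg i j, neg j i}

/-- The non-minimality clause `D(j)`. -/
def clauseD (n j : ℕ) : Clause Var :=
  ((Finset.Icc 1 n).filter fun i => i ≠ j).image fun i => pos i j

/-- The formula `OP_n`. -/
def formula (n : ℕ) : Finset (Clause Var) :=
  ((Finset.Icc 1 n ×ˢ Finset.Icc 1 n ×ˢ Finset.Icc 1 n).filter fun t =>
      t.1 ≠ t.2.1 ∧ t.2.2 ≠ t.1 ∧ t.2.1 ≠ t.2.2).image (fun t => clauseA t.1 t.2.1 t.2.2) ∪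
    (vars n).image (fun p => clauseB p.1 p.2) ∪
    (Finset.Icc 1 n).image (fun j => clauseD n j)

/-- Column-major order. -/
def columnMajor (v w : Var) : Prop := v.2 < w.2 ∨ (v.2 = w.2 ∧ v.1 < w.1)

/-- The solver configuration for `OP_n` with decay factor `δ`. -/
def config (n : ℕ) (δ : ℝ) : CDCL.Config Var :=
  { formula := formula n, vars := vars n, before := columnMajor, decay := δ }

/-- The variables of column `j` in increasing order of their rows. -/
def column (n j : ℕ) : List Var :=
  ((List.range' 1 n).filter fun i => i ≠ j).map fun i => (i, j)

/-- The prefix clause `C(j, k)`: the disjunction of the first `k` variables of column `j`. -/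
def prefixClause (n j k : ℕ) : Clause Var :=
  (((column n j).take k).map fun v => (v, true)).toFinset

/-- The list `a, a - 1, …, b`. -/
def downTo (a b : ℕ) : List ℕ := (List.range' b (a + 1 - b)).reverse

def head (n : ℕ) : List (Clause Var) := [prefixClause n 1 (n - 2), prefixClause n 1 (n - 3)]

def descendingCascade (n : ℕ) : List (Clause Var) :=
  (downTo (n - 2) 2).flatMap fun j => (downTo (n - 2) (j - 1)).map fun k => prefixClause n j k

def tail (n : ℕ) : List (Clause Var) := (downTo (n - 4) 2).map fun k => prefixClause n 1 k

end OrderingPrinciple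

/-! ### General facts about the solver -/

/-! Every learned clause `C(p, m - 2)` comes from the same kind of conflict. Suppose `P_{i,p}` is
false for all `i < m`, `i ≠ p`, and `C(p, m - 1)` is available. Then `P_{m,p}` is implied, the
clauses `A(i, m, p)` and `B(m, p)` make the rows below `m` of column `m` false, and `C(m, m - 1)` is
falsified (it is `D(n)` when `m = n`). For `m = n - 1` no such clause is ever learned, but `D(n -
1)` implies `P_{n,n-1}`, and the same step repeated in column `n` falsifies `D(n)`. The last entry
`P_{a,p}` of column `p` to become false is the unique implication point, and resolution leaves
exactly the false entries of column `p`.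

Since `δ ≤ 1/2`, all scores stay below `2`, so one fresh bump outweighs any history; since only
prefixes of columns are learned, scores do not increase down a column. Hence the solver decides the
first unassigned variable of the column it learned about last (`branchVar_eq`).

The order of the clauses depends on which `C(m, m - 1)` exist. Column `1` gets stuck after `C(1, n -
3)`, because `C(n - 2, n - 3)` is missing: `P_{n-2,1}` is implied without conflict, and from then on
`A(x, n - 2, 1)` copies each false entry of column `1` to column `n - 2`, where the conflict occurs.
Column `p` is worked down to `C(p, p - 1)`. After `C(p + 1, p)` the decisions in column `p + 1` make
`P_{p,p+1}` true and are copied to column `p` in the same way. The cascade ends with the unit clause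
`C(2, 1)`; now all `C(m, m - 1)` needed for column `1` are present, and that column is finished.

The free order of propagation is handled by invariants (`Leads`, `Leads.of_invariant`). On a level
without conflict, unit propagation has a unique closure (`leads_of_level`, `Level.closed`). In the
conflict phase the possible states are confined by `BeforePivot`, `DuringPivot`, `AfterPivot` and
`DuringLast`, and `firstUIP_eq` computes the learned clause without knowing the order of the trail.
`halts_of_leads` joins the legs between restarts and proves termination. -/

theorem Lit.neg_neg {V : Type} (l : Lit V) : l.neg.neg = l := by
  simp [Lit.neg]

namespace CDCL

variable {V : Type}

/-- Every variable occurs at most once on the trail, and the reason of an implied literal was unit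
when the literal was assigned. -/
def WellFormed : List (Entry V) → Prop
  | [] => True
  | e :: t => (∀ e' ∈ t, e'.lit.1 ≠ e.lit.1) ∧
      (∀ r, e.reason = some r → e.lit ∈ r ∧ ∀ l ∈ r, l ≠ e.lit → ∃ e' ∈ t, e'.lit = l.neg) ∧
      WellFormed t

theorem WellFormed.nodup {T : List (Entry V)} (h : WellFormed T) :
    (T.map fun e => e.lit.1).Nodup := by
  induction T with
  | nil => simp
  | cons f T ih =>
    rw [List.map_cons, List.nodup_cons]
    refine ⟨?_, ih h.2.2⟩
    rw [List.mem_map]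
    rintro ⟨e, he, h'⟩
    exact h.1 e he h'

/-- The state after assigning the unit literal `l` of `c`. -/
abbrev State.imply [DecidableEq V] (s : State V) (c : Clause V) (l : Lit V) : State V :=
  { s with
    trail := ⟨l, s.level, some c⟩ :: s.trail
    pending := insert l s.pending }

/-- The state after taking up the pending literal `x`. -/
abbrev State.takeUp [DecidableEq V] (s : State V) (x : Lit V) : State V :=
  { s with
    pending := s.pending.erase x
    focus := some x }

/-- The state after deciding `v`. -/
abbrev State.decide (s : State V) (v : V) : State V :=
  { s with
    trail := ⟨(v, false), s.level + 1, none⟩ :: s.trail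
    focus := some (v, false)
    level := s.level + 1 }

/-- The scores after learning the clauses of `L` in this order. -/
def scores [DecidableEq V] (δ : ℝ) (L : List (Clause V)) : V → ℝ :=
  L.foldl (fun q c => bump δ c q) fun _ => 0

/-- The state right after the restart that follows the learning of the last clause of `L`. -/
def restarted [DecidableEq V] (δ : ℝ) (L : List (Clause V)) : State V :=
  { learned := L, score := scores δ L, trail := [], pending := ∅, focus := none,
    level := 0, status := Status.running }

theorem isTrue_cons {s : State V} {e : Entry V} {t : List (Entry V)} (h : s.trail = e :: t)
    (l : Lit V) : IsTrue s l ↔ l = e.lit ∨ ∃ e' ∈ t, e'.lit = l := by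
  unfold IsTrue
  rw [h]
  simp [eq_comm]

theorem assigned_iff (s : State V) (l : Lit V) : Assigned s l.1 ↔ IsTrue s l ∨ IsTrue s l.neg := by
  obtain ⟨v, b⟩ := l
  cases b <;> simp [Assigned, Lit.neg, or_comm]

theorem not_mem_of_not_assigned {s : State V} {v : V} (h : ¬ Assigned s v) :
    ∀ e ∈ s.trail, e.lit.1 ≠ v := by
  rintro e he rfl
  exact h ((assigned_iff s e.lit).2 (Or.inl ⟨e, he, rfl⟩))

theorem isTrue_decide (s : State V) (v : V) (x : Lit V) :
    IsTrue (s.decide v) x ↔ x = (v, false) ∨ IsTrue s x :=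
  isTrue_cons (s := s.decide v) rfl x

variable [DecidableEq V] {cfg : Config V} {s : State V}

theorem scores_append (δ : ℝ) (L : List (Clause V)) (c : Clause V) :
    scores δ (L ++ [c]) = bump δ c (scores δ L) := by
  simp [scores]

theorem isTrue_imply (s : State V) (c : Clause V) (l x : Lit V) :
    IsTrue (s.imply c l) x ↔ x = l ∨ IsTrue s x :=
  isTrue_cons (s := s.imply c l) rfl x

/-- The invariants of the running solver that do not depend on the formula. -/
structure Sound (cfg : Config V) (s : State V) : Prop where
  running : s.status = Status.running
  score_eq : s.score = scores cfg.decay s.learned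
  wf : WellFormed s.trail
  pending_true : ∀ l ∈ s.pending, IsTrue s l
  focus_true : ∀ x, s.focus = some x → IsTrue s x
  -- No unit clause is overlooked: each one is reached by the present focus or by a literal still
  -- waiting. Once the focus is saturated and nothing is pending, no unit clause remains.
  unit_examined : ∀ c l, InDatabase cfg s c → IsUnitClause s c l →
    Examined s.focus c ∨ ∃ x ∈ s.pending, x.neg ∈ c
  level_le : ∀ e ∈ s.trail, e.level ≤ s.level
  trail_vars : ∀ e ∈ s.trail, e.lit.1 ∈ cfg.vars
  clause_vars : ∀ c, InDatabase cfg s c → ∀ l ∈ c, l.1 ∈ cfg.vars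

theorem Sound.restarted {L : List (Clause V)}
    (h : ∀ c, c ∈ cfg.formula ∨ c ∈ L → ∀ l ∈ c, l.1 ∈ cfg.vars) :
    Sound cfg (restarted cfg.decay L) where
  running := rfl
  score_eq := rfl
  wf := trivial
  pending_true := by simp [CDCL.restarted]
  focus_true := by simp [CDCL.restarted]
  unit_examined := by
    rintro c l - ⟨hl, -, hu⟩
    -- On the empty trail nothing is false, so a unit clause has just one literal.
    refine Or.inl ?_
    change c.card = 1
    rw [Finset.card_eq_one]
    refine ⟨l, Finset.eq_singleton_iff_unique_mem.2 ⟨hl, fun x hx => ?_⟩⟩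
    by_contra hne
    obtain ⟨e, he, -⟩ := hu x hx hne
    cases he
  level_le := by simp [CDCL.restarted]
  trail_vars := by simp [CDCL.restarted]
  clause_vars := h

theorem Sound.imply (h : Sound cfg s) {c : Clause V} {l : Lit V} (hc : InDatabase cfg s c)
    (hu : IsUnitClause s c l) : Sound cfg (s.imply c l) where
  running := h.running
  score_eq := h.score_eq
  wf := by
    refine ⟨not_mem_of_not_assigned hu.2.1, ?_, h.wf⟩
    rintro r ⟨⟩
    exact ⟨hu.1, fun x hx hne => hu.2.2 x hx hne⟩
  pending_true := by
    intro x hx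
    rw [isTrue_imply]
    exact (Finset.mem_insert.1 hx).imp id (h.pending_true x)
  focus_true := fun x hx => (isTrue_imply ..).2 (Or.inr (h.focus_true x hx))
  unit_examined := by
    intro c' l' hc' hu'
    -- A clause that contains the complement of `l` is owed to the new pending literal; any other
    -- unit clause was unit before.
    by_cases hl : l.neg ∈ c'
    · exact Or.inr ⟨l, Finset.mem_insert_self _ _, hl⟩
    · have hu'' : IsUnitClause s c' l' := by
        refine ⟨hu'.1, fun ha => hu'.2.1 ?_, fun x hx hne => ?_⟩
        · rw [assigned_iff] at ha ⊢
          rw [isTrue_imply, isTrue_imply]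
          tauto
        · have := hu'.2.2 x hx hne
          rw [IsFalse, isTrue_imply] at this
          refine this.resolve_left fun h' => hl ?_
          rwa [← h', Lit.neg_neg]
      exact (h.unit_examined c' l' hc' hu'').imp id
        fun ⟨x, hx, hx'⟩ => ⟨x, Finset.mem_insert_of_mem hx, hx'⟩
  level_le := by
    intro e he
    rcases List.mem_cons.1 he with rfl | he
    · exact le_rfl
    · exact h.level_le e he
  trail_vars := by
    intro e he
    rcases List.mem_cons.1 he with rfl | he
    · exact h.clause_vars c hc l hu.1
    · exact h.trail_vars e he
  clause_vars := h.clause_vars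

theorem Sound.takeUp (h : Sound cfg s) (hs : Saturated cfg s) {x : Lit V} (hx : x ∈ s.pending) :
    Sound cfg (s.takeUp x) where
  running := h.running
  score_eq := h.score_eq
  wf := h.wf
  pending_true := fun l hl => h.pending_true l (Finset.mem_of_mem_erase hl)
  focus_true := by
    rintro y ⟨⟩
    exact h.pending_true x hx
  unit_examined := by
    intro c l hc hu
    obtain ⟨y, hy, hyc⟩ :=
      (h.unit_examined c l hc hu).resolve_left fun he => hs c l hc he hu
    by_cases hxy : y = x
    · exact Or.inl (hxy ▸ hyc)
    · exact Or.inr ⟨y, Finset.mem_erase.2 ⟨hxy, hy⟩, hyc⟩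
  level_le := h.level_le
  trail_vars := h.trail_vars
  clause_vars := h.clause_vars

theorem Sound.decide (h : Sound cfg s) (hs : Saturated cfg s) (hp : s.pending = ∅) {v : V}
    (hv : IsBranchVar cfg s v) : Sound cfg (s.decide v) where
  running := h.running
  score_eq := h.score_eq
  wf := ⟨not_mem_of_not_assigned hv.2.1, by simp, h.wf⟩
  pending_true := fun l hl => (isTrue_decide ..).2 (Or.inr (h.pending_true l hl))
  focus_true := by
    rintro y ⟨⟩
    exact (isTrue_decide ..).2 (Or.inl rfl)
  unit_examined := by
    intro c l hc hu
    -- Everything was propagated before the decision, so a clause can only have become unit through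
    -- the decided variable.
    by_cases hl : (v, true) ∈ c
    · exact Or.inl hl
    · have hu' : IsUnitClause s c l := by
        refine ⟨hu.1, fun ha => hu.2.1 ?_, fun x hx hne => ?_⟩
        · rw [assigned_iff] at ha ⊢
          rw [isTrue_decide, isTrue_decide]
          tauto
        · have := hu.2.2 x hx hne
          rw [IsFalse, isTrue_decide] at this
          refine this.resolve_left fun h' => hl ?_
          rw [← Lit.neg_neg x, h'] at hx
          exact hx
      rcases h.unit_examined c l hc hu' with he | ⟨y, hy, -⟩
      · exact absurd hu' (hs c l hc he)
      · rw [hp] at hy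
        cases hy
  level_le := by
    intro e he
    rcases List.mem_cons.1 he with rfl | he
    · exact le_rfl
    · exact (h.level_le e he).trans (Nat.le_succ _)
  trail_vars := by
    intro e he
    rcases List.mem_cons.1 he with rfl | he
    · exact hv.1
    · exact h.trail_vars e he
  clause_vars := h.clause_vars

/-- When everything is propagated, the assignment is closed under unit propagation. -/
theorem Sound.closed (h : Sound cfg s) (hn : NoConflict cfg s) (hs : Saturated cfg s)
    (hp : s.pending = ∅) {c : Clause V} (hc : InDatabase cfg s c) {l : Lit V} (hl : l ∈ c)
    (hf : ∀ l' ∈ c, l' ≠ l → IsFalse s l') : IsTrue s l := by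
  by_contra hnt
  by_cases ha : Assigned s l.1
  · rw [assigned_iff] at ha
    refine hn c hc fun x hx => ?_
    by_cases hxl : x = l
    · exact hxl ▸ ha.resolve_left hnt
    · exact hf x hx hxl
  · rcases h.unit_examined c l hc ⟨hl, ha, hf⟩ with he | ⟨y, hy, -⟩
    · exact hs c l hc he ⟨hl, ha, hf⟩
    · rw [hp] at hy
      cases hy

/-- In a saturated state without conflict an examined clause with all but one literal false has
its remaining literal true. -/
theorem true_of_examined (hn : NoConflict cfg s) (hs : Saturated cfg s) {c : Clause V}
    (hc : InDatabase cfg s c) (he : Examined s.focus c) {l : Lit V} (hl : l ∈ c)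
    (hf : ∀ l' ∈ c, l' ≠ l → IsFalse s l') : IsTrue s l := by
  by_contra hnt
  by_cases ha : Assigned s l.1
  · rw [assigned_iff] at ha
    refine hn c hc fun x hx => ?_
    by_cases hxl : x = l
    · exact hxl ▸ ha.resolve_left hnt
    · exact hf x hx hxl
  · exact hs c l hc he ⟨hl, ha, hf⟩

theorem Sound.length_le (h : Sound cfg s) : s.trail.length ≤ cfg.vars.card := by
  have h1 := h.wf.nodup
  have h2 : (s.trail.map fun e => e.lit.1).toFinset ⊆ cfg.vars := by
    intro v hv
    simp only [List.mem_toFinset, List.mem_map] at hv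
    obtain ⟨e, he, rfl⟩ := hv
    exact h.trail_vars e he
  have h3 := Finset.card_le_card h2
  rwa [List.toFinset_card_of_nodup h1, List.length_map] at h3

/-! ### Runs between restarts, and termination -/

/-- Every run from `s` keeps the learned clauses `L` until it reaches a state in `G`. -/
def Leads (cfg : Config V) (L : List (Clause V)) (G : State V → Prop) (s : State V) : Prop :=
  ∃ I : State V → Prop, I s ∧
    ∀ x, I x → (Sound cfg x ∧ x.learned = L) ∧ ∀ y, Step cfg x y → I y ∨ G y

variable {L : List (Clause V)} {G : State V → Prop}

theorem Leads.sound (h : Leads cfg L G s) : Sound cfg s ∧ s.learned = L :=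
  let ⟨_, h1, h2⟩ := h
  (h2 s h1).1

theorem Leads.step (h : Leads cfg L G s) {t : State V} (ht : Step cfg s t) :
    Leads cfg L G t ∨ G t :=
  let ⟨I, h1, h2⟩ := h
  ((h2 s h1).2 t ht).imp (fun h' => ⟨I, h', h2⟩) id

/-- The proof rule for one phase of a run: a step either stays in `I` or hands over to a phase
already treated, so legs can be assembled backwards from the conflict. Demanding an unassigned
variable in every fully propagated state excludes the answer SAT. -/
theorem Leads.of_invariant (I : State V → Prop)
    (himp : ∀ x, I x → Sound cfg x → x.learned = L → ∀ c l, InDatabase cfg x c →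
      Examined x.focus c → IsUnitClause x c l →
        Sound cfg (x.imply c l) → I (x.imply c l) ∨ Leads cfg L G (x.imply c l))
    (htake : ∀ x, I x → Sound cfg x → x.learned = L → NoConflict cfg x → Saturated cfg x →
      ∀ l ∈ x.pending,
        Sound cfg (x.takeUp l) → I (x.takeUp l) ∨ Leads cfg L G (x.takeUp l))
    (hdecide : ∀ x, I x → Sound cfg x → x.learned = L → NoConflict cfg x → Saturated cfg x →
      x.pending = ∅ → (∃ v ∈ cfg.vars, ¬ Assigned x v) ∧
        ∀ v, IsBranchVar cfg x v →
          Sound cfg (x.decide v) → I (x.decide v) ∨ Leads cfg L G (x.decide v))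
    (hconf : ∀ x, I x → Sound cfg x → x.learned = L → ∀ c, InDatabase cfg x c → Falsified x c →
      (0 < x.level → G (restarted cfg.decay (L ++ [firstUIP x.level x.trail c]))) ∧
        (x.level = 0 → G { x with status := Status.unsat }))
    (h1 : I s) (h2 : Sound cfg s) (h3 : s.learned = L) : Leads cfg L G s := by
  refine ⟨fun x => (I x ∧ Sound cfg x ∧ x.learned = L) ∨ Leads cfg L G x,
    Or.inl ⟨h1, h2, h3⟩, ?_⟩
  rintro x (⟨hx, hS, hL⟩ | hx)
  · refine ⟨⟨hS, hL⟩, fun y hy => ?_⟩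
    cases hy with
    | imply c l _ hc he hu =>
      refine Or.inl ?_
      have hS' := hS.imply hc hu
      exact (himp x hx hS hL c l hc he hu hS').imp (fun h => ⟨h, hS', hL⟩) id
    | focus l _ hn hs hl =>
      refine Or.inl ?_
      have hS' := hS.takeUp hs hl
      exact (htake x hx hS hL hn hs l hl hS').imp (fun h => ⟨h, hS', hL⟩) id
    | branch v _ hn hs hp hv =>
      refine Or.inl ?_
      have hS' := hS.decide hs hp hv
      exact ((hdecide x hx hS hL hn hs hp).2 v hv hS').imp (fun h => ⟨h, hS', hL⟩) id
    | learn c _ hc hf hl =>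
      refine Or.inr ?_
      have := (hconf x hx hS hL c hc hf).1 hl
      rw [restarted, scores_append, ← hL, ← hS.score_eq] at this
      exact this
    | refute c _ hc hf hl => exact Or.inr ((hconf x hx hS hL c hc hf).2 hl)
    | model _ hn hs hp hv =>
      obtain ⟨⟨v, h4, h5⟩, -⟩ := hdecide x hx hS hL hn hs hp
      exact absurd (hv v h4) h5
  · exact ⟨hx.sound, fun y hy => (hx.step hy).imp Or.inr id⟩

/-- Where the solver stops. -/
def Refuted (L : List (Clause V)) (s : State V) : Prop :=
  s.learned = L ∧ s.status = Status.unsat ∧ s.level = 0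

/-- The steps cover all situations of a running solver, so a halted state on a known run must be the
refuted one. -/
theorem Sound.exists_step (h : Sound cfg s)
    (hbranch : (∃ v ∈ cfg.vars, ¬ Assigned s v) → ∃ v, IsBranchVar cfg s v) :
    ∃ t, Step cfg s t := by
  by_cases hn : NoConflict cfg s
  · by_cases hs : Saturated cfg s
    · rcases s.pending.eq_empty_or_nonempty with hp | ⟨x, hx⟩
      · by_cases hv : ∃ v ∈ cfg.vars, ¬ Assigned s v
        · obtain ⟨v, hv⟩ := hbranch hv
          exact ⟨_, Step.branch s v h.running hn hs hp hv⟩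
        · push Not at hv
          exact ⟨_, Step.model s h.running hn hs hp hv⟩
      · exact ⟨_, Step.focus s x h.running hn hs hx⟩
    · unfold Saturated at hs
      push Not at hs
      obtain ⟨c, l, hc, he, hu⟩ := hs
      exact ⟨_, Step.imply s c l h.running hc he hu⟩
  · unfold NoConflict at hn
    push Not at hn
    obtain ⟨c, hc, hf⟩ := hn
    rcases Nat.eq_zero_or_pos s.level with hl | hl
    · exact ⟨_, Step.refute s c h.running hc hf hl⟩
    · exact ⟨_, Step.learn s c h.running hc hf hl⟩

/-- An upper bound for the number of steps that remain when at most `M` clauses are learned. -/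
def stepBound (N M : ℕ) (s : State V) : ℕ :=
  match s.status with
  | Status.running =>
    -- A trail slot weighs `2` because an implication fills one and adds at most one pending
    -- literal. A restart frees at most `N` slots, which the weight `2 * N + 1` of a learned clause
    -- outweighs.
    (M - s.learned.length) * (2 * N + 1) + (2 * (N - s.trail.length) + s.pending.card) + 1
  | _ => 0

theorem stepBound_lt {M : ℕ} {t : State V} (hs : Sound cfg s) (h : Step cfg s t)
    (ht : t.status = Status.running → t.learned.length ≤ M ∧ Sound cfg t) :
    stepBound cfg.vars.card M t < stepBound cfg.vars.card M s := by
  cases h with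
  | imply c l hr hc he hu =>
    have h1 := (ht hr).2.length_le
    simp only [List.length_cons] at h1
    have h2 := Finset.card_insert_le l s.pending
    simp only [stepBound, hr, List.length_cons]
    omega
  | focus x hr hn hs hx =>
    have h2 := Finset.card_erase_lt_of_mem hx
    simp only [stepBound, hr]
    omega
  | branch v hr hn hs hp hv =>
    have h1 := (ht hr).2.length_le
    simp only [List.length_cons] at h1
    simp only [stepBound, hr, List.length_cons]
    omega
  | learn c hr hc hf hl =>
    have h1 := (ht rfl).1
    simp only [List.length_append, List.length_singleton] at h1
    simp only [stepBound, hr, List.length_append, List.length_singleton, List.length_nil,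
      Finset.card_empty]
    have h3 := hs.length_le
    obtain ⟨k, hk⟩ : ∃ k, M - s.learned.length = k + 1 := ⟨M - (s.learned.length + 1), by omega⟩
    have h4 : M - (s.learned.length + 1) = k := by omega
    rw [hk, h4, add_mul, one_mul]
    omega
  | refute c hr hc hf hl => simp [stepBound, hr]
  | model hr hn hs hp hv => simp [stepBound, hr]

/-- If the runs lead from each initial segment of `L` to the next and from `L` to a refutation, then
every run of the solver learns `L` and stops with a refutation. -/
theorem halts_of_leads {δ : ℝ} (hδ : cfg.decay = δ)
    (hstep : ∀ L' c L'', L = L' ++ c :: L'' →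
      Leads cfg L' (fun t => t = restarted δ (L' ++ [c])) (restarted δ L'))
    (hlast : Leads cfg L (Refuted L) (restarted δ L))
    (hbranch : ∀ s : State V, (∃ v ∈ cfg.vars, ¬ Assigned s v) → ∃ v, IsBranchVar cfg s v) :
    AlwaysHalts cfg ∧ ∀ s, Reachable cfg s → Halted cfg s → Refuted L s := by
  subst hδ
  -- A run is always on a leg between consecutive initial segments of `L`, on the final leg, or
  -- refuted.
  let J : State V → Prop := fun s =>
    (∃ L' c L'', L = L' ++ c :: L'' ∧
      Leads cfg L' (fun t => t = restarted cfg.decay (L' ++ [c])) s) ∨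
    Leads cfg L (Refuted L) s ∨ Refuted L s
  have hrest : ∀ L' L'', L = L' ++ L'' → J (restarted cfg.decay L') := by
    intro L' L'' h
    cases L'' with
    | nil =>
      rw [List.append_nil] at h
      exact Or.inr (Or.inl (h ▸ hlast))
    | cons c L'' => exact Or.inl ⟨L', c, L'', h, hstep L' c L'' h⟩
  have hJ : ∀ s t, J s → Step cfg s t → J t := by
    rintro s t (⟨L', c, L'', h, hl⟩ | hl | hl) ht
    · rcases hl.step ht with h' | h'
      · exact Or.inl ⟨L', c, L'', h, h'⟩
      · rw [h']
        exact hrest _ L'' (by simp [h])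
    · exact (hl.step ht).elim (fun h => Or.inr (Or.inl h)) fun h => Or.inr (Or.inr h)
    · have h2 := hl.2.1
      cases ht <;> simp_all
  have hrun : ∀ s, J s → s.status = Status.running →
      s.learned.length ≤ L.length ∧ Sound cfg s := by
    rintro s (⟨L', c, L'', h, hl⟩ | hl | hl) hr
    · refine ⟨?_, hl.sound.1⟩
      rw [hl.sound.2, h]
      simp
    · refine ⟨?_, hl.sound.1⟩
      rw [hl.sound.2]
    · have h2 := hl.2.1
      simp_all
  have hstatus : ∀ s t : State V, Step cfg s t → s.status = Status.running := by
    intro s t h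
    cases h <;> assumption
  constructor
  · rintro ⟨run, h0, hrun'⟩
    have hJrun : ∀ t, J (run t) := by
      intro t
      induction t with
      | zero => rw [h0]; exact hrest [] L rfl
      | succ t ih => exact hJ _ _ ih (hrun' t)
    have hlt : ∀ t, stepBound cfg.vars.card L.length (run (t + 1)) <
        stepBound cfg.vars.card L.length (run t) := fun t =>
      stepBound_lt (hrun _ (hJrun t) (hstatus _ _ (hrun' t))).2 (hrun' t) (hrun _ (hJrun (t + 1)))
    have hle : ∀ t, stepBound cfg.vars.card L.length (run t) + t ≤
        stepBound cfg.vars.card L.length (run 0) := by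
      intro t
      induction t with
      | zero => simp
      | succ t ih =>
        have := hlt t
        omega
    have := hle (stepBound cfg.vars.card L.length (run 0) + 1)
    omega
  · intro s hs hh
    have : J s := by
      clear hh
      induction hs with
      | refl => exact hrest [] L rfl
      | tail _ h ih => exact hJ _ _ ih h
    by_contra hR
    have hS : Sound cfg s := by
      rcases this with ⟨L', c, L'', h, hl⟩ | hl | hl
      · exact hl.sound.1
      · exact hl.sound.1
      · exact absurd hl hR
    obtain ⟨t, ht⟩ := hS.exists_step (hbranch s)
    exact hh t ht

end CDCL

/-! ### Conflict analysis and the growth of scores -/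

namespace CDCL

variable {V : Type} [DecidableEq V]

theorem mem_atLevel {lvl : ℕ} {T : List (Entry V)} {c : Clause V} {l : Lit V} :
    l ∈ atLevel lvl T c ↔ l ∈ c ∧ ∃ e ∈ T, e.lit = l.neg ∧ e.level = lvl := by
  simp [atLevel]

theorem firstUIP_eq_self {lvl : ℕ} {T : List (Entry V)} {c : Clause V}
    (h : (atLevel lvl T c).card ≤ 1) : firstUIP lvl T c = c := by
  cases T with
  | nil => rfl
  | cons e T => rw [firstUIP, if_pos h]

/-- A description of the 1UIP clause. The trail consists of the entries `E` of the current level on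
top of a trail `B`; `w` is the complement of the unique implication point. All clauses that come up
consist of literals in `U`, and every set of literals in `𝒱` meets all of them. -/
theorem firstUIP_eq {lvl : ℕ} {E B : List (Entry V)} {c T : Clause V} {w : Lit V}
    (U : Lit V → Prop) (𝒱 : (Lit V → Prop) → Prop) (hok : WellFormed (E ++ B))
    (hE : ∀ e ∈ E, e.level = lvl)
    (hr : ∀ e ∈ E, U e.lit.neg → ∃ r, e.reason = some r ∧ (∀ x ∈ r, x ≠ e.lit → U x) ∧
      ∀ W, 𝒱 W → W e.lit.neg → ∃ x ∈ r, x ≠ e.lit ∧ W x)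
    (hw : ∃ e ∈ B, e.lit.neg = w ∧ e.level = lvl)
    (hB : ∀ e ∈ B, e.level = lvl → U e.lit.neg → e.lit.neg = w)
    (hBT : ∀ e ∈ B, U e.lit.neg → e.lit.neg ∈ T)
    (hW : ∃ W₁ W₂, 𝒱 W₁ ∧ 𝒱 W₂ ∧ (∀ x, W₁ x → W₂ x → x = w) ∧
      ∀ e ∈ B, W₁ e.lit.neg ∨ W₂ e.lit.neg → e.lit.neg = w)
    (hT : ∀ t ∈ T, ∃ W, 𝒱 W ∧ ∀ x ∈ T, W x → x = t)
    (hcU : ∀ x ∈ c, U x) (hcf : ∀ x ∈ c, ∃ e ∈ E ++ B, e.lit = x.neg)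
    (hcV : ∀ W, 𝒱 W → ∃ x ∈ c, W x) :
    firstUIP lvl (E ++ B) c = T := by
  -- Wherever the analysis stops, the clause is `T`. It meets `W₁` and `W₂` in literals of the
  -- current level; only one such literal is left, so it lies in both sets and is `w`. The other
  -- literals come from `B` and hence belong to `T`. Conversely, each `t ∈ T` is the only literal of
  -- `T` in some set of `𝒱`, so it cannot be missing.
  have hfinal : ∀ (E : List (Entry V)) (c : Clause V), (∀ e ∈ E, e.level = lvl) →
      (∀ x ∈ c, U x) → (∀ x ∈ c, ∃ e ∈ E ++ B, e.lit = x.neg) → (∀ W, 𝒱 W → ∃ x ∈ c, W x) →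
      (atLevel lvl (E ++ B) c).card ≤ 1 → c = T := by
    intro E c hE hcU hcf hcV hcard
    obtain ⟨W₁, W₂, hV₁, hV₂, h12, hWB⟩ := hW
    have key : ∀ x ∈ c, W₁ x ∨ W₂ x → x ∈ atLevel lvl (E ++ B) c := by
      intro x hx hxW
      refine mem_atLevel.2 ⟨hx, ?_⟩
      obtain ⟨e, he, hel⟩ := hcf x hx
      have hx' : e.lit.neg = x := by rw [hel, Lit.neg_neg]
      rcases List.mem_append.1 he with he' | he'
      · exact ⟨e, he, hel, hE e he'⟩
      · have hxw := hWB e he' (by rwa [hx'])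
        rw [hx'] at hxw
        obtain ⟨e', h1, h2, h3⟩ := hw
        exact ⟨e', List.mem_append_right _ h1, by rw [hxw, ← h2, Lit.neg_neg], h3⟩
    obtain ⟨x₁, hx₁, hxW₁⟩ := hcV W₁ hV₁
    obtain ⟨x₂, hx₂, hxW₂⟩ := hcV W₂ hV₂
    have h3 := key x₁ hx₁ (Or.inl hxW₁)
    have h4 := key x₂ hx₂ (Or.inr hxW₂)
    obtain rfl := Finset.card_le_one.1 hcard _ h3 _ h4
    obtain rfl := h12 _ hxW₁ hxW₂
    have hwT : x₁ ∈ T := by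
      obtain ⟨e', h1, h2, -⟩ := hw
      exact h2 ▸ hBT e' h1 (h2 ▸ hcU _ hx₁)
    have hsub : ∀ x ∈ c, x ∈ T := by
      intro x hx
      obtain ⟨e, he, hel⟩ := hcf x hx
      have hx' : e.lit.neg = x := by rw [hel, Lit.neg_neg]
      rcases List.mem_append.1 he with he' | he'
      · have h5 := mem_atLevel.2 ⟨hx, e, he, hel, hE e he'⟩
        rwa [Finset.card_le_one.1 hcard _ h5 _ h3]
      · exact hx' ▸ hBT e he' (hx' ▸ hcU x hx)
    refine Finset.Subset.antisymm hsub fun t ht => ?_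
    obtain ⟨W, hVW, hWt⟩ := hT t ht
    obtain ⟨x, hx, hxW⟩ := hcV W hVW
    exact hWt x (hsub x hx) hxW ▸ hx
  -- A resolution step keeps all three properties of `c`: a set of `𝒱` that loses the resolved
  -- literal meets the reason in another one. Thus a set of `𝒱` is a route from the conflict back to
  -- `B`, and two routes that share only `w` rule out any other implication point.
  induction E generalizing c with
  | nil =>
    have hcard : (atLevel lvl ([] ++ B) c).card ≤ 1 := by
      refine Finset.card_le_one.2 fun a ha b hb => ?_
      have : ∀ a ∈ atLevel lvl ([] ++ B) c, a = w := by
        intro a ha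
        obtain ⟨hac, e, he, hel, hlv⟩ := mem_atLevel.1 ha
        have hx' : e.lit.neg = a := by rw [hel, Lit.neg_neg]
        exact hx' ▸ hB e he hlv (hx' ▸ hcU a hac)
      rw [this a ha, this b hb]
    rw [firstUIP_eq_self hcard]
    exact hfinal [] c hE hcU hcf hcV hcard
  | cons e E ih =>
    by_cases hcard : (atLevel lvl (e :: E ++ B) c).card ≤ 1
    · rw [firstUIP_eq_self hcard]
      exact hfinal _ c hE hcU hcf hcV hcard
    · have ih' := fun c => ih (c := c) hok.2.2 (fun e' h => hE e' (List.mem_cons_of_mem _ h))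
        (fun e' h => hr e' (List.mem_cons_of_mem _ h))
      have hmem : ∀ x, x ≠ e.lit.neg → (∃ e' ∈ e :: E ++ B, e'.lit = x.neg) →
          ∃ e' ∈ E ++ B, e'.lit = x.neg := by
        rintro x hne ⟨e', he', hx⟩
        rw [List.cons_append, List.mem_cons] at he'
        rcases he' with rfl | he'
        · exact absurd (by rw [hx, Lit.neg_neg]) hne
        · exact ⟨e', he', hx⟩
      rw [List.cons_append] at hcard ⊢
      rw [firstUIP, if_neg hcard]
      by_cases hec : e.lit.neg ∈ c
      · obtain ⟨r, hr', hrU, hrV⟩ := hr e List.mem_cons_self (hcU _ hec)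
        simp only [hr', if_pos hec]
        refine ih' _ ?_ ?_ ?_
        · intro x hx
          rcases Finset.mem_union.1 hx with hx | hx
          · exact hcU x (Finset.mem_of_mem_erase hx)
          · exact hrU x (Finset.mem_of_mem_erase hx) (Finset.ne_of_mem_erase hx)
        · intro x hx
          rcases Finset.mem_union.1 hx with hx | hx
          · exact hmem x (Finset.ne_of_mem_erase hx) (hcf x (Finset.mem_of_mem_erase hx))
          · exact (hok.2.1 r hr').2 x (Finset.mem_of_mem_erase hx) (Finset.ne_of_mem_erase hx)
        · intro W hW'
          obtain ⟨x, hx, hxW⟩ := hcV W hW'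
          by_cases hxe : x = e.lit.neg
          · obtain ⟨y, hy, hne, hyW⟩ := hrV W hW' (hxe ▸ hxW)
            exact ⟨y, Finset.mem_union_right _ (Finset.mem_erase.2 ⟨hne, hy⟩), hyW⟩
          · exact ⟨x, Finset.mem_union_left _ (Finset.mem_erase.2 ⟨hxe, hx⟩), hxW⟩
      · have : firstUIP lvl (E ++ B) c = T :=
          ih' c hcU (fun x hx => hmem x (fun h => hec (h ▸ hx)) (hcf x hx)) hcV
        cases e.reason with
        | none => exact this
        | some r => simpa only [if_neg hec] using this

/-! ### Scores -/

/-- The variable `v` occurs in the clause `c`. -/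
def Occurs (v : V) (c : Clause V) : Prop := v ∈ c.image Prod.fst

theorem scores_nonneg {δ : ℝ} (h : 0 < δ) (L : List (Clause V)) (v : V) : 0 ≤ scores δ L v := by
  induction L using List.reverseRecOn with
  | nil => exact le_rfl
  | append_singleton L c ih =>
    rw [scores_append, bump]
    split_ifs <;> positivity

/-- A bump gives at most `1 + δ q`, and `2` is the fixed point of `q ↦ 1 + q / 2`. This is where `δ
≤ 1/2` enters. -/
theorem scores_lt_two {δ : ℝ} (h : 0 < δ) (h' : δ ≤ 1 / 2) (L : List (Clause V)) (v : V) :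
    scores δ L v < 2 := by
  induction L using List.reverseRecOn with
  | nil => exact two_pos
  | append_singleton L c ih =>
    rw [scores_append, bump]
    have := scores_nonneg h L v
    split_ifs <;> nlinarith

/-- Every bump of `w` is also one of `v`. Applied inside a column, where a prefix containing a row
contains all earlier ones. -/
theorem scores_le_of_occurs {δ : ℝ} (h : 0 < δ) {L : List (Clause V)} {v w : V}
    (hvw : ∀ c ∈ L, Occurs w c → Occurs v c) : scores δ L w ≤ scores δ L v := by
  induction L using List.reverseRecOn with
  | nil => exact le_rfl
  | append_singleton L c ih =>
    have ih := mul_le_mul_of_nonneg_left (ih fun c hc => hvw c (by simp [hc])) h.le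
    have hc := hvw c (by simp)
    unfold Occurs at hc
    rw [scores_append, bump, bump]
    split_ifs
    · linarith
    · tauto
    · linarith
    · linarith

/-- After `c` the score of `v` is at least `1`, while that of `w` is a decayed number below `2`,
hence below `1`. Later clauses scale both scores alike and can bump only `v`. -/
theorem scores_lt_of_recent {δ : ℝ} (h : 0 < δ) (h' : δ ≤ 1 / 2) {L₁ L₂ : List (Clause V)}
    {c : Clause V} {v w : V} (hv : Occurs v c) (hw : ∀ d ∈ c :: L₂, ¬ Occurs w d) :
    scores δ (L₁ ++ c :: L₂) w < scores δ (L₁ ++ c :: L₂) v := by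
  induction L₂ using List.reverseRecOn with
  | nil =>
    have h1 := hw c (by simp)
    unfold Occurs at hv h1
    rw [scores_append, bump, bump, if_pos hv, if_neg h1]
    have h2 := scores_nonneg h L₁ v
    have h3 := scores_lt_two h h' L₁ w
    have h4 := scores_nonneg h L₁ w
    nlinarith
  | append_singleton L₂ d ih =>
    have ih := ih fun d hd => hw d (by
      rw [← List.cons_append]
      exact List.mem_append_left _ hd)
    have h1 := hw d (by simp)
    unfold Occurs at h1
    rw [← List.cons_append, ← List.append_assoc, scores_append, bump, bump, if_neg h1]
    have := mul_lt_mul_of_pos_left ih h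
    split_ifs <;> linarith

end CDCL

/-! ### The clauses of the ordering principle -/

namespace OrderingPrinciple

open CDCL

theorem pos_neg (i j : ℕ) : (pos i j).neg = neg i j := rfl

theorem neg_neg (i j : ℕ) : (neg i j).neg = pos i j := rfl

@[simp] theorem pos_inj {i j i' j' : ℕ} : pos i j = pos i' j' ↔ i = i' ∧ j = j' := by
  simp [pos]

@[simp] theorem neg_inj {i j i' j' : ℕ} : neg i j = neg i' j' ↔ i = i' ∧ j = j' := by
  simp [neg]

@[simp] theorem pos_ne_neg {i j i' j' : ℕ} : pos i j ≠ neg i' j' := by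
  simp [pos, neg]

@[simp] theorem neg_ne_pos {i j i' j' : ℕ} : neg i j ≠ pos i' j' := by
  simp [pos, neg]

theorem lit_cases (l : Lit Var) : ∃ i j, l = pos i j ∨ l = neg i j := by
  obtain ⟨⟨i, j⟩, b⟩ := l
  cases b
  · exact ⟨i, j, Or.inr rfl⟩
  · exact ⟨i, j, Or.inl rfl⟩

theorem mem_vars {n : ℕ} {v : Var} :
    v ∈ vars n ↔ 1 ≤ v.1 ∧ v.1 ≤ n ∧ 1 ≤ v.2 ∧ v.2 ≤ n ∧ v.1 ≠ v.2 := by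
  simp only [vars, Finset.mem_filter, Finset.mem_product, Finset.mem_Icc]
  tauto

theorem clauseB_comm (i j : ℕ) : clauseB i j = clauseB j i := Finset.pair_comm _ _

/-- Row `x` is among the first `k` rows of column `j`. -/
def InRows (n j k x : ℕ) : Prop :=
  1 ≤ x ∧ x ≤ n ∧ (x < j ∧ x ≤ k ∨ j < x ∧ x ≤ k + 1)

theorem column_eq {n j : ℕ} (h1 : 1 ≤ j) (h2 : j ≤ n) :
    column n j = (List.range' 1 (j - 1) ++ List.range' (j + 1) (n - j)).map fun i => (i, j) := by
  have hn : List.range' 1 n = List.range' 1 (j - 1) ++ j :: List.range' (j + 1) (n - j) := by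
    rw [← List.range'_succ, ← show 1 + (j - 1) = j by omega]
    have h := List.range'_append (s := 1) (m := j - 1) (n := n - j + 1) (step := 1)
    rw [one_mul] at h
    rw [show 1 + (j - 1) - 1 = j - 1 by omega, show n - (1 + (j - 1)) + 1 = n - j + 1 by omega, h]
    congr 1
    omega
  rw [column, hn, List.filter_append, List.filter_cons]
  congr 1
  have e1 : (List.range' 1 (j - 1)).filter (fun i => decide (i ≠ j)) = List.range' 1 (j - 1) := by
    rw [List.filter_eq_self]
    intro a ha
    rw [List.mem_range'_1] at ha
    simp
    omega
  have e2 : (List.range' (j + 1) (n - j)).filter (fun i => decide (i ≠ j)) =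
      List.range' (j + 1) (n - j) := by
    rw [List.filter_eq_self]
    intro a ha
    rw [List.mem_range'_1] at ha
    simp
    omega
  rw [e1, e2]
  simp

theorem take_range' (s m k : ℕ) :
    (List.range' s m).take k = List.range' s (min k m) := by
  rcases le_total k m with h | h
  · rw [min_eq_left h]
    have := List.range'_append (s := s) (m := k) (n := m - k) (step := 1)
    rw [show k + (m - k) = m by omega] at this
    rw [← this, List.take_left' List.length_range']
  · rw [min_eq_right h, List.take_of_length_le (by simpa using h)]

theorem mem_prefixClause {n j k : ℕ} (h1 : 1 ≤ j) (h2 : j ≤ n) {l : Lit Var} :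
    l ∈ prefixClause n j k ↔ ∃ x, InRows n j k x ∧ l = pos x j := by
  rw [prefixClause, column_eq h1 h2, ← List.map_take, List.take_append, List.length_range']
  simp only [take_range', List.map_append, List.map_map, List.mem_toFinset, List.mem_append,
    List.mem_map, List.mem_range'_1, Function.comp]
  constructor
  · rintro (⟨x, hx, rfl⟩ | ⟨x, hx, rfl⟩)
    · exact ⟨x, by unfold InRows; omega, rfl⟩
    · exact ⟨x, by unfold InRows; omega, rfl⟩
  · rintro ⟨x, hx, rfl⟩
    unfold InRows at hx
    rcases hx.2.2 with h | h
    · exact Or.inl ⟨x, by omega, rfl⟩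
    · exact Or.inr ⟨x, by omega, rfl⟩

theorem clauseD_eq {n j : ℕ} (h1 : 1 ≤ j) (h2 : j ≤ n) : clauseD n j = prefixClause n j (n - 1) := by
  ext l
  rw [mem_prefixClause h1 h2]
  simp only [clauseD, Finset.mem_image, Finset.mem_filter, Finset.mem_Icc, InRows]
  constructor
  · rintro ⟨x, hx, rfl⟩
    exact ⟨x, by omega, rfl⟩
  · rintro ⟨x, hx, rfl⟩
    exact ⟨x, by omega, rfl⟩

theorem occurs_prefixClause {n j k : ℕ} (h1 : 1 ≤ j) (h2 : j ≤ n) {v : Var} :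
    Occurs v (prefixClause n j k) ↔ InRows n j k v.1 ∧ v.2 = j := by
  simp only [Occurs, Finset.mem_image, mem_prefixClause h1 h2]
  constructor
  · rintro ⟨_, ⟨x, hx, rfl⟩, rfl⟩
    exact ⟨hx, rfl⟩
  · rintro ⟨hx, rfl⟩
    exact ⟨_, ⟨_, hx, rfl⟩, rfl⟩

/-- The available clauses are those of the formula and of `L`; the prefix clauses among them are the
`C(j, k)` with `G j k`. -/
structure Describes (n : ℕ) (L : List (Clause Var)) (G : ℕ → ℕ → Prop) : Prop where
  bounds : ∀ {j k}, G j k → 1 ≤ j ∧ j ≤ n ∧ 1 ≤ k ∧ k + 1 ≤ n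
  full : ∀ {j}, 1 ≤ j → j ≤ n → G j (n - 1)
  learned : ∀ c ∈ L, ∃ j k, G j k ∧ c = prefixClause n j k
  available : ∀ {j k}, G j k → prefixClause n j k ∈ formula n ∨ prefixClause n j k ∈ L

/-- The indices of the transitivity clauses. -/
def Triple (n i j k : ℕ) : Prop :=
  1 ≤ i ∧ i ≤ n ∧ 1 ≤ j ∧ j ≤ n ∧ 1 ≤ k ∧ k ≤ n ∧ i ≠ j ∧ k ≠ i ∧ j ≠ k

/-- The indices of the antisymmetry clauses. -/
def Pair (n i j : ℕ) : Prop := 1 ≤ i ∧ i ≤ n ∧ 1 ≤ j ∧ j ≤ n ∧ i ≠ j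

theorem mem_formula {n : ℕ} {c : Clause Var} : c ∈ formula n ↔
    (∃ i j k, Triple n i j k ∧ c = clauseA i j k) ∨ (∃ i j, Pair n i j ∧ c = clauseB i j) ∨
      ∃ j, 1 ≤ j ∧ j ≤ n ∧ c = prefixClause n j (n - 1) := by
  simp only [formula, Finset.mem_union, Finset.mem_image, Finset.mem_filter, Finset.mem_product,
    Finset.mem_Icc, mem_vars, Triple, Pair, Prod.exists]
  rw [or_assoc]
  refine or_congr ?_ (or_congr ?_ ?_)
  · constructor
    · rintro ⟨i, j, k, h, rfl⟩
      exact ⟨i, j, k, by tauto, rfl⟩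
    · rintro ⟨i, j, k, h, rfl⟩
      exact ⟨i, j, k, by tauto, rfl⟩
  · constructor
    · rintro ⟨i, j, h, rfl⟩
      exact ⟨i, j, by tauto, rfl⟩
    · rintro ⟨i, j, h, rfl⟩
      exact ⟨i, j, by tauto, rfl⟩
  · constructor
    · rintro ⟨j, h, rfl⟩
      exact ⟨j, h.1, h.2, clauseD_eq h.1 h.2⟩
    · rintro ⟨j, h1, h2, rfl⟩
      exact ⟨j, ⟨h1, h2⟩, clauseD_eq h1 h2⟩

section

variable {n : ℕ} {δ : ℝ} {L : List (Clause Var)} {G : ℕ → ℕ → Prop} {s : State Var}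

theorem Describes.cases (hG : Describes n L G) (hs : s.learned = L) {c : Clause Var}
    (hc : InDatabase (config n δ) s c) :
    (∃ i j k, Triple n i j k ∧ c = clauseA i j k) ∨ (∃ i j, Pair n i j ∧ c = clauseB i j) ∨
      ∃ j k, G j k ∧ c = prefixClause n j k := by
  rcases hc with hc | hc
  · rcases mem_formula.1 hc with h | h | ⟨j, h1, h2, rfl⟩
    · exact Or.inl h
    · exact Or.inr (Or.inl h)
    · exact Or.inr (Or.inr ⟨j, _, hG.full h1 h2, rfl⟩)
  · exact Or.inr (Or.inr (hG.learned c (hs ▸ hc)))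

theorem inDatabase_clauseA {i j k : ℕ} (h : Triple n i j k) :
    InDatabase (config n δ) s (clauseA i j k) :=
  Or.inl (mem_formula.2 (Or.inl ⟨i, j, k, h, rfl⟩))

theorem inDatabase_clauseB {i j : ℕ} (h : Pair n i j) :
    InDatabase (config n δ) s (clauseB i j) :=
  Or.inl (mem_formula.2 (Or.inr (Or.inl ⟨i, j, h, rfl⟩)))

theorem Describes.inDatabase (hG : Describes n L G) (hs : s.learned = L) {j k : ℕ} (h : G j k) :
    InDatabase (config n δ) s (prefixClause n j k) :=
  (hG.available h).imp id fun h => hs.symm ▸ h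

theorem Describes.clause_vars (hG : Describes n L G) (c : Clause Var)
    (hc : c ∈ (config n δ).formula ∨ c ∈ L) (l : Lit Var) (hl : l ∈ c) :
    l.1 ∈ (config n δ).vars := by
  change l.1 ∈ vars n
  rw [mem_vars]
  rcases hG.cases (s := restarted δ L) (δ := δ) rfl hc with
    ⟨i, j, k, h, rfl⟩ | ⟨i, j, h, rfl⟩ | ⟨j, k, h, rfl⟩
  · unfold Triple at h
    simp only [clauseA, Finset.mem_insert, Finset.mem_singleton] at hl
    rcases hl with rfl | rfl | rfl <;> simp only [neg, pos] <;> omega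
  · unfold Pair at h
    simp only [clauseB, Finset.mem_insert, Finset.mem_singleton] at hl
    rcases hl with rfl | rfl <;> simp only [neg] <;> omega
  · have hb := hG.bounds h
    obtain ⟨x, hx, rfl⟩ := (mem_prefixClause hb.1 hb.2.1).1 hl
    unfold InRows at hx
    simp only [pos]
    omega

/-! ### Unit propagation and falsification, clause by clause -/

/-- All literals of `c` except possibly `l` are false under the assignment `S`. -/
def AllBut (S : Lit Var → Prop) (c : Clause Var) (l : Lit Var) : Prop :=
  l ∈ c ∧ ∀ l' ∈ c, l' ≠ l → S l'.neg

variable {S : Lit Var → Prop} {l : Lit Var}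

theorem AllBut.mono {S' : Lit Var → Prop} {c : Clause Var} (h : AllBut S c l)
    (hS : ∀ x, S x → S' x) : AllBut S' c l :=
  ⟨h.1, fun x hx hne => hS _ (h.2 x hx hne)⟩

theorem allBut_clauseA {i j k : ℕ} (ht : Triple n i j k) : AllBut S (clauseA i j k) l ↔
    (l = neg i j ∧ S (pos j k) ∧ S (neg i k)) ∨ (l = neg j k ∧ S (pos i j) ∧ S (neg i k)) ∨
      (l = pos i k ∧ S (pos i j) ∧ S (pos j k)) := by
  unfold Triple at ht
  simp only [AllBut, clauseA, Finset.mem_insert, Finset.mem_singleton, forall_eq_or_imp,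
    forall_eq, neg_neg, pos_neg]
  constructor
  · rintro ⟨rfl | rfl | rfl, h1, h2, h3⟩
    · exact Or.inl ⟨rfl, h2 (by simp; omega), h3 (by simp)⟩
    · exact Or.inr (Or.inl ⟨rfl, h1 (by simp; omega), h3 (by simp)⟩)
    · exact Or.inr (Or.inr ⟨rfl, h1 (by simp), h2 (by simp)⟩)
  · rintro (⟨rfl, h1, h2⟩ | ⟨rfl, h1, h2⟩ | ⟨rfl, h1, h2⟩) <;> simp [h1, h2]

theorem allBut_clauseB {i j : ℕ} (ht : Pair n i j) : AllBut S (clauseB i j) l ↔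
    (l = neg i j ∧ S (pos j i)) ∨ (l = neg j i ∧ S (pos i j)) := by
  unfold Pair at ht
  simp only [AllBut, clauseB, Finset.mem_insert, Finset.mem_singleton, forall_eq_or_imp,
    forall_eq, neg_neg]
  constructor
  · rintro ⟨rfl | rfl, h1, h2⟩
    · exact Or.inl ⟨rfl, h2 (by simp; omega)⟩
    · exact Or.inr ⟨rfl, h1 (by simp; omega)⟩
  · rintro (⟨rfl, h1⟩ | ⟨rfl, h1⟩) <;> simp [h1]

theorem allBut_prefixClause {j k : ℕ} (h1 : 1 ≤ j) (h2 : j ≤ n) :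
    AllBut S (prefixClause n j k) l ↔
      ∃ x, InRows n j k x ∧ l = pos x j ∧ ∀ y, InRows n j k y → y ≠ x → S (neg y j) := by
  simp only [AllBut, mem_prefixClause h1 h2]
  constructor
  · rintro ⟨⟨x, hx, rfl⟩, h⟩
    exact ⟨x, hx, rfl, fun y hy hne => h (pos y j) ⟨y, hy, rfl⟩ (by simp [hne])⟩
  · rintro ⟨x, hx, rfl, h⟩
    refine ⟨⟨x, hx, rfl⟩, ?_⟩
    rintro _ ⟨y, hy, rfl⟩ hne
    exact h y hy fun h' => hne (by rw [h'])

/-- All literals of `c` are false under the assignment `S`. -/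
def AllFalse (S : Lit Var → Prop) (c : Clause Var) : Prop := ∀ l ∈ c, S l.neg

theorem allFalse_clauseA {i j k : ℕ} : AllFalse S (clauseA i j k) ↔
    S (pos i j) ∧ S (pos j k) ∧ S (neg i k) := by
  simp only [AllFalse, clauseA, Finset.mem_insert, Finset.mem_singleton, forall_eq_or_imp,
    forall_eq, neg_neg, pos_neg]

theorem allFalse_clauseB {i j : ℕ} : AllFalse S (clauseB i j) ↔ S (pos i j) ∧ S (pos j i) := by
  simp only [AllFalse, clauseB, Finset.mem_insert, Finset.mem_singleton, forall_eq_or_imp,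
    forall_eq, neg_neg]

theorem allFalse_prefixClause {j k : ℕ} (h1 : 1 ≤ j) (h2 : j ≤ n) :
    AllFalse S (prefixClause n j k) ↔ ∀ x, InRows n j k x → S (neg x j) := by
  simp only [AllFalse, mem_prefixClause h1 h2]
  constructor
  · exact fun h x hx => h (pos x j) ⟨x, hx, rfl⟩
  · rintro h _ ⟨x, hx, rfl⟩
    exact h x hx

/-- The assignment `S` is closed under unit propagation with the available clauses. -/
structure Closed (n : ℕ) (G : ℕ → ℕ → Prop) (S : Lit Var → Prop) : Prop where
  clauseA : ∀ {i j k l}, Triple n i j k → AllBut S (clauseA i j k) l → S l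
  clauseB : ∀ {i j l}, Pair n i j → AllBut S (clauseB i j) l → S l
  clauseC : ∀ {j k l}, G j k → AllBut S (prefixClause n j k) l → S l

theorem Closed.of_sound (hG : Describes n L G) (hL : s.learned = L) (h : Sound (config n δ) s)
    (hn : NoConflict (config n δ) s) (hs : Saturated (config n δ) s) (hp : s.pending = ∅) :
    Closed n G (IsTrue s) where
  clauseA ht ha := h.closed hn hs hp (inDatabase_clauseA ht) ha.1 ha.2
  clauseB ht ha := h.closed hn hs hp (inDatabase_clauseB ht) ha.1 ha.2
  clauseC hg ha := h.closed hn hs hp (hG.inDatabase hL hg) ha.1 ha.2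

theorem Closed.of_allBut (hG : Describes n L G) (hL : s.learned = L) (h : Closed n G S)
    {c : Clause Var} (hc : InDatabase (config n δ) s c) (ha : AllBut S c l) : S l := by
  rcases hG.cases hL hc with ⟨i, j, k, ht, rfl⟩ | ⟨i, j, ht, rfl⟩ | ⟨j, k, hg, rfl⟩
  · exact h.clauseA ht ha
  · exact h.clauseB ht ha
  · exact h.clauseC hg ha

end

end OrderingPrinciple

/-! ### The clause learned from a conflict in column `m` -/

namespace OrderingPrinciple

open CDCL

/-- The set of literals that contains `P_{x,y}` if `P x y` and `¬ P_{x,y}` if `N x y`. -/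
def litSet (P N : ℕ → ℕ → Prop) (l : Lit Var) : Prop :=
  (l.2 = true ∧ P l.1.1 l.1.2) ∨ (l.2 = false ∧ N l.1.1 l.1.2)

@[simp] theorem litSet_pos {P N : ℕ → ℕ → Prop} {x y : ℕ} : litSet P N (pos x y) ↔ P x y := by
  simp [litSet, pos]

@[simp] theorem litSet_neg {P N : ℕ → ℕ → Prop} {x y : ℕ} : litSet P N (neg x y) ↔ N x y := by
  simp [litSet, neg]

theorem litSet_ext {P N : ℕ → ℕ → Prop} {S : Lit Var → Prop} :
    (∀ l, S l → litSet P N l) ↔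
      (∀ x y, S (pos x y) → P x y) ∧ ∀ x y, S (neg x y) → N x y := by
  constructor
  · exact fun h => ⟨fun x y hs => litSet_pos.1 (h _ hs), fun x y hs => litSet_neg.1 (h _ hs)⟩
  · rintro ⟨h1, h2⟩ l hl
    obtain ⟨i, j, rfl | rfl⟩ := lit_cases l
    · exact litSet_pos.2 (h1 _ _ hl)
    · exact litSet_neg.2 (h2 _ _ hl)

/-- The indices of a conflict that arises when `P_{m,p}` is propagated while `P_{i,p}` is false for all
`i < m`. If `d` holds, `P_{p,q}` is true, and `P_{x,q}` is false for `x` in `Q`; the other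
variables are unassigned. The complement of `P_{a,p}` is the unique implication point. -/
structure Setup (n : ℕ) (G : ℕ → ℕ → Prop) (d : Prop) (p q m a : ℕ) (Q : ℕ → Prop) : Prop where
  p_pos : 1 ≤ p
  p_lt : p < m
  m_le : m ≤ n
  a_pos : 1 ≤ a
  a_lt : a < m
  a_ne : a ≠ p
  q_pos : d → 1 ≤ q
  q_lt : d → q < m
  q_ne : d → q ≠ p
  rows : ∀ x, Q x → d ∧ 1 ≤ x ∧ x < m ∧ x ≠ p ∧ x ≠ q
  pivot : G p (m - 1)
  pivot_le : ∀ {k}, G p k → m ≤ k + 1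
  column_le : ∀ {k}, G m k → m ≤ k + 1
  q_column : ∀ {k}, d → G q k → InRows n q k p

/-- The trail below the propagation of `P_{m,p}`. -/
structure BaseTrail (d : Prop) (p q m a : ℕ) (Q : ℕ → Prop) (lvl : ℕ) (B : List (Entry Var)) :
    Prop where
  pos_iff : ∀ x y, (∃ e ∈ B, e.lit = pos x y) ↔ d ∧ x = p ∧ y = q
  neg_iff : ∀ x y, (∃ e ∈ B, e.lit = neg x y) ↔
    (y = p ∧ 1 ≤ x ∧ x < m ∧ x ≠ p) ∨ (y = q ∧ Q x)
  uip : ∃ e ∈ B, e.lit = neg a p ∧ e.level = lvl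
  level : ∀ e ∈ B, e.level = lvl → e.lit = neg a p ∨ (d ∧ e.lit.1.2 = q)

variable {n : ℕ} {G : ℕ → ℕ → Prop} {d : Prop} {p q m a lvl : ℕ} {Q : ℕ → Prop}
  {E B : List (Entry Var)}

theorem BaseTrail.cases (hB : BaseTrail d p q m a Q lvl B) {e : Entry Var} (he : e ∈ B) :
    (d ∧ e.lit = pos p q) ∨ (∃ x, e.lit = neg x p ∧ 1 ≤ x ∧ x < m ∧ x ≠ p) ∨
      (∃ x, e.lit = neg x q ∧ Q x) := by
  obtain ⟨x, y, h | h⟩ := lit_cases e.lit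
  · obtain ⟨hd, rfl, rfl⟩ := (hB.pos_iff x y).1 ⟨e, he, h⟩
    exact Or.inl ⟨hd, h⟩
  · rcases (hB.neg_iff x y).1 ⟨e, he, h⟩ with ⟨rfl, hx⟩ | ⟨rfl, hx⟩
    · exact Or.inr (Or.inl ⟨x, h, hx⟩)
    · exact Or.inr (Or.inr ⟨x, h, hx⟩)

/-- The clause to be learned, in terms of rows. -/
theorem mem_target (h : Setup n G d p q m a Q) {l : Lit Var} :
    l ∈ prefixClause n p (m - 2) ↔ ∃ x, (1 ≤ x ∧ x < m ∧ x ≠ p) ∧ l = pos x p := by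
  have h1 := h.p_lt
  have h2 := h.m_le
  have h3 := h.p_pos
  rw [mem_prefixClause h3 (by omega)]
  refine exists_congr fun x => and_congr_left fun _ => ?_
  unfold InRows
  omega

theorem mem_pivot (h : Setup n G d p q m a Q) {l : Lit Var} :
    l ∈ prefixClause n p (m - 1) ↔ ∃ x, (1 ≤ x ∧ x ≤ m ∧ x ≠ p) ∧ l = pos x p := by
  have h1 := h.p_lt
  have h2 := h.m_le
  have h3 := h.p_pos
  rw [mem_prefixClause h3 (by omega)]
  refine exists_congr fun x => and_congr_left fun _ => ?_
  unfold InRows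
  omega

theorem mem_prefixClause_self (h1 : 1 ≤ m) (h2 : m ≤ n) {l : Lit Var} :
    l ∈ prefixClause n m (m - 1) ↔ ∃ x, (1 ≤ x ∧ x < m) ∧ l = pos x m := by
  rw [mem_prefixClause h1 h2]
  refine exists_congr fun x => and_congr_left fun _ => ?_
  unfold InRows
  omega

/-- The literals implied after `P_{a,p}` becomes false, with their reasons. -/
inductive Implied (n : ℕ) (d : Prop) (p q m : ℕ) : Lit Var → Clause Var → Prop
  | pivot : Implied n d p q m (pos m p) (prefixClause n p (m - 1))
  | column (i : ℕ) (h1 : 1 ≤ i) (h2 : i < m) (h3 : i ≠ p) :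
      Implied n d p q m (neg i m) (clauseA i m p)
  | anti : Implied n d p q m (neg p m) (clauseB m p)
  | row (r : Clause Var) (hd : d) : Implied n d p q m (pos m q) r
  | close : Implied n d p q m (pos p m) (prefixClause n m (m - 1))

/-- Resolving with `A(i, m, p)` moves the literals of column `m` to column `p`, and resolving with
`C(p, m - 1)` removes `¬ P_{m,p}`. Both possible conflict clauses are covered, and the order of the
implied literals is not needed. -/
theorem firstUIP_of_close (h : Setup n G d p q m a Q) (hB : BaseTrail d p q m a Q lvl B)
    (hok : WellFormed (E ++ B))
    (hE : ∀ e ∈ E, e.level = lvl ∧ ∃ r, e.reason = some r ∧ Implied n d p q m e.lit r)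
    {c : Clause Var} (hc : c = prefixClause n m (m - 1) ∨ c = clauseB m p)
    (hf : ∀ x ∈ c, ∃ e ∈ E ++ B, e.lit = x.neg) :
    firstUIP lvl (E ++ B) c = prefixClause n p (m - 2) := by
  obtain ⟨hp, hpm, hmn, ha, ham, hap, hq, hqm, hqp, hQ, -, -, -, -⟩ := id h
  let U := litSet (fun x y => 1 ≤ x ∧ x < m ∧ ((y = p ∧ x ≠ p) ∨ y = m))
    (fun x y => (x = m ∧ y = p) ∨ (x = p ∧ y = m))
  -- `R i` follows row `i` from column `m` to `P_{i,p}`, which shows that this literal is learned.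
  -- `W` leads through the other rows of column `m` and `¬ P_{m,p}` to `P_{a,p}`, avoiding
  -- `P_{a,m}`, so it shares only `P_{a,p}` with `R a`. The entry `¬ P_{p,m}` of `R i` serves the
  -- conflict with `B(m, p)`.
  let R : ℕ → Lit Var → Prop := fun i =>
    litSet (fun x y => x = i ∧ (y = p ∨ y = m)) (fun x y => x = p ∧ y = m)
  let W := litSet (fun x y => (x = a ∧ y = p) ∨ (1 ≤ x ∧ x < m ∧ x ≠ a ∧ y = m))
    (fun x y => x = m ∧ y = p)
  have hclose : ∀ l, l ∈ prefixClause n m (m - 1) ↔ ∃ x, (1 ≤ x ∧ x < m) ∧ l = pos x m :=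
    fun l => mem_prefixClause_self (by omega) hmn
  refine firstUIP_eq (w := pos a p) U
    (fun V => V = W ∨ ∃ i, 1 ≤ i ∧ i < m ∧ i ≠ p ∧ V = R i) hok
    (fun e he => (hE e he).1) ?_ ?_ ?_ ?_ ?_ ?_ ?_ hf ?_
  · rintro e he hU
    obtain ⟨-, r, hr, hi⟩ := hE e he
    refine ⟨r, hr, ?_⟩
    generalize e.lit = l at hi hU
    cases hi with
    | pivot =>
      refine ⟨?_, ?_⟩
      · simp only [mem_pivot h]
        rintro _ ⟨x, hx, rfl⟩ hne
        simp [U] at hne ⊢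
        omega
      · rintro V (rfl | ⟨i, h1, h2, h3, rfl⟩) hV
        · exact ⟨pos a p, (mem_pivot h).2 ⟨a, by omega, rfl⟩, by simp; omega, by simp [W]⟩
        · simp [R, pos_neg] at hV
          omega
    | column i h1 h2 h3 =>
      refine ⟨?_, ?_⟩
      · simp [clauseA, U]; omega
      · rintro V (rfl | ⟨j, h4, h5, h6, rfl⟩) hV
        all_goals simp only [clauseA, Finset.mem_insert, Finset.mem_singleton,
          exists_eq_or_imp, exists_eq_left]
        · refine Or.inr (Or.inl ⟨?_, ?_⟩) <;> simp [W] <;> omega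
        · simp [R, neg_neg] at hV ⊢
          omega
    | anti =>
      refine ⟨?_, ?_⟩
      · simp [clauseB, U]
      · rintro V (rfl | ⟨j, h4, h5, h6, rfl⟩) hV
        all_goals simp only [clauseB, Finset.mem_insert, Finset.mem_singleton,
          exists_eq_or_imp, exists_eq_left]
        · refine Or.inl ⟨?_, ?_⟩ <;> simp [W] <;> omega
        · simp [R, neg_neg] at hV ⊢
          omega
    -- `P_{m,q}` is a by-product of `P_{m,p}` and `P_{p,q}`. Its complement is outside `U`, so it is
    -- never resolved and its reason does not matter.
    | row _ hd =>
      have := hqm hd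
      have := hqp hd
      simp [U, pos_neg] at hU
      omega
    | close =>
      refine ⟨?_, ?_⟩
      · simp only [hclose]
        rintro _ ⟨x, hx, rfl⟩ hne
        simp [U]
        omega
      · rintro V (rfl | ⟨i, h1, h2, h3, rfl⟩) hV
        · simp [W, pos_neg] at hV
          omega
        · refine ⟨pos i m, (hclose _).2 ⟨i, by omega, rfl⟩, by simp; omega, by simp [R]⟩
  · obtain ⟨e, he, h1, h2⟩ := hB.uip
    exact ⟨e, he, by rw [h1, neg_neg], h2⟩
  · intro e he hl hU
    rcases hB.level e he hl with h1 | ⟨hd, h1⟩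
    · rw [h1, neg_neg]
    · have := hqm hd
      have := hqp hd
      rcases hB.cases he with ⟨-, h2⟩ | ⟨x, h2, h3⟩ | ⟨x, h2, h3⟩
      · simp [U, h2, pos_neg] at hU
        omega
      · rw [h2] at h1
        simp [neg] at h1
        omega
      · simp [U, h2, neg_neg] at hU
        omega
  · intro e he hU
    rw [mem_target h]
    rcases hB.cases he with ⟨hd, h2⟩ | ⟨x, h2, h3⟩ | ⟨x, h2, h3⟩
    · have := hqm hd
      have := hqp hd
      simp [U, h2, pos_neg] at hU
      omega
    · exact ⟨x, by omega, by rw [h2, neg_neg]⟩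
    · have hd := (hQ x h3).1
      have := hqm hd
      have := hqp hd
      simp [U, h2, neg_neg] at hU
      omega
  · refine ⟨R a, W, Or.inr ⟨a, ha, ham, hap, rfl⟩, Or.inl rfl, ?_, ?_⟩
    · intro x h1 h2
      obtain ⟨i, j, rfl | rfl⟩ := lit_cases x
      · simp [R, W] at h1 h2 ⊢
        omega
      · simp [R, W] at h1 h2 ⊢
        omega
    · intro e he hV
      rcases hB.cases he with ⟨hd, h2⟩ | ⟨x, h2, h3⟩ | ⟨x, h2, h3⟩
      · have := hqm hd
        have := hqp hd
        simp [R, W, h2, pos_neg] at hV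
        omega
      · simp [R, W, h2, neg_neg] at hV ⊢
        omega
      · have hd := (hQ x h3).1
        have := hqm hd
        have := hqp hd
        simp [R, W, h2, neg_neg] at hV ⊢
        omega
  · intro t ht
    obtain ⟨x, hx, rfl⟩ := (mem_target h).1 ht
    refine ⟨R x, Or.inr ⟨x, by omega, by omega, by omega, rfl⟩, fun y hy hV => ?_⟩
    obtain ⟨x', hx', rfl⟩ := (mem_target h).1 hy
    simp [R] at hV
    rw [hV]
  · rcases hc with rfl | rfl
    · simp only [hclose]
      rintro _ ⟨x, hx, rfl⟩
      simp [U]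
      omega
    · simp [clauseB, U]
  · rintro V (rfl | ⟨i, h1, h2, h3, rfl⟩)
    · rcases hc with rfl | rfl
      · exact ⟨pos p m, (hclose _).2 ⟨p, by omega, rfl⟩, by simp [W]; omega⟩
      · exact ⟨neg m p, by simp [clauseB], by simp [W]⟩
    · rcases hc with rfl | rfl
      · exact ⟨pos i m, (hclose _).2 ⟨i, by omega, rfl⟩, by simp [R]⟩
      · exact ⟨neg p m, by simp [clauseB], by simp [R]⟩

/-! ### Conflict analysis through the columns `n - 1` and `n` -/

/-- The literals implied after `P_{a,p}` becomes false, with their reasons, when `m = n - 1`. -/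
inductive ImpliedPenultimate (n p m : ℕ) : Lit Var → Clause Var → Prop
  | pivot : ImpliedPenultimate n p m (pos m p) (prefixClause n p (m - 1))
  | column (i : ℕ) (h1 : 1 ≤ i) (h2 : i < m) (h3 : i ≠ p) :
      ImpliedPenultimate n p m (neg i m) (clauseA i m p)
  | anti : ImpliedPenultimate n p m (neg p m) (clauseB m p)
  | last : ImpliedPenultimate n p m (pos n m) (prefixClause n m (n - 1))
  | lastColumn (i : ℕ) (h1 : 1 ≤ i) (h2 : i < m) :
      ImpliedPenultimate n p m (neg i n) (clauseA i n m)
  | lastAnti : ImpliedPenultimate n p m (neg m n) (clauseB n m)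
  | row (r : Clause Var) : ImpliedPenultimate n p m (pos n p) r
  | close : ImpliedPenultimate n p m (pos m n) (prefixClause n n (n - 1))

theorem firstUIP_of_penultimate (h : Setup n G False p q m a Q)
    (hB : BaseTrail False p q m a Q lvl B) (hn : m + 1 = n) (hok : WellFormed (E ++ B))
    (hE : ∀ e ∈ E, e.level = lvl ∧ ∃ r, e.reason = some r ∧ ImpliedPenultimate n p m e.lit r)
    {c : Clause Var} (hc : c = prefixClause n n (n - 1) ∨ c = clauseB n m)
    (hf : ∀ x ∈ c, ∃ e ∈ E ++ B, e.lit = x.neg) :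
    firstUIP lvl (E ++ B) c = prefixClause n p (m - 2) := by
  obtain ⟨hp, hpm, hmn, ha, ham, hap, -, -, -, hQ, -, -, -, -⟩ := id h
  have hBc : ∀ e ∈ B, ∃ x, e.lit = neg x p ∧ 1 ≤ x ∧ x < m ∧ x ≠ p := by
    intro e he
    rcases hB.cases he with ⟨⟨⟩, -⟩ | h | ⟨x, -, h3⟩
    · exact h
    · exact (hQ x h3).1.elim
  let U := litSet (fun x y => 1 ≤ x ∧ ((x < m ∧ ((y = p ∧ x ≠ p) ∨ y = m)) ∨ (x < n ∧ y = n)))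
    (fun x y => (x = m ∧ y = p) ∨ (x = n ∧ y = m) ∨ (x = m ∧ y = n))
  -- The routes of `firstUIP_of_close`, begun one column later: row `i` now runs through the columns
  -- `n`, `m`, `p`, while `W` uses `¬ P_{n,m}` and `¬ P_{m,p}` and avoids row `a` outside column
  -- `p`. `¬ P_{m,n}` serves the conflict with `B(n, m)`.
  let R : ℕ → Lit Var → Prop := fun i =>
    litSet (fun x y => x = i ∧ (y = p ∨ y = m ∨ y = n)) (fun x y => x = m ∧ y = n)
  let W := litSet
    (fun x y => (x = a ∧ y = p) ∨ (1 ≤ x ∧ x ≠ a ∧ ((x < m ∧ y = m) ∨ (x < n ∧ y = n))))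
    (fun x y => (x = m ∧ y = p) ∨ (x = n ∧ y = m))
  have hclose : ∀ l, l ∈ prefixClause n n (n - 1) ↔ ∃ x, (1 ≤ x ∧ x < n) ∧ l = pos x n :=
    fun l => mem_prefixClause_self (by omega) le_rfl
  have hlast : ∀ l, l ∈ prefixClause n m (n - 1) ↔
      ∃ x, (1 ≤ x ∧ x ≤ n ∧ x ≠ m) ∧ l = pos x m := by
    intro l
    rw [mem_prefixClause (by omega) hmn]
    refine exists_congr fun x => and_congr_left fun _ => ?_
    unfold InRows
    omega
  refine firstUIP_eq (w := pos a p) U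
    (fun V => V = W ∨ ∃ i, 1 ≤ i ∧ i < m ∧ i ≠ p ∧ V = R i) hok
    (fun e he => (hE e he).1) ?_ ?_ ?_ ?_ ?_ ?_ ?_ hf ?_
  · rintro e he hU
    obtain ⟨-, r, hr, hi⟩ := hE e he
    refine ⟨r, hr, ?_⟩
    generalize e.lit = l at hi hU
    cases hi with
    | pivot =>
      refine ⟨?_, ?_⟩
      · simp only [mem_pivot h]
        rintro _ ⟨x, hx, rfl⟩ hne
        simp [U] at hne ⊢
        omega
      · rintro V (rfl | ⟨i, h1, h2, h3, rfl⟩) hV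
        · exact ⟨pos a p, (mem_pivot h).2 ⟨a, by omega, rfl⟩, by simp; omega, by simp [W]⟩
        · simp [R, pos_neg] at hV
          omega
    | column i h1 h2 h3 =>
      refine ⟨?_, ?_⟩
      · simp [clauseA, U]; omega
      · rintro V (rfl | ⟨j, h4, h5, h6, rfl⟩) hV
        all_goals simp only [clauseA, Finset.mem_insert, Finset.mem_singleton,
          exists_eq_or_imp, exists_eq_left]
        · refine Or.inr (Or.inl ⟨?_, ?_⟩) <;> simp [W] <;> omega
        · simp [R, neg_neg] at hV ⊢
          omega
    | anti =>
      refine ⟨?_, ?_⟩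
      · simp [clauseB, U]
      · rintro V (rfl | ⟨j, h4, h5, h6, rfl⟩) hV
        all_goals simp only [clauseB, Finset.mem_insert, Finset.mem_singleton,
          exists_eq_or_imp, exists_eq_left]
        · refine Or.inl ⟨?_, ?_⟩ <;> simp [W] <;> omega
        · simp [R, neg_neg] at hV ⊢
          omega
    | last =>
      refine ⟨?_, ?_⟩
      · simp only [hlast]
        rintro _ ⟨x, hx, rfl⟩ hne
        simp [U]
        simp at hne
        omega
      · rintro V (rfl | ⟨i, h1, h2, h3, rfl⟩) hV
        · exact ⟨pos p m, (hlast _).2 ⟨p, by omega, rfl⟩, by simp; omega, by simp [W]; omega⟩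
        · simp [R, pos_neg] at hV
          omega
    | lastColumn i h1 h2 =>
      refine ⟨?_, ?_⟩
      · simp [clauseA, U]; omega
      · rintro V (rfl | ⟨j, h4, h5, h6, rfl⟩) hV
        all_goals simp only [clauseA, Finset.mem_insert, Finset.mem_singleton,
          exists_eq_or_imp, exists_eq_left]
        · refine Or.inr (Or.inl ⟨?_, ?_⟩) <;> simp [W] <;> omega
        · simp [R, neg_neg] at hV ⊢
          omega
    | lastAnti =>
      refine ⟨?_, ?_⟩
      · simp [clauseB, U]
      · rintro V (rfl | ⟨j, h4, h5, h6, rfl⟩) hV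
        all_goals simp only [clauseB, Finset.mem_insert, Finset.mem_singleton,
          exists_eq_or_imp, exists_eq_left]
        · refine Or.inl ⟨?_, ?_⟩ <;> simp [W] <;> omega
        · simp [R, neg_neg] at hV ⊢
          omega
    | row =>
      simp [U, pos_neg] at hU
      omega
    | close =>
      refine ⟨?_, ?_⟩
      · simp only [hclose]
        rintro _ ⟨x, hx, rfl⟩ hne
        simp [U]
        omega
      · rintro V (rfl | ⟨i, h1, h2, h3, rfl⟩) hV
        · simp [W, pos_neg] at hV
          omega
        · refine ⟨pos i n, (hclose _).2 ⟨i, by omega, rfl⟩, by simp; omega, by simp [R]⟩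
  · obtain ⟨e, he, h1, h2⟩ := hB.uip
    exact ⟨e, he, by rw [h1, neg_neg], h2⟩
  · intro e he hl hU
    rcases hB.level e he hl with h1 | ⟨⟨⟩, -⟩
    rw [h1, neg_neg]
  · intro e he hU
    rw [mem_target h]
    obtain ⟨x, h2, h3⟩ := hBc e he
    exact ⟨x, by omega, by rw [h2, neg_neg]⟩
  · refine ⟨R a, W, Or.inr ⟨a, ha, ham, hap, rfl⟩, Or.inl rfl, ?_, ?_⟩
    · intro x h1 h2
      obtain ⟨i, j, rfl | rfl⟩ := lit_cases x
      · simp [R, W] at h1 h2 ⊢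
        omega
      · simp [R, W] at h1 h2 ⊢
        omega
    · intro e he hV
      obtain ⟨x, h2, h3⟩ := hBc e he
      simp [R, W, h2, neg_neg] at hV ⊢
      omega
  · intro t ht
    obtain ⟨x, hx, rfl⟩ := (mem_target h).1 ht
    refine ⟨R x, Or.inr ⟨x, by omega, by omega, by omega, rfl⟩, fun y hy hV => ?_⟩
    obtain ⟨x', hx', rfl⟩ := (mem_target h).1 hy
    simp [R] at hV
    rw [hV]
  · rcases hc with rfl | rfl
    · simp only [hclose]
      rintro _ ⟨x, hx, rfl⟩
      simp [U]
      omega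
    · simp [clauseB, U]
  · rintro V (rfl | ⟨i, h1, h2, h3, rfl⟩)
    · rcases hc with rfl | rfl
      · exact ⟨pos p n, (hclose _).2 ⟨p, by omega, rfl⟩, by simp [W]; omega⟩
      · exact ⟨neg n m, by simp [clauseB], by simp [W]⟩
    · rcases hc with rfl | rfl
      · exact ⟨pos i n, (hclose _).2 ⟨i, by omega, rfl⟩, by simp [R]⟩
      · exact ⟨neg m n, by simp [clauseB], by simp [R]⟩

end OrderingPrinciple

/-! ### The propagation that ends in a conflict -/

namespace OrderingPrinciple

open CDCL

section

variable {n : ℕ} {δ : ℝ} {L : List (Clause Var)} {G : ℕ → ℕ → Prop} {s : State Var}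

theorem isUnitClause_iff {c : Clause Var} {l : Lit Var} :
    IsUnitClause s c l ↔ AllBut (IsTrue s) c l ∧ ¬ IsTrue s l ∧ ¬ IsTrue s l.neg := by
  unfold IsUnitClause AllBut
  rw [assigned_iff]
  simp only [IsFalse]
  tauto

theorem Describes.allBut_cases (hG : Describes n L G) (hs : s.learned = L) {S : Lit Var → Prop}
    {c : Clause Var} (hc : InDatabase (config n δ) s c) {l : Lit Var} (h : AllBut S c l) :
    (∃ i j k, Triple n i j k ∧ c = clauseA i j k ∧
      ((l = neg i j ∧ S (pos j k) ∧ S (neg i k)) ∨ (l = neg j k ∧ S (pos i j) ∧ S (neg i k)) ∨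
        (l = pos i k ∧ S (pos i j) ∧ S (pos j k)))) ∨
    (∃ i j, Pair n i j ∧ c = clauseB i j ∧ l = neg i j ∧ S (pos j i)) ∨
    ∃ j k x, G j k ∧ c = prefixClause n j k ∧ InRows n j k x ∧ l = pos x j ∧
      ∀ y, InRows n j k y → y ≠ x → S (neg y j) := by
  rcases hG.cases hs hc with ⟨i, j, k, ht, rfl⟩ | ⟨i, j, ht, rfl⟩ | ⟨j, k, hg, rfl⟩
  · exact Or.inl ⟨i, j, k, ht, rfl, (allBut_clauseA ht).1 h⟩
  · refine Or.inr (Or.inl ?_)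
    rcases (allBut_clauseB ht).1 h with h | h
    · exact ⟨i, j, ht, rfl, h⟩
    · refine ⟨j, i, ?_, clauseB_comm i j, h⟩
      unfold Pair at ht ⊢
      omega
  · obtain ⟨x, hx⟩ := (allBut_prefixClause (hG.bounds hg).1 (hG.bounds hg).2.1).1 h
    exact Or.inr (Or.inr ⟨j, k, x, hg, rfl, hx⟩)

theorem Describes.falsified_cases (hG : Describes n L G) (hs : s.learned = L)
    {c : Clause Var} (hc : InDatabase (config n δ) s c) (h : Falsified s c) :
    (∃ i j k, Triple n i j k ∧ IsTrue s (pos i j) ∧ IsTrue s (pos j k) ∧ IsTrue s (neg i k)) ∨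
    (∃ i j, Pair n i j ∧ c = clauseB i j ∧ IsTrue s (pos i j) ∧ IsTrue s (pos j i)) ∨
    ∃ j k, G j k ∧ c = prefixClause n j k ∧ ∀ y, InRows n j k y → IsTrue s (neg y j) := by
  rcases hG.cases hs hc with ⟨i, j, k, ht, rfl⟩ | ⟨i, j, ht, rfl⟩ | ⟨j, k, hg, rfl⟩
  · exact Or.inl ⟨i, j, k, ht, allFalse_clauseA.1 h⟩
  · exact Or.inr (Or.inl ⟨i, j, ht, rfl, allFalse_clauseB.1 h⟩)
  · exact Or.inr (Or.inr ⟨j, k, hg, rfl,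
      (allFalse_prefixClause (hG.bounds hg).1 (hG.bounds hg).2.1).1 h⟩)

/-- The true literals of `s` are among the `P_{x,y}` with `P x y` and the `¬ P_{x,y}` with
`N x y`. -/
structure Within (P N : ℕ → ℕ → Prop) (s : State Var) : Prop where
  pos : ∀ {x y}, IsTrue s (pos x y) → P x y
  neg : ∀ {x y}, IsTrue s (neg x y) → N x y

theorem Within.imply {P N : ℕ → ℕ → Prop} (h : Within P N s) {c : Clause Var} {l : Lit Var}
    (hl : litSet P N l) : Within P N (s.imply c l) where
  pos := by
    intro x y hx
    rcases (isTrue_imply s c l _).1 hx with rfl | hx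
    · exact litSet_pos.1 hl
    · exact h.pos hx
  neg := by
    intro x y hx
    rcases (isTrue_imply s c l _).1 hx with rfl | hx
    · exact litSet_neg.1 hl
    · exact h.neg hx

/-- On top of `B` there are only implied literals of level `lvl` with reasons according to `R`. -/
def Above (B : List (Entry Var)) (lvl : ℕ) (R : Lit Var → Clause Var → Prop) (s : State Var) :
    Prop :=
  s.level = lvl ∧ ∃ E, s.trail = E ++ B ∧
    ∀ e ∈ E, e.level = lvl ∧ ∃ r, e.reason = some r ∧ R e.lit r

theorem Above.imply {B : List (Entry Var)} {lvl : ℕ} {R : Lit Var → Clause Var → Prop}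
    (h : Above B lvl R s) {c : Clause Var} {l : Lit Var} (hl : R l c) :
    Above B lvl R (s.imply c l) := by
  obtain ⟨h1, E, h2, h3⟩ := h
  refine ⟨h1, ⟨l, s.level, some c⟩ :: E, by simp [h2], ?_⟩
  intro e he
  rcases List.mem_cons.1 he with rfl | he
  · exact ⟨h1, c, rfl, hl⟩
  · exact h3 e he

theorem Above.base {B : List (Entry Var)} {lvl : ℕ} {R : Lit Var → Clause Var → Prop}
    (h : Above B lvl R s) {l : Lit Var} (hl : ∃ e ∈ B, e.lit = l) : IsTrue s l := by
  obtain ⟨-, E, h2, -⟩ := h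
  obtain ⟨e, he, rfl⟩ := hl
  exact ⟨e, by simp [h2, he], rfl⟩

end

variable {n : ℕ} {δ : ℝ} {L : List (Clause Var)} {G : ℕ → ℕ → Prop} {d : Prop} {p q m a lvl : ℕ}
  {Q : ℕ → Prop} {B : List (Entry Var)} {R : Lit Var → Clause Var → Prop}

/-- The variables that are true in the base trail. -/
def basePos (d : Prop) (p q : ℕ) (x y : ℕ) : Prop := d ∧ x = p ∧ y = q

/-- The variables that are false in the base trail. -/
def baseNeg (p q m : ℕ) (Q : ℕ → Prop) (x y : ℕ) : Prop :=
  (y = p ∧ 1 ≤ x ∧ x < m ∧ x ≠ p) ∨ (y = q ∧ Q x)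

/-- The states from the propagation of `¬ P_{a,p}` to that of `P_{m,p}`. -/
structure BeforePivot (d : Prop) (p q m a : ℕ) (Q : ℕ → Prop) (B : List (Entry Var)) (lvl : ℕ)
    (R : Lit Var → Clause Var → Prop) (s : State Var) : Prop where
  above : Above B lvl R s
  within : Within (fun x y => basePos d p q x y ∨ (x = m ∧ y = p) ∨ (x = p ∧ y = m))
    (fun x y => baseNeg p q m Q x y ∨ (x = a ∧ y = m)) s
  focus : s.focus = some (neg a p) ∨ s.focus = some (neg a m)
  pending : ∀ l ∈ s.pending, l = pos m p ∨ l = pos p m ∨ l = neg a m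
  pivot_pending : IsTrue s (pos m p) → pos m p ∈ s.pending
  pivot_of_close : IsTrue s (pos p m) → IsTrue s (pos m p)
  pivot_of_column : IsTrue s (neg a m) → IsTrue s (pos m p)

/-- The states during the propagation of `P_{m,p}`. -/
structure DuringPivot (d : Prop) (p q m : ℕ) (Q : ℕ → Prop) (B : List (Entry Var)) (lvl : ℕ)
    (R : Lit Var → Clause Var → Prop) (s : State Var) : Prop where
  above : Above B lvl R s
  within : Within (fun x y => basePos d p q x y ∨ (x = m ∧ y = p) ∨ (d ∧ x = m ∧ y = q))
    (fun x y => baseNeg p q m Q x y ∨ (1 ≤ x ∧ x < m ∧ y = m)) s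
  focus : s.focus = some (pos m p)
  pivot : IsTrue s (pos m p)
  pending : ∀ l ∈ s.pending, (∃ i, 1 ≤ i ∧ i < m ∧ l = neg i m) ∨ (d ∧ l = pos m q)

variable {s : State Var}

/-- Only clauses containing `P_{a,p}` or `P_{a,m}` are examined, and few of them can be unit. The
third case arises only for `m = 3`: just `P_{a,m}` can be false in column `m`, so `a` and `p` must
be all the rows below `m`. -/
theorem BeforePivot.unit (h : Setup n G d p q m a Q) (hB : BaseTrail d p q m a Q lvl B)
    (hG : Describes n L G) (hL : s.learned = L) (hs : BeforePivot d p q m a Q B lvl R s)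
    {c : Clause Var} {l : Lit Var} (hc : InDatabase (config n δ) s c) (he : Examined s.focus c)
    (hu : IsUnitClause s c l) :
    (l = pos m p ∧ c = prefixClause n p (m - 1)) ∨
      (l = neg a m ∧ c = clauseA a m p ∧ IsTrue s (pos m p)) ∨
      (l = pos p m ∧ c = prefixClause n m (m - 1) ∧ G m (m - 1) ∧ IsTrue s (pos m p)) := by
  obtain ⟨h1, h2, h3⟩ := isUnitClause_iff.1 hu
  have hap : IsTrue s (neg a p) :=
    hs.above.base ((hB.neg_iff a p).2 (Or.inl ⟨rfl, h.a_pos, h.a_lt, h.a_ne⟩))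
  have hc' : pos a p ∈ c ∨ pos a m ∈ c := by
    rcases hs.focus with hf | hf
    · rw [hf] at he; exact Or.inl he
    · rw [hf] at he; exact Or.inr he
  obtain ⟨hp, hpm, hmn, ha, ham, ha_ne, hq, hqm, hqp, hQ, hpiv, hpiv_le, hcol, hqcol⟩ := h
  have hP := @hs.within.pos
  have hN := @hs.within.neg
  simp only [basePos, baseNeg] at hP hN
  rcases hG.allBut_cases hL hc h1 with ⟨i, j, k, ht, rfl, h4⟩ | ⟨i, j, ht, rfl, rfl, h4⟩ |
    ⟨j, k, x, hg, rfl, hx, rfl, h4⟩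
  · have hik : i = a ∧ (k = p ∨ k = m) := by
      simp [clauseA] at hc'
      omega
    obtain ⟨rfl, hk⟩ := hik
    unfold Triple at ht
    rcases h4 with ⟨rfl, h4, h5⟩ | ⟨rfl, h4, h5⟩ | ⟨rfl, h4, h5⟩
    · rcases hP h4 with ⟨hd, rfl, rfl⟩ | ⟨rfl, rfl⟩ | ⟨rfl, rfl⟩
      · have := hqm hd
        have := hqp hd
        omega
      · exact Or.inr (Or.inl ⟨rfl, rfl, h4⟩)
      · exact absurd hap h2
    · have := hP h4
      omega
    · have := hP h4
      omega
  · simp [clauseB] at hc'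
  · have hb := hG.bounds hg
    simp only [mem_prefixClause hb.1 hb.2.1, pos_inj] at hc'
    have hj : j = p ∨ j = m := by
      rcases hc' with ⟨y, -, -, rfl⟩ | ⟨y, -, -, rfl⟩ <;> simp
    clear hc'
    rcases hj with rfl | rfl
    · have hk := hpiv_le hg
      have hxm : x = m := by
        by_contra hne
        have := hN (h4 m (by unfold InRows; omega) (Ne.symm hne))
        grind
      have hk' : k = m - 1 := by
        by_contra hne
        have := hN (h4 (m + 1) (by unfold InRows; omega) (by omega))
        grind
      exact Or.inl ⟨by rw [hxm], by rw [hk']⟩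
    · have hk := hcol hg
      have hxp : x = p := by
        by_contra hne
        have := hN (h4 p (by unfold InRows; omega) (Ne.symm hne))
        grind
      have hk' : k = j - 1 := by
        by_contra hne
        have := hN (h4 (j + 1) (by unfold InRows; omega) (by omega))
        grind
      subst hk'
      exact Or.inr (Or.inr ⟨by rw [hxp], rfl, hg,
        hs.pivot_of_column (h4 a (by unfold InRows; omega) (by omega))⟩)

theorem BeforePivot.imply (h : Setup n G d p q m a Q) (hB : BaseTrail d p q m a Q lvl B)
    (hG : Describes n L G) (hL : s.learned = L) (hs : BeforePivot d p q m a Q B lvl R s)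
    (hR₁ : R (pos m p) (prefixClause n p (m - 1))) (hR₂ : R (neg a m) (clauseA a m p))
    (hR₃ : G m (m - 1) → R (pos p m) (prefixClause n m (m - 1)))
    {c : Clause Var} {l : Lit Var} (hc : InDatabase (config n δ) s c) (he : Examined s.focus c)
    (hu : IsUnitClause s c l) : BeforePivot d p q m a Q B lvl R (s.imply c l) := by
  have h1 := h.a_lt
  have h2 := h.p_lt
  have hmp := h.a_ne
  rcases hs.unit h hB hG hL hc he hu with ⟨rfl, rfl⟩ | ⟨rfl, rfl, h3⟩ | ⟨rfl, rfl, hg, h3⟩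
  · refine ⟨hs.above.imply hR₁, hs.within.imply (by simp), hs.focus, ?_, ?_, ?_, ?_⟩
    · intro l hl
      rcases Finset.mem_insert.1 hl with rfl | hl
      · simp
      · exact hs.pending l hl
    · exact fun _ => Finset.mem_insert_self _ _
    · exact fun _ => (isTrue_imply ..).2 (Or.inl rfl)
    · exact fun _ => (isTrue_imply ..).2 (Or.inl rfl)
  · refine ⟨hs.above.imply hR₂, hs.within.imply (by simp), hs.focus, ?_, ?_, ?_, ?_⟩
    · intro l hl
      rcases Finset.mem_insert.1 hl with rfl | hl
      · simp
      · exact hs.pending l hl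
    · exact fun _ => Finset.mem_insert_of_mem (hs.pivot_pending h3)
    · exact fun _ => (isTrue_imply ..).2 (Or.inr h3)
    · exact fun _ => (isTrue_imply ..).2 (Or.inr h3)
  · refine ⟨hs.above.imply (hR₃ hg), hs.within.imply (by simp), hs.focus, ?_, ?_, ?_, ?_⟩
    · intro l hl
      rcases Finset.mem_insert.1 hl with rfl | hl
      · simp
      · exact hs.pending l hl
    · exact fun _ => Finset.mem_insert_of_mem (hs.pivot_pending h3)
    · exact fun _ => (isTrue_imply ..).2 (Or.inr h3)
    · exact fun _ => (isTrue_imply ..).2 (Or.inr h3)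

/-- If `P_{p,m}` had been implied, `P_{m,p}` would be true as well and `B(p, m)` falsified; so
without a conflict only `P_{m,p}` or `¬ P_{a,m}` can be taken up. -/
theorem BeforePivot.takeUp (h : Setup n G d p q m a Q)
    (hs : BeforePivot d p q m a Q B lvl R s) (hS : Sound (config n δ) s)
    (hn : NoConflict (config n δ) s) {l : Lit Var} (hl : l ∈ s.pending) :
    BeforePivot d p q m a Q B lvl R (s.takeUp l) ∨ DuringPivot d p q m Q B lvl R (s.takeUp l) := by
  have h1 := h.p_lt
  have h2 := h.m_le
  have h3 := h.p_pos
  have h4 := h.a_lt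
  have h5 := h.a_pos
  have hpm : ¬ IsTrue s (pos p m) := by
    intro hpm
    refine hn (clauseB p m) (inDatabase_clauseB ?_) ?_
    · unfold Pair
      omega
    · exact allFalse_clauseB.2 ⟨hpm, hs.pivot_of_close hpm⟩
  rcases hs.pending l hl with rfl | rfl | rfl
  · refine Or.inr ⟨hs.above, ⟨?_, ?_⟩, rfl, hS.pending_true _ hl, ?_⟩
    · intro x y hx
      rcases hs.within.pos hx with h | h | ⟨rfl, rfl⟩
      · exact Or.inl h
      · exact Or.inr (Or.inl h)
      · exact absurd hx hpm
    · intro x y hx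
      rcases hs.within.neg hx with h | ⟨rfl, rfl⟩
      · exact Or.inl h
      · exact Or.inr ⟨h5, h4, rfl⟩
    · intro l hl'
      obtain ⟨hne, hl'⟩ := Finset.mem_erase.1 hl'
      rcases hs.pending l hl' with rfl | rfl | rfl
      · exact absurd rfl hne
      · exact absurd (hS.pending_true _ hl') hpm
      · exact Or.inl ⟨a, h5, h4, rfl⟩
  · exact absurd (hS.pending_true _ hl) hpm
  · exact Or.inl ⟨hs.above, ⟨hs.within.pos, hs.within.neg⟩, Or.inr rfl,
      fun l hl => hs.pending l (Finset.mem_of_mem_erase hl),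
      fun h => Finset.mem_erase.2 ⟨by simp, hs.pivot_pending h⟩, hs.pivot_of_close,
      hs.pivot_of_column⟩

/-- `C(p, m - 1)` forces `P_{m,p}`, which stays pending throughout this phase. -/
theorem BeforePivot.not_done (h : Setup n G d p q m a Q) (hB : BaseTrail d p q m a Q lvl B)
    (hG : Describes n L G) (hL : s.learned = L) (hs : BeforePivot d p q m a Q B lvl R s)
    (hS : Sound (config n δ) s) (hn : NoConflict (config n δ) s)
    (hsat : Saturated (config n δ) s) (hp : s.pending = ∅) : False := by
  have hC := Closed.of_sound hG hL hS hn hsat hp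
  have : IsTrue s (pos m p) := by
    refine hC.clauseC h.pivot ⟨(mem_pivot h).2 ⟨m, ?_, rfl⟩, ?_⟩
    · have := h.p_lt
      omega
    · intro l hl hne
      obtain ⟨x, hx, rfl⟩ := (mem_pivot h).1 hl
      refine hs.above.base ((hB.neg_iff x p).2 (Or.inl ⟨rfl, ?_⟩))
      simp at hne
      omega
  have := hs.pivot_pending this
  rw [hp] at this
  cases this

theorem BeforePivot.conflict (h : Setup n G d p q m a Q) (hG : Describes n L G)
    (hL : s.learned = L) (hs : BeforePivot d p q m a Q B lvl R s) {c : Clause Var}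
    (hc : InDatabase (config n δ) s c) (hf : Falsified s c) :
    c = clauseB m p ∧ IsTrue s (pos p m) := by
  obtain ⟨hp, hpm, hmn, ha, ham, ha_ne, hq, hqm, hqp, hQ, hpiv, hpiv_le, hcol, hqcol⟩ := h
  have hP := @hs.within.pos
  have hN := @hs.within.neg
  simp only [basePos, baseNeg] at hP hN
  rcases hG.falsified_cases hL hc hf with ⟨i, j, k, ht, h1, h2, h3⟩ | ⟨i, j, ht, rfl, h1, h2⟩ |
    ⟨j, k, hg, rfl, h1⟩
  · unfold Triple at ht
    have h1 := hP h1
    have h2 := hP h2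
    have h3 := hN h3
    grind
  · unfold Pair at ht
    have h1' := hP h1
    have h2' := hP h2
    have : (i = m ∧ j = p) ∨ (i = p ∧ j = m) := by grind
    rcases this with ⟨rfl, rfl⟩ | ⟨rfl, rfl⟩
    · exact ⟨rfl, h2⟩
    · exact ⟨clauseB_comm _ _, h1⟩
  · exfalso
    have hb := hG.bounds hg
    by_cases hjp : j = p
    · subst hjp
      have hk := hpiv_le hg
      have := hN (h1 m (by unfold InRows; omega))
      grind
    by_cases hjm : j = m
    · subst hjm
      have hk := hcol hg
      have := hN (h1 p (by unfold InRows; omega))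
      grind
    by_cases hjq : d ∧ j = q
    · obtain ⟨hd, rfl⟩ := hjq
      have := hN (h1 p (hqcol hd hg))
      grind
    · by_cases hj1 : j = 1
      · have := hN (h1 2 (by unfold InRows; omega))
        grind
      · have := hN (h1 1 (by unfold InRows; omega))
        grind

theorem DuringPivot.imply (h : Setup n G d p q m a Q) (hB : BaseTrail d p q m a Q lvl B)
    (hG : Describes n L G) (hL : s.learned = L) (hs : DuringPivot d p q m Q B lvl R s)
    (hR₁ : ∀ i, 1 ≤ i → i < m → i ≠ p → R (neg i m) (clauseA i m p))
    (hR₂ : R (neg p m) (clauseB m p)) (hR₃ : ∀ r, d → R (pos m q) r)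
    {c : Clause Var} {l : Lit Var} (hc : InDatabase (config n δ) s c) (he : Examined s.focus c)
    (hu : IsUnitClause s c l) : DuringPivot d p q m Q B lvl R (s.imply c l) := by
  obtain ⟨h1, h2, h3⟩ := isUnitClause_iff.1 hu
  have key : ((∃ i, 1 ≤ i ∧ i < m ∧ l = neg i m) ∨ (d ∧ l = pos m q)) ∧ R l c := by
    have hmp := hs.pivot
    have hc' : neg m p ∈ c := by
      have := hs.focus
      rw [this] at he
      exact he
    obtain ⟨hp, hpm, hmn, ha, ham, ha_ne, hq, hqm, hqp, hQ, hpiv, hpiv_le, hcol, hqcol⟩ := h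
    have hP := @hs.within.pos
    have hN := @hs.within.neg
    simp only [basePos, baseNeg] at hP hN
    rcases hG.allBut_cases hL hc h1 with ⟨i, j, k, ht, rfl, h4⟩ | ⟨i, j, ht, rfl, rfl, h4⟩ |
      ⟨j, k, x, hg, rfl, hx, rfl, h4⟩
    · have hik : (i = m ∧ j = p) ∨ (j = m ∧ k = p) := by
        simp [clauseA] at hc'
        omega
      unfold Triple at ht
      rcases hik with ⟨rfl, rfl⟩ | ⟨rfl, rfl⟩
      · rcases h4 with ⟨rfl, h4, h5⟩ | ⟨rfl, h4, h5⟩ | ⟨rfl, h4, h5⟩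
        · exact absurd hmp h3
        · have := hN h5
          grind
        · have := hP h5
          have hk : d ∧ k = q := by grind
          obtain ⟨hd, rfl⟩ := hk
          exact ⟨Or.inr ⟨hd, rfl⟩, hR₃ _ hd⟩
      · rcases h4 with ⟨rfl, h4, h5⟩ | ⟨rfl, h4, h5⟩ | ⟨rfl, h4, h5⟩
        · have := hN h5
          have hi : 1 ≤ i ∧ i < j ∧ i ≠ k := by grind
          exact ⟨Or.inl ⟨i, hi.1, hi.2.1, rfl⟩, hR₁ i hi.1 hi.2.1 hi.2.2⟩
        · exact absurd hmp h3
        · have := hP h4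
          grind
    · have hij : (i = m ∧ j = p) ∨ (i = p ∧ j = m) := by
        simp [clauseB] at hc'
        omega
      rcases hij with ⟨rfl, rfl⟩ | ⟨rfl, rfl⟩
      · exact absurd hmp h3
      · refine ⟨Or.inl ⟨i, hp, hpm, rfl⟩, ?_⟩
        rw [clauseB_comm]
        exact hR₂
    · have hb := hG.bounds hg
      rw [mem_prefixClause hb.1 hb.2.1] at hc'
      simp at hc'
  refine ⟨hs.above.imply key.2, hs.within.imply ?_, hs.focus,
    (isTrue_imply ..).2 (Or.inr hs.pivot), ?_⟩
  · rcases key.1 with ⟨i, h4, h5, rfl⟩ | ⟨hd, rfl⟩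
    · simp [h4, h5]
    · simp [hd]
  · intro l' hl'
    rcases Finset.mem_insert.1 hl' with rfl | hl'
    · exact key.1
    · exact hs.pending l' hl'

/-- With `P_{m,p}` in focus, `B(p, m)` handles row `p` and `A(i, m, p)` every other row, since
`P_{i,p}` is already false. -/
theorem DuringPivot.saturated (h : Setup n G d p q m a Q) (hB : BaseTrail d p q m a Q lvl B)
    (hs : DuringPivot d p q m Q B lvl R s)
    (hn : NoConflict (config n δ) s) (hsat : Saturated (config n δ) s) {i : ℕ} (h1 : 1 ≤ i)
    (h2 : i < m) : IsTrue s (neg i m) := by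
  have h3 := h.p_pos
  have h4 := h.p_lt
  have h5 := h.m_le
  by_cases hi : i = p
  · subst hi
    refine true_of_examined hn hsat (c := clauseB i m) (inDatabase_clauseB ?_) ?_ ?_ ?_
    · unfold Pair
      omega
    · rw [hs.focus]
      simp [Examined, clauseB, pos_neg]
    · simp [clauseB]
    · simp [clauseB, IsFalse, neg_neg, hs.pivot]
  · have hip : IsTrue s (neg i p) :=
      hs.above.base ((hB.neg_iff i p).2 (Or.inl ⟨rfl, h1, h2, hi⟩))
    refine true_of_examined hn hsat (c := clauseA i m p) (inDatabase_clauseA ?_) ?_ ?_ ?_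
    · unfold Triple
      omega
    · rw [hs.focus]
      simp [Examined, clauseA, pos_neg]
    · simp [clauseA]
    · simp [clauseA, IsFalse, neg_neg, pos_neg, hs.pivot, hip]

theorem DuringPivot.conflict (h : Setup n G d p q m a Q) (hG : Describes n L G)
    (hL : s.learned = L) (hs : DuringPivot d p q m Q B lvl R s) {c : Clause Var}
    (hc : InDatabase (config n δ) s c) (hf : Falsified s c) :
    c = prefixClause n m (m - 1) ∧ G m (m - 1) := by
  obtain ⟨hp, hpm, hmn, ha, ham, ha_ne, hq, hqm, hqp, hQ, hpiv, hpiv_le, hcol, hqcol⟩ := h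
  have hP := @hs.within.pos
  have hN := @hs.within.neg
  simp only [basePos, baseNeg] at hP hN
  rcases hG.falsified_cases hL hc hf with ⟨i, j, k, ht, h1, h2, h3⟩ | ⟨i, j, ht, rfl, h1, h2⟩ |
    ⟨j, k, hg, rfl, h1⟩
  · unfold Triple at ht
    have h1 := hP h1
    have h2 := hP h2
    have h3 := hN h3
    grind
  · unfold Pair at ht
    have h1' := hP h1
    have h2' := hP h2
    grind
  · have hb := hG.bounds hg
    by_cases hjp : j = p
    · subst hjp
      have hk := hpiv_le hg
      have := hN (h1 m (by unfold InRows; omega))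
      grind
    by_cases hjm : j = m
    · subst hjm
      have hk := hcol hg
      by_cases hk' : k = j - 1
      · exact ⟨by rw [hk'], hk' ▸ hg⟩
      · have := hN (h1 (j + 1) (by unfold InRows; omega))
        grind
    by_cases hjq : d ∧ j = q
    · obtain ⟨hd, rfl⟩ := hjq
      have := hN (h1 p (hqcol hd hg))
      grind
    · by_cases hj1 : j = 1
      · have := hN (h1 2 (by unfold InRows; omega))
        grind
      · have := hN (h1 1 (by unfold InRows; omega))
        grind

theorem falsified_iff_trail {c : Clause Var} {E : List (Entry Var)} (ht : s.trail = E ++ B)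
    (hf : Falsified s c) : ∀ x ∈ c, ∃ e ∈ E ++ B, e.lit = x.neg := by
  rw [← ht]
  exact hf

theorem BeforePivot.of_trail (h : Setup n G d p q m a Q) (hB : BaseTrail d p q m a Q lvl s.trail)
    (hlvl : s.level = lvl) (hp : s.pending = ∅) (hf : s.focus = some (neg a p)) :
    BeforePivot d p q m a Q s.trail lvl R s := by
  have h1 : ¬ IsTrue s (pos m p) := by
    intro h'
    have := (hB.pos_iff m p).1 h'
    have := h.p_lt
    omega
  have h2 : ¬ IsTrue s (pos p m) := by
    intro h'
    obtain ⟨h3, h4, h5⟩ := (hB.pos_iff p m).1 h'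
    have := h.q_lt h3
    omega
  have h3 : ¬ IsTrue s (neg a m) := by
    intro h'
    rcases (hB.neg_iff a m).1 h' with ⟨h3, -⟩ | ⟨h3, h4⟩
    · have := h.p_lt
      omega
    · have := h.q_lt (h.rows a h4).1
      omega
  exact ⟨⟨hlvl, [], rfl, by simp⟩,
    ⟨fun hx => Or.inl ((hB.pos_iff _ _).1 hx), fun hx => Or.inl ((hB.neg_iff _ _).1 hx)⟩,
    Or.inl hf, by simp [hp], fun h' => absurd h' h1, fun h' => absurd h' h2, fun h' => absurd h' h3⟩

/-- If `C(m, m - 1)` is available, the conflict in column `m` makes the solver learn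
`C(p, m - 2)`. -/
theorem leads_of_close (h : Setup n G d p q m a Q) (hG : Describes n L G)
    (hclose : G m (m - 1)) (hS : Sound (config n δ) s) (hL : s.learned = L)
    (hB : BaseTrail d p q m a Q s.level s.trail) (hlvl : 0 < s.level) (hp : s.pending = ∅)
    (hf : s.focus = some (neg a p)) :
    Leads (config n δ) L (fun t => t = restarted δ (L ++ [prefixClause n p (m - 2)])) s := by
  generalize hl : s.level = lvl at hB hlvl
  generalize hb : s.trail = B at hB
  refine Leads.of_invariant
    (fun x => BeforePivot d p q m a Q B lvl (Implied n d p q m) x ∨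
      DuringPivot d p q m Q B lvl (Implied n d p q m) x) ?_ ?_ ?_ ?_ (Or.inl ?_) hS hL
  · rintro x (hx | hx) hSx hLx c l hc he hu -
    · exact Or.inl (Or.inl (hx.imply h hB hG hLx .pivot (.column a h.a_pos h.a_lt h.a_ne)
        (fun _ => .close) hc he hu))
    · exact Or.inl (Or.inr (hx.imply h hB hG hLx (fun i h1 h2 h3 => .column i h1 h2 h3)
        .anti (fun r hd => .row r hd) hc he hu))
  · rintro x (hx | hx) hSx hLx hn hsat l hl' -
    · exact Or.inl (hx.takeUp h hSx hn hl')
    -- Saturating `P_{m,p}` falsifies `C(m, m - 1)`, so nothing further can be taken up.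
    · refine (hn _ (hG.inDatabase hLx hclose) ?_).elim
      intro y hy
      have h1 := h.p_lt
      obtain ⟨x', hx', rfl⟩ := (mem_prefixClause_self (by omega) h.m_le).1 hy
      exact hx.saturated h hB hn hsat hx'.1 hx'.2
  · rintro x (hx | hx) hSx hLx hn hsat hpx
    · exact (hx.not_done h hB hG hLx hSx hn hsat hpx).elim
    · refine (hn _ (hG.inDatabase hLx hclose) ?_).elim
      intro y hy
      have h1 := h.p_lt
      obtain ⟨x', hx', rfl⟩ := (mem_prefixClause_self (by omega) h.m_le).1 hy
      exact hx.saturated h hB hn hsat hx'.1 hx'.2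
  · rintro x hx hSx hLx c hc hfc
    have habove : Above B lvl (Implied n d p q m) x := hx.elim (·.above) (·.above)
    obtain ⟨hxl, E, hE, hE'⟩ := habove
    refine ⟨fun _ => ?_, fun h0 => by omega⟩
    change restarted δ (L ++ [firstUIP x.level x.trail c]) = _
    have hcases : c = prefixClause n m (m - 1) ∨ c = clauseB m p := by
      rcases hx with hx | hx
      · exact Or.inr (hx.conflict h hG hLx hc hfc).1
      · exact Or.inl (hx.conflict h hG hLx hc hfc).1
    rw [hxl, hE, firstUIP_of_close h hB (hE ▸ hSx.wf) hE' hcases (falsified_iff_trail hE hfc)]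
  · subst hb
    exact BeforePivot.of_trail h hB hl hp hf

end OrderingPrinciple

/-! ### The conflict that passes through column `n - 1` -/

namespace OrderingPrinciple

open CDCL

variable {n : ℕ} {δ : ℝ} {L : List (Clause Var)} {G : ℕ → ℕ → Prop} {p q m a lvl : ℕ}
  {Q : ℕ → Prop} {B : List (Entry Var)} {s : State Var}

/-- The states between the propagations of `P_{m,p}` and of `P_{n,m}`, where `m = n - 1`. -/
structure AfterPivot (n p q m : ℕ) (Q : ℕ → Prop) (B : List (Entry Var)) (lvl : ℕ)
    (s : State Var) : Prop where
  above : Above B lvl (ImpliedPenultimate n p m) s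
  within : Within (fun x y => (x = m ∧ y = p) ∨ (x = n ∧ y = m) ∨ (x = m ∧ y = n))
    (fun x y => baseNeg p q m Q x y ∨ (1 ≤ x ∧ x < m ∧ (y = m ∨ y = n))) s
  focus : ∃ i, 1 ≤ i ∧ i < m ∧ (s.focus = some (neg i m) ∨ s.focus = some (neg i n))
  column : ∀ i, 1 ≤ i → i < m → IsTrue s (neg i m)
  pending : ∀ l ∈ s.pending,
    (∃ i, 1 ≤ i ∧ i < m ∧ (l = neg i m ∨ l = neg i n)) ∨ l = pos n m ∨ l = pos m n
  last_pending : IsTrue s (pos n m) → pos n m ∈ s.pending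
  last_of_column : ∀ i, IsTrue s (neg i n) → IsTrue s (pos n m)
  last_of_close : IsTrue s (pos m n) → IsTrue s (pos n m)

/-- The states during the propagation of `P_{n,m}`, where `m = n - 1`. -/
structure DuringLast (n p q m : ℕ) (Q : ℕ → Prop) (B : List (Entry Var)) (lvl : ℕ)
    (s : State Var) : Prop where
  above : Above B lvl (ImpliedPenultimate n p m) s
  within : Within (fun x y => (x = m ∧ y = p) ∨ (x = n ∧ y = m) ∨ (x = n ∧ y = p))
    (fun x y => baseNeg p q m Q x y ∨ (1 ≤ x ∧ x < m ∧ y = m) ∨ (1 ≤ x ∧ x < n ∧ y = n)) s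
  focus : s.focus = some (pos n m)
  last : IsTrue s (pos n m)
  column : ∀ i, 1 ≤ i → i < m → IsTrue s (neg i m)

/-- Column `m` is false below row `m`, so `D(m)` yields `P_{n,m}`. Before this literal is taken up,
column `n` may already fill row by row through `A(i, n, m)`, and `D(n)` may then imply `P_{m,n}`.
All of this presupposes `P_{n,m}`, which the invariant records. -/
theorem AfterPivot.imply (h : Setup n G False p q m a Q) (hn : m + 1 = n)
    (hm : ∀ {k}, G m k → k = n - 1) (hlast : ∀ {k}, G n k → k = n - 1)
    (hG : Describes n L G) (hL : s.learned = L) (hs : AfterPivot n p q m Q B lvl s)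
    {c : Clause Var} {l : Lit Var} (hc : InDatabase (config n δ) s c) (he : Examined s.focus c)
    (hu : IsUnitClause s c l) : AfterPivot n p q m Q B lvl (s.imply c l) := by
  obtain ⟨h1, h2, h3⟩ := isUnitClause_iff.1 hu
  have hpn := h.p_lt
  have key : (∃ i, 1 ≤ i ∧ i < m ∧ l = neg i n ∧ IsTrue s (pos n m) ∧ c = clauseA i n m) ∨
      (l = pos n m ∧ c = prefixClause n m (n - 1)) ∨
      (l = pos m n ∧ c = prefixClause n n (n - 1) ∧ IsTrue s (pos n m)) := by
    obtain ⟨i₀, hi₁, hi₂, hf⟩ := hs.focus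
    have hc' : pos i₀ m ∈ c ∨ pos i₀ n ∈ c := by
      rcases hf with hf | hf
      · rw [hf] at he; exact Or.inl he
      · rw [hf] at he; exact Or.inr he
    obtain ⟨hp, hpm, hmn, ha, ham, ha_ne, -, -, -, hQ, hpiv, hpiv_le, hcol, -⟩ := h
    have hP := @hs.within.pos
    have hN := @hs.within.neg
    simp only [baseNeg] at hP hN
    rcases hG.allBut_cases hL hc h1 with ⟨i, j, k, ht, rfl, h4⟩ | ⟨i, j, ht, rfl, rfl, h4⟩ |
      ⟨j, k, x, hg, rfl, hx, rfl, h4⟩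
    · have hik : i = i₀ ∧ (k = m ∨ k = n) := by
        simp [clauseA] at hc'
        omega
      obtain ⟨rfl, hk⟩ := hik
      unfold Triple at ht
      rcases h4 with ⟨rfl, h4, h5⟩ | ⟨rfl, h4, h5⟩ | ⟨rfl, h4, h5⟩
      · rcases hP h4 with ⟨rfl, rfl⟩ | ⟨rfl, rfl⟩ | ⟨rfl, rfl⟩
        · omega
        · exact Or.inl ⟨i, hi₁, hi₂, rfl, h4, rfl⟩
        · exact absurd (hs.column i hi₁ hi₂) h2
      · have := hP h4
        omega
      · have := hP h4
        omega
    · simp [clauseB] at hc'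
    · have hb := hG.bounds hg
      simp only [mem_prefixClause hb.1 hb.2.1, pos_inj] at hc'
      have hj : j = m ∨ j = n := by
        rcases hc' with ⟨y, -, -, rfl⟩ | ⟨y, -, -, rfl⟩ <;> simp
      clear hc'
      rcases hj with rfl | rfl
      · obtain rfl := hm hg
        have hxn : x = n := by
          by_contra hne
          have := hN (h4 n (by unfold InRows; omega) (Ne.symm hne))
          grind
        exact Or.inr (Or.inl ⟨by rw [hxn], rfl⟩)
      · obtain rfl := hlast hg
        have hxm : x = m := by
          by_contra hne
          have := hN (h4 m (by unfold InRows; omega) (Ne.symm hne))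
          grind
        refine Or.inr (Or.inr ⟨by rw [hxm], rfl, ?_⟩)
        exact hs.last_of_column a (h4 a (by unfold InRows; omega) (by omega))
  have himp : ∀ {x}, IsTrue s x → IsTrue (s.imply c l) x :=
    fun hx => (isTrue_imply ..).2 (Or.inr hx)
  have hR : ImpliedPenultimate n p m l c := by
    rcases key with ⟨i, h4, h5, rfl, -, rfl⟩ | ⟨rfl, rfl⟩ | ⟨rfl, rfl, -⟩
    · exact .lastColumn i h4 h5
    · exact .last
    · exact .close
  refine ⟨hs.above.imply hR, hs.within.imply ?_, hs.focus,
    fun i h1 h2 => himp (hs.column i h1 h2), ?_, ?_, ?_, ?_⟩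
  · rcases key with ⟨i, h4, h5, rfl, -⟩ | ⟨rfl, rfl⟩ | ⟨rfl, -⟩ <;> simp <;> omega
  · intro l' hl'
    rcases Finset.mem_insert.1 hl' with rfl | hl'
    · rcases key with ⟨i, h4, h5, rfl, -⟩ | ⟨rfl, rfl⟩ | ⟨rfl, -⟩
      · exact Or.inl ⟨i, h4, h5, Or.inr rfl⟩
      · simp
      · simp
    · exact hs.pending l' hl'
  · intro hx
    rcases (isTrue_imply ..).1 hx with rfl | hx
    · exact Finset.mem_insert_self _ _
    · exact Finset.mem_insert_of_mem (hs.last_pending hx)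
  · intro i hx
    rcases (isTrue_imply ..).1 hx with rfl | hx
    · rcases key with ⟨i', h4, h5, h6, h7, -⟩ | ⟨h6, rfl⟩ | ⟨h6, -⟩
      · exact himp h7
      · simp at h6
      · simp at h6
    · exact himp (hs.last_of_column i hx)
  · intro hx
    rcases (isTrue_imply ..).1 hx with rfl | hx
    · rcases key with ⟨i', h4, h5, h6, h7, -⟩ | ⟨h6, rfl⟩ | ⟨-, -, h6⟩
      · simp at h6
      · simp at h6
        omega
      · exact himp h6
    · exact himp (hs.last_of_close hx)

theorem AfterPivot.takeUp (h : Setup n G False p q m a Q) (hmn : m + 1 = n)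
    (hs : AfterPivot n p q m Q B lvl s) (hS : Sound (config n δ) s)
    (hn : NoConflict (config n δ) s) {l : Lit Var} (hl : l ∈ s.pending) :
    AfterPivot n p q m Q B lvl (s.takeUp l) ∨ DuringLast n p q m Q B lvl (s.takeUp l) := by
  have h1 := h.p_lt
  have h2 := h.p_pos
  have hmn' : ¬ IsTrue s (pos m n) := by
    intro h'
    refine hn (clauseB m n) (inDatabase_clauseB ?_) ?_
    · unfold Pair
      omega
    · exact allFalse_clauseB.2 ⟨h', hs.last_of_close h'⟩
  rcases hs.pending l hl with ⟨i, h3, h4, h5⟩ | rfl | rfl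
  · refine Or.inl ⟨hs.above, ⟨hs.within.pos, hs.within.neg⟩, ⟨i, h3, h4, ?_⟩, hs.column,
      fun l hl => hs.pending l (Finset.mem_of_mem_erase hl), fun h' => ?_, hs.last_of_column,
      hs.last_of_close⟩
    · rcases h5 with rfl | rfl
      · exact Or.inl rfl
      · exact Or.inr rfl
    · refine Finset.mem_erase.2 ⟨?_, hs.last_pending h'⟩
      rcases h5 with rfl | rfl <;> simp
  · refine Or.inr ⟨hs.above, ⟨?_, ?_⟩, rfl, hS.pending_true _ hl, hs.column⟩
    · intro x y hx
      rcases hs.within.pos hx with h | h | ⟨rfl, rfl⟩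
      · exact Or.inl h
      · exact Or.inr (Or.inl h)
      · exact absurd hx hmn'
    · intro x y hx
      rcases hs.within.neg hx with h | ⟨h3, h4, h5⟩
      · exact Or.inl h
      · omega
  · exact absurd (hS.pending_true _ hl) hmn'

theorem AfterPivot.not_done (h : Setup n G False p q m a Q) (hmn : m + 1 = n)
    (hG : Describes n L G) (hL : s.learned = L) (hs : AfterPivot n p q m Q B lvl s)
    (hS : Sound (config n δ) s) (hn : NoConflict (config n δ) s)
    (hsat : Saturated (config n δ) s) (hp : s.pending = ∅) : False := by
  have hC := Closed.of_sound hG hL hS hn hsat hp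
  have h1 := h.p_lt
  have h2 := h.p_pos
  have : IsTrue s (pos n m) := by
    refine hC.clauseC (hG.full (j := m) (by omega) (by omega))
      ((allBut_prefixClause (by omega) (by omega)).2 ⟨n, ?_, rfl, ?_⟩)
    · unfold InRows
      omega
    · intro y hy hne
      unfold InRows at hy
      exact hs.column y (by omega) (by omega)
  have := hs.last_pending this
  rw [hp] at this
  cases this

theorem AfterPivot.conflict (h : Setup n G False p q m a Q) (hn : m + 1 = n)
    (hm : ∀ {k}, G m k → k = n - 1) (hlast : ∀ {k}, G n k → k = n - 1) (hG : Describes n L G)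
    (hL : s.learned = L) (hs : AfterPivot n p q m Q B lvl s) {c : Clause Var}
    (hc : InDatabase (config n δ) s c) (hf : Falsified s c) : c = clauseB n m := by
  obtain ⟨hp, hpm, hmn, ha, ham, ha_ne, -, -, -, hQ, hpiv, hpiv_le, -, -⟩ := h
  have hP := @hs.within.pos
  have hN := @hs.within.neg
  simp only [baseNeg] at hP hN
  rcases hG.falsified_cases hL hc hf with ⟨i, j, k, ht, h1, h2, h3⟩ | ⟨i, j, ht, rfl, h1, h2⟩ |
    ⟨j, k, hg, rfl, h1⟩
  · unfold Triple at ht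
    have h1 := hP h1
    have h2 := hP h2
    have h3 := hN h3
    grind
  · unfold Pair at ht
    have h1' := hP h1
    have h2' := hP h2
    have : (i = m ∧ j = n) ∨ (i = n ∧ j = m) := by grind
    rcases this with ⟨rfl, rfl⟩ | ⟨rfl, rfl⟩
    · exact clauseB_comm _ _
    · rfl
  · exfalso
    have hb := hG.bounds hg
    by_cases hjp : j = p
    · subst hjp
      have hk := hpiv_le hg
      have := hN (h1 m (by unfold InRows; omega))
      grind
    by_cases hjm : j = m
    · subst hjm
      obtain rfl := hm hg
      have := hN (h1 n (by unfold InRows; omega))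
      grind
    by_cases hjn : j = n
    · subst hjn
      obtain rfl := hlast hg
      have := hN (h1 m (by unfold InRows; omega))
      grind
    · by_cases hj1 : j = 1
      · have := hN (h1 2 (by unfold InRows; omega))
        grind
      · have := hN (h1 1 (by unfold InRows; omega))
        grind

theorem DuringLast.imply (h : Setup n G False p q m a Q) (hn : m + 1 = n)
    (hG : Describes n L G) (hL : s.learned = L) (hs : DuringLast n p q m Q B lvl s)
    {c : Clause Var} {l : Lit Var} (hc : InDatabase (config n δ) s c) (he : Examined s.focus c)
    (hu : IsUnitClause s c l) : DuringLast n p q m Q B lvl (s.imply c l) := by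
  obtain ⟨h1, h2, h3⟩ := isUnitClause_iff.1 hu
  have key : ((∃ i, 1 ≤ i ∧ i < n ∧ l = neg i n) ∨ l = pos n p) ∧
      ImpliedPenultimate n p m l c := by
    have hnm := hs.last
    have hc' : neg n m ∈ c := by
      have := hs.focus
      rw [this] at he
      exact he
    obtain ⟨hp, hpm, hmn, ha, ham, ha_ne, -, -, -, hQ, hpiv, hpiv_le, -, -⟩ := h
    have hP := @hs.within.pos
    have hN := @hs.within.neg
    simp only [baseNeg] at hP hN
    rcases hG.allBut_cases hL hc h1 with ⟨i, j, k, ht, rfl, h4⟩ | ⟨i, j, ht, rfl, rfl, h4⟩ |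
      ⟨j, k, x, hg, rfl, hx, rfl, h4⟩
    · have hik : (i = n ∧ j = m) ∨ (j = n ∧ k = m) := by
        simp [clauseA] at hc'
        omega
      unfold Triple at ht
      rcases hik with ⟨rfl, rfl⟩ | ⟨rfl, rfl⟩
      · rcases h4 with ⟨rfl, h4, h5⟩ | ⟨rfl, h4, h5⟩ | ⟨rfl, h4, h5⟩
        · exact absurd hnm h3
        · have := hN h5
          grind
        · have := hP h5
          have hk : k = p := by grind
          subst hk
          exact ⟨Or.inr rfl, .row _⟩
      · rcases h4 with ⟨rfl, h4, h5⟩ | ⟨rfl, h4, h5⟩ | ⟨rfl, h4, h5⟩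
        · have := hN h5
          have hi : 1 ≤ i ∧ i < k := by grind
          exact ⟨Or.inl ⟨i, hi.1, by omega, rfl⟩, .lastColumn i hi.1 hi.2⟩
        · exact absurd hnm h3
        · have := hP h4
          grind
    · have hij : (i = n ∧ j = m) ∨ (i = m ∧ j = n) := by
        simp [clauseB] at hc'
        omega
      rcases hij with ⟨rfl, rfl⟩ | ⟨rfl, rfl⟩
      · exact absurd hnm h3
      · refine ⟨Or.inl ⟨i, by omega, by omega, rfl⟩, ?_⟩
        rw [clauseB_comm]
        exact .lastAnti
    · have hb := hG.bounds hg
      rw [mem_prefixClause hb.1 hb.2.1] at hc'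
      simp at hc'
  refine ⟨hs.above.imply key.2, hs.within.imply ?_, hs.focus,
    (isTrue_imply ..).2 (Or.inr hs.last),
    fun i h1 h2 => (isTrue_imply ..).2 (Or.inr (hs.column i h1 h2))⟩
  rcases key.1 with ⟨i, h4, h5, rfl⟩ | rfl
  · simp [h4, h5]
  · simp

/-- Propagating `P_{n,m}` makes the whole of column `n` false through `A(i, n, m)` and `B(m, n)`,
which falsifies `D(n)`. -/
theorem DuringLast.not_saturated (h : Setup n G False p q m a Q) (hmn : m + 1 = n)
    (hG : Describes n L G) (hL : s.learned = L) (hs : DuringLast n p q m Q B lvl s)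
    (hn : NoConflict (config n δ) s) (hsat : Saturated (config n δ) s) : False := by
  have h3 := h.p_pos
  have h4 := h.p_lt
  refine hn _ (hG.inDatabase hL (hG.full (j := n) (by omega) le_rfl)) ?_
  refine (allFalse_prefixClause (by omega) le_rfl).2 fun i hi => ?_
  unfold InRows at hi
  by_cases him : i = m
  · subst him
    refine true_of_examined hn hsat (c := clauseB i n) (inDatabase_clauseB ?_) ?_ ?_ ?_
    · unfold Pair
      omega
    · rw [hs.focus]
      simp [Examined, clauseB, pos_neg]
    · simp [clauseB]
    · simp [clauseB, IsFalse, neg_neg, hs.last]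
  · have hi' := hs.column i (by omega) (by omega)
    refine true_of_examined hn hsat (c := clauseA i n m) (inDatabase_clauseA ?_) ?_ ?_ ?_
    · unfold Triple
      omega
    · rw [hs.focus]
      simp [Examined, clauseA, pos_neg]
    · simp [clauseA]
    · simp [clauseA, IsFalse, neg_neg, pos_neg, hs.last, hi']

theorem DuringLast.conflict (h : Setup n G False p q m a Q) (hn : m + 1 = n)
    (hm : ∀ {k}, G m k → k = n - 1) (hlast : ∀ {k}, G n k → k = n - 1) (hG : Describes n L G)
    (hL : s.learned = L) (hs : DuringLast n p q m Q B lvl s) {c : Clause Var}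
    (hc : InDatabase (config n δ) s c) (hf : Falsified s c) : c = prefixClause n n (n - 1) := by
  obtain ⟨hp, hpm, hmn, ha, ham, ha_ne, -, -, -, hQ, hpiv, hpiv_le, -, -⟩ := h
  have hP := @hs.within.pos
  have hN := @hs.within.neg
  simp only [baseNeg] at hP hN
  rcases hG.falsified_cases hL hc hf with ⟨i, j, k, ht, h1, h2, h3⟩ | ⟨i, j, ht, rfl, h1, h2⟩ |
    ⟨j, k, hg, rfl, h1⟩
  · unfold Triple at ht
    have h1 := hP h1
    have h2 := hP h2
    have h3 := hN h3
    grind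
  · unfold Pair at ht
    have h1' := hP h1
    have h2' := hP h2
    grind
  · have hb := hG.bounds hg
    by_cases hjp : j = p
    · subst hjp
      have hk := hpiv_le hg
      have := hN (h1 m (by unfold InRows; omega))
      grind
    by_cases hjm : j = m
    · subst hjm
      obtain rfl := hm hg
      have := hN (h1 n (by unfold InRows; omega))
      grind
    by_cases hjn : j = n
    · subst hjn
      obtain rfl := hlast hg
      rfl
    · by_cases hj1 : j = 1
      · have := hN (h1 2 (by unfold InRows; omega))
        grind
      · have := hN (h1 1 (by unfold InRows; omega))
        grind

theorem DuringPivot.afterPivot (h : Setup n G False p q m a Q)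
    (hB : BaseTrail False p q m a Q lvl B) (hmn : m + 1 = n)
    (hs : DuringPivot False p q m Q B lvl (ImpliedPenultimate n p m) s)
    (hn : NoConflict (config n δ) s) (hsat : Saturated (config n δ) s) {l : Lit Var}
    (hl : l ∈ s.pending) : AfterPivot n p q m Q B lvl (s.takeUp l) := by
  have h1 := h.p_lt
  have hnm : ¬ IsTrue s (pos n m) := by
    intro h'
    have := hs.within.pos h'
    simp only [basePos, false_and, false_or, or_false] at this
    omega
  have hN := @hs.within.neg
  refine ⟨hs.above, ⟨?_, ?_⟩, ?_, fun i h2 h3 => hs.saturated h hB hn hsat h2 h3, ?_,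
    fun h' => absurd h' hnm, ?_, ?_⟩
  · intro x y hx
    have := hs.within.pos hx
    simp only [basePos, false_and, false_or, or_false] at this
    omega
  · intro x y hx
    rcases hN hx with h | h
    · exact Or.inl h
    · exact Or.inr (by omega)
  · rcases hs.pending l hl with ⟨i, h2, h3, rfl⟩ | ⟨⟨⟩, -⟩
    exact ⟨i, h2, h3, Or.inl rfl⟩
  · intro l' hl'
    rcases hs.pending l' (Finset.mem_of_mem_erase hl') with ⟨i, h2, h3, rfl⟩ | ⟨⟨⟩, -⟩
    exact Or.inl ⟨i, h2, h3, Or.inl rfl⟩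
  · intro i h'
    have := hN h'
    have hQ := h.rows i
    simp only [baseNeg] at this
    grind
  · intro h'
    have := hs.within.pos h'
    simp only [basePos, false_and, false_or, or_false] at this
    omega

/-- If `m = n - 1` and no clause about the columns `n - 1` and `n` has been learned, the conflict
in column `n` makes the solver learn `C(p, m - 2)`. -/
theorem leads_of_penultimate (h : Setup n G False p q m a Q) (hG : Describes n L G)
    (hmn : m + 1 = n) (hm : ∀ {k}, G m k → k = n - 1) (hlast : ∀ {k}, G n k → k = n - 1)
    (hS : Sound (config n δ) s) (hL : s.learned = L)
    (hB : BaseTrail False p q m a Q s.level s.trail) (hlvl : 0 < s.level) (hp : s.pending = ∅)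
    (hf : s.focus = some (neg a p)) :
    Leads (config n δ) L (fun t => t = restarted δ (L ++ [prefixClause n p (m - 2)])) s := by
  have hmG : ¬ G m (m - 1) := by
    intro h'
    have := hm h'
    have := h.p_lt
    omega
  have h1 := h.p_lt
  generalize hl : s.level = lvl at hB hlvl
  generalize hb : s.trail = B at hB
  refine Leads.of_invariant
    (fun x => (BeforePivot False p q m a Q B lvl (ImpliedPenultimate n p m) x ∨
      DuringPivot False p q m Q B lvl (ImpliedPenultimate n p m) x) ∨
      (AfterPivot n p q m Q B lvl x ∨ DuringLast n p q m Q B lvl x)) ?_ ?_ ?_ ?_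
      (Or.inl (Or.inl ?_)) hS hL
  · rintro x ((hx | hx) | (hx | hx)) hSx hLx c l hc he hu -
    · exact Or.inl (Or.inl (Or.inl (hx.imply h hB hG hLx .pivot
        (.column a h.a_pos h.a_lt h.a_ne) (fun h' => absurd h' hmG) hc he hu)))
    · exact Or.inl (Or.inl (Or.inr (hx.imply h hB hG hLx (fun i h1 h2 h3 => .column i h1 h2 h3)
        .anti (fun r hd => hd.elim) hc he hu)))
    · exact Or.inl (Or.inr (Or.inl (hx.imply h hmn hm hlast hG hLx hc he hu)))
    · exact Or.inl (Or.inr (Or.inr (hx.imply h hmn hG hLx hc he hu)))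
  · rintro x ((hx | hx) | (hx | hx)) hSx hLx hn hsat l hl' -
    · exact Or.inl (Or.inl (hx.takeUp h hSx hn hl'))
    · exact Or.inl (Or.inr (Or.inl (hx.afterPivot h hB hmn hn hsat hl')))
    · exact Or.inl (Or.inr (hx.takeUp h hmn hSx hn hl'))
    · exact (hx.not_saturated h hmn hG hLx hn hsat).elim
  · rintro x ((hx | hx) | (hx | hx)) hSx hLx hn hsat hpx
    · exact (hx.not_done h hB hG hLx hSx hn hsat hpx).elim
    · exfalso
      have hC := Closed.of_sound hG hLx hSx hn hsat hpx
      have h2 := h.p_pos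
      have : IsTrue x (pos n m) := by
        refine hC.clauseC (hG.full (j := m) (by omega) (by omega))
          ((allBut_prefixClause (by omega) (by omega)).2 ⟨n, ?_, rfl, ?_⟩)
        · unfold InRows
          omega
        · intro y hy hne
          unfold InRows at hy
          exact hx.saturated h hB hn hsat (by omega) (by omega)
      have := hx.within.pos this
      simp only [basePos, false_and, false_or, or_false] at this
      omega
    · exact (hx.not_done h hmn hG hLx hSx hn hsat hpx).elim
    · exact (hx.not_saturated h hmn hG hLx hn hsat).elim
  · rintro x hx hSx hLx c hc hfc
    have habove : Above B lvl (ImpliedPenultimate n p m) x :=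
      hx.elim (fun hx => hx.elim (·.above) (·.above)) (fun hx => hx.elim (·.above) (·.above))
    obtain ⟨hxl, E, hE, hE'⟩ := habove
    refine ⟨fun _ => ?_, fun h0 => by omega⟩
    change restarted δ (L ++ [firstUIP x.level x.trail c]) = _
    have hcases : c = prefixClause n n (n - 1) ∨ c = clauseB n m := by
      rcases hx with (hx | hx) | (hx | hx)
      -- A conflict this early needs `P_{p,m}`, which no clause implies here because `C(m, m - 1)`
      -- is unavailable.
      · obtain ⟨rfl, h2⟩ := hx.conflict h hG hLx hc hfc
        exfalso
        obtain ⟨e, he, h3⟩ := h2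
        rw [hE, List.mem_append] at he
        rcases he with he | he
        · obtain ⟨-, r, hr, hi⟩ := hE' e he
          rw [h3] at hi
          generalize hl : pos p m = l at hi
          cases hi <;> simp at hl <;> omega
        · exact ((hB.pos_iff p m).1 ⟨e, he, h3⟩).1
      · exact absurd (hx.conflict h hG hLx hc hfc).2 hmG
      · exact Or.inr (hx.conflict h hmn hm hlast hG hLx hc hfc)
      · exact Or.inl (hx.conflict h hmn hm hlast hG hLx hc hfc)
    rw [hxl, hE, firstUIP_of_penultimate h hB hmn (hE ▸ hSx.wf) hE' hcases
      (falsified_iff_trail hE hfc)]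
  · subst hb
    exact BeforePivot.of_trail h hB hl hp hf

end OrderingPrinciple

/-! ### The decision levels without conflict -/

namespace OrderingPrinciple

open CDCL

variable {n : ℕ} {δ : ℝ} {L : List (Clause Var)} {G : ℕ → ℕ → Prop} {s : State Var}

/-- One positive literal `P_{p,q}` (if `d` holds), and negative literals in column `p` (rows in `R`)
and in column `q` (rows in `Q`). -/
structure Level (n : ℕ) (G : ℕ → ℕ → Prop) (d : Prop) (p q : ℕ) (Q R : ℕ → Prop) : Prop where
  p_pos : 1 ≤ p
  p_le : p ≤ n
  q_ne : d → q ≠ p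
  rows : ∀ x, R x → 1 ≤ x ∧ x ≤ n ∧ x ≠ p
  q_rows : ∀ x, Q x → d ∧ x ≠ p ∧ x ≠ q ∧ R x
  q_mem : d → R q
  column : ∀ {k}, G p k → ∃ x y, x ≠ y ∧ InRows n p k x ∧ InRows n p k y ∧ ¬ R x ∧ ¬ R y
  q_column : ∀ {k}, d → G q k → InRows n q k p
  two_le : ∀ {j k}, G j k → j ≠ p → (d → j ≠ q) → 2 ≤ k

/-- The negative literals of a level. -/
def levelNeg (p q : ℕ) (Q R : ℕ → Prop) (x y : ℕ) : Prop := (y = p ∧ R x) ∨ (y = q ∧ Q x)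

variable {d : Prop} {p q : ℕ} {Q R : ℕ → Prop}

/-- `P_{p,q}` satisfies the clauses of column `q` and, by transitivity and antisymmetry, transfers
the false entries of column `q` and the row `q` to column `p`, where they already are. Column `p`
keeps two unassigned rows in each clause, and clauses of the other columns have at least two
unassigned literals. -/
theorem Level.closed (h : Level n G d p q Q R) (hG : Describes n L G) :
    Closed n G (litSet (basePos d p q) (levelNeg p q Q R)) where
  clauseA := by
    intro i j k l ht hl
    obtain ⟨hp, hpn, hqp, hR, hQ, hqR, -, -, -⟩ := h
    unfold Triple at ht
    rcases (allBut_clauseA ht).1 hl with ⟨rfl, h1, h2⟩ | ⟨rfl, h1, h2⟩ | ⟨rfl, h1, h2⟩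
    all_goals
      simp only [litSet_pos, litSet_neg, basePos, levelNeg] at h1 h2 ⊢
      grind
  clauseB := by
    intro i j l ht hl
    obtain ⟨hp, hpn, hqp, hR, hQ, hqR, -, -, -⟩ := h
    unfold Pair at ht
    rcases (allBut_clauseB ht).1 hl with ⟨rfl, h1⟩ | ⟨rfl, h1⟩
    all_goals
      simp only [litSet_pos, litSet_neg, basePos, levelNeg] at h1 ⊢
      grind
  clauseC := by
    intro j k l hg hl
    have hb := hG.bounds hg
    obtain ⟨x, hx, rfl, hall⟩ := (allBut_prefixClause hb.1 hb.2.1).1 hl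
    obtain ⟨hp, hpn, hqp, hR, hQ, hqR, hcol, hqcol, htwo⟩ := h
    simp only [litSet_pos, litSet_neg, basePos, levelNeg] at hall ⊢
    by_cases hjp : j = p
    · subst hjp
      obtain ⟨y, z, hyz, hy, hz, hRy, hRz⟩ := hcol hg
      exfalso
      have h1 := hall y hy
      have h2 := hall z hz
      grind
    by_cases hjq : d ∧ j = q
    · obtain ⟨hd, rfl⟩ := hjq
      have := hall p (hqcol hd hg)
      grind
    · exfalso
      have hk := htwo hg hjp (fun hd hj => hjq ⟨hd, hj⟩)
      -- As `2 ≤ k`, the clause has a second literal, chosen among the first rows other than `j`; it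
      -- would have to be false in a column that has no false entries.
      obtain ⟨y, hy, hne⟩ : ∃ y, InRows n j k y ∧ y ≠ x := by
        unfold InRows at hx ⊢
        by_cases h1 : x = 1
        · by_cases h2 : j = 2
          · exact ⟨3, by omega⟩
          · exact ⟨2, by omega⟩
        · by_cases h2 : j = 1
          · by_cases h3 : x = 2
            · exact ⟨3, by omega⟩
            · exact ⟨2, by omega⟩
          · exact ⟨1, by omega⟩
      have := hall y hy hne
      grind

theorem Level.consistent (h : Level n G d p q Q R) (x y : ℕ) :
    basePos d p q x y → ¬ levelNeg p q Q R x y := by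
  obtain ⟨hp, hpn, hqp, hR, hQ, hqR, -, -, -⟩ := h
  simp only [basePos, levelNeg]
  grind

/-- In a falsified clause every literal is the only possible exception to falsity, so closure makes
it true as well, against consistency. -/
theorem noConflict_of_closed {P N : ℕ → ℕ → Prop} (hG : Describes n L G) (hL : s.learned = L)
    (hC : Closed n G (litSet P N)) (hcons : ∀ x y, P x y → ¬ N x y) (hw : Within P N s) :
    NoConflict (config n δ) s := by
  intro c hc hf
  have hw' : ∀ l, IsTrue s l → litSet P N l := litSet_ext.2 ⟨fun _ _ => hw.pos, fun _ _ => hw.neg⟩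
  have hne : ∃ l, l ∈ c := by
    rcases hG.cases hL hc with ⟨i, j, k, -, rfl⟩ | ⟨i, j, -, rfl⟩ | ⟨j, k, hg, rfl⟩
    · exact ⟨neg i j, by simp [clauseA]⟩
    · exact ⟨neg i j, by simp [clauseB]⟩
    · have hb := hG.bounds hg
      by_cases hj : j = 1
      · exact ⟨pos 2 j, (mem_prefixClause hb.1 hb.2.1).2 ⟨2, by unfold InRows; omega, rfl⟩⟩
      · exact ⟨pos 1 j, (mem_prefixClause hb.1 hb.2.1).2 ⟨1, by unfold InRows; omega, rfl⟩⟩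
  obtain ⟨l, hl⟩ := hne
  have h1 : litSet P N l := hC.of_allBut hG hL hc ⟨hl, fun x hx _ => hw' _ (hf x hx)⟩
  have h2 : litSet P N l.neg := hw' _ (hf l hl)
  obtain ⟨i, j, rfl | rfl⟩ := lit_cases l
  · rw [pos_neg, litSet_neg] at h2
    exact hcons i j (litSet_pos.1 h1) h2
  · rw [neg_neg, litSet_pos] at h2
    exact hcons i j h2 (litSet_neg.1 h1)

/-- Propagation never leaves the closed set given by `P` and `N`, and when it ends the assignment is
itself closed, so by `hgen` it is the whole set. The outcome is therefore independent of the order,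
and so is the next decision. -/
theorem leads_of_level {P N : ℕ → ℕ → Prop} {g : State Var → Prop} {v : Var}
    (hG : Describes n L G) (hC : Closed n G (litSet P N)) (hcons : ∀ x y, P x y → ¬ N x y)
    (hv : v ∈ vars n ∧ ¬ P v.1 v.2 ∧ ¬ N v.1 v.2)
    (hbr : ∀ t : State Var, Sound (config n δ) t → t.learned = L →
      (∀ l, IsTrue t l ↔ litSet P N l) → ∀ w, IsBranchVar (config n δ) t w → w = v)
    (hnext : ∀ t : State Var, Sound (config n δ) t → t.learned = L →
      (∀ l, IsTrue t l ↔ litSet P N l) → t.pending = ∅ → Sound (config n δ) (t.decide v) →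
        Leads (config n δ) L g (t.decide v))
    (hS : Sound (config n δ) s) (hL : s.learned = L) (hw : Within P N s)
    (hgen : ∀ S, Closed n G S → (∀ l, IsTrue s l → S l) → ∀ l, litSet P N l → S l) :
    Leads (config n δ) L g s := by
  have hexact : ∀ x, Within P N x → (∀ l, IsTrue s l → IsTrue x l) → Sound (config n δ) x →
      x.learned = L → NoConflict (config n δ) x → Saturated (config n δ) x → x.pending = ∅ →
      ∀ l, IsTrue x l ↔ litSet P N l := fun x hx1 hx2 hSx hLx hn hsat hp l =>
    ⟨litSet_ext.2 ⟨fun _ _ => hx1.pos, fun _ _ => hx1.neg⟩ l,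
      hgen _ (Closed.of_sound hG hLx hSx hn hsat hp) hx2 l⟩
  refine Leads.of_invariant (fun x => Within P N x ∧ ∀ l, IsTrue s l → IsTrue x l)
    ?_ ?_ ?_ ?_ ⟨hw, fun _ h => h⟩ hS hL
  · rintro x ⟨hx1, hx2⟩ hSx hLx c l hc he hu -
    refine Or.inl ⟨hx1.imply ?_, fun l hl => (isTrue_imply ..).2 (Or.inr (hx2 l hl))⟩
    exact hC.of_allBut hG hLx hc ((isUnitClause_iff.1 hu).1.mono
      (litSet_ext.2 ⟨fun _ _ => hx1.pos, fun _ _ => hx1.neg⟩))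
  · rintro x ⟨hx1, hx2⟩ hSx hLx hn hsat l hl -
    exact Or.inl ⟨⟨hx1.pos, hx1.neg⟩, hx2⟩
  · rintro x ⟨hx1, hx2⟩ hSx hLx hn hsat hp
    have hx3 := hexact x hx1 hx2 hSx hLx hn hsat hp
    refine ⟨⟨v, hv.1, ?_⟩, fun w hw' hS' => Or.inr ?_⟩
    · rintro (h | h)
      · exact hv.2.1 (hx1.pos h)
      · exact hv.2.2 (hx1.neg h)
    · obtain rfl := hbr x hSx hLx hx3 w hw'
      exact hnext x hSx hLx hx3 hp hS'
  · rintro x ⟨hx1, hx2⟩ hSx hLx c hc hf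
    exact (noConflict_of_closed hG hLx hC hcons hx1 c hc hf).elim

/-- Consecutive decisions in column `c`, ending with row `a`. -/
theorem leads_of_descent {P N : ℕ → ℕ → ℕ → Prop} {g : State Var → Prop} {c a : ℕ}
    {next : ℕ → ℕ} {valid : ℕ → Prop} (hG : Describes n L G)
    (hnext : ∀ x, valid x → x < a → x < next x ∧ next x ≤ a ∧ valid (next x))
    (hC : ∀ x, valid x → x ≤ a → Closed n G (litSet (P x) (N x)))
    (hcons : ∀ x, valid x → x ≤ a → ∀ i j, P x i j → ¬ N x i j)
    (hv : ∀ x, valid x → x ≤ a → (x, c) ∈ vars n ∧ ¬ P x x c ∧ ¬ N x x c)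
    (hbr : ∀ x, valid x → x ≤ a → ∀ t : State Var, Sound (config n δ) t → t.learned = L →
      (∀ l, IsTrue t l ↔ litSet (P x) (N x) l) → ∀ w, IsBranchVar (config n δ) t w → w = (x, c))
    (hsub : ∀ x, valid x → x < a → ∀ l, l = neg x c ∨ litSet (P x) (N x) l →
      litSet (P (next x)) (N (next x)) l)
    (hgen : ∀ x, valid x → x < a → ∀ S, Closed n G S →
      (∀ l, l = neg x c ∨ litSet (P x) (N x) l → S l) →
        ∀ l, litSet (P (next x)) (N (next x)) l → S l)
    (hlast : valid a → ∀ t : State Var, Sound (config n δ) t → t.learned = L →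
      (∀ l, IsTrue t l ↔ litSet (P a) (N a) l) → t.pending = ∅ →
        Sound (config n δ) (t.decide (a, c)) → Leads (config n δ) L g (t.decide (a, c)))
    {x : ℕ} (hxa : x ≤ a) (hx : valid x) (hS : Sound (config n δ) s) (hL : s.learned = L)
    (hw : Within (P x) (N x) s)
    (hgs : ∀ S, Closed n G S → (∀ l, IsTrue s l → S l) → ∀ l, litSet (P x) (N x) l → S l) :
    Leads (config n δ) L g s := by
  obtain ⟨k, hk⟩ : ∃ k, k = a - x := ⟨_, rfl⟩
  induction k using Nat.strong_induction_on generalizing x s with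
  | _ k ih =>
    refine leads_of_level hG (hC x hx hxa) (hcons x hx hxa) (hv x hx hxa) (hbr x hx hxa) ?_
      hS hL hw hgs
    intro t hSt hLt htrue hpt hS'
    rcases Nat.lt_or_ge x a with hlt | hge
    · obtain ⟨h1, h2, h3⟩ := hnext x hx hlt
      have htrue' : ∀ l, IsTrue (t.decide (x, c)) l ↔ l = neg x c ∨ litSet (P x) (N x) l := by
        intro l
        rw [isTrue_decide, htrue]
        rfl
      refine ih (a - next x) (by omega) h2 h3 hS' hLt ⟨?_, ?_⟩ ?_ rfl
      · intro i j h
        exact litSet_pos.1 (hsub x hx hlt _ ((htrue' _).1 h))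
      · intro i j h
        exact litSet_neg.1 (hsub x hx hlt _ ((htrue' _).1 h))
      · intro S hS hsub' l hl
        exact hgen x hx hlt S hS (fun l h => hsub' l ((htrue' l).2 h)) l hl
    · obtain rfl : x = a := by omega
      exact hlast hx t hSt hLt htrue hpt hS'

/-- The most recently learned clauses are prefix clauses of column `c`, and row `x` of this column
occurs in one of them; or nothing has been learned and `c = 1`. -/
def Recent (n : ℕ) (L : List (Clause Var)) (c x : ℕ) : Prop :=
  (L = [] ∧ c = 1) ∨ ∃ L₁ k L₂, L = L₁ ++ prefixClause n c k :: L₂ ∧ InRows n c k x ∧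
    ∀ D ∈ L₂, ∃ k', D = prefixClause n c k'

/-- Within column `c`, later rows occur only in clauses that also contain row `x`, so they win
neither by score nor by the tie-break. Variables of other columns are absent from the most recent
clauses and score strictly less; if nothing has been learned, all scores are `0` and column `1`
comes first. -/
theorem branchVar_eq (hG : Describes n L G) (hδ : 0 < δ) (hδ' : δ ≤ 1 / 2) {c x : ℕ}
    (hc : 1 ≤ c) (hcn : c ≤ n) (hx : 1 ≤ x) (hxn : x ≤ n) (hxc : x ≠ c) (hrec : Recent n L c x)
    (hS : Sound (config n δ) s) (hL : s.learned = L) (hna : ¬ Assigned s (x, c))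
    (hbefore : ∀ i, 1 ≤ i → i < x → i ≠ c → Assigned s (i, c)) {w : Var}
    (hw : IsBranchVar (config n δ) s w) : w = (x, c) := by
  obtain ⟨hw1, hw2, hw3⟩ := hw
  by_contra hne
  have hsc : s.score = scores δ L := by
    rw [hS.score_eq, hL]
    rfl
  have h1 := hw3 (x, c) (mem_vars.2 ⟨hx, hxn, hc, hcn, hxc⟩) hna (Ne.symm hne)
  rw [hsc] at h1
  have hwv : 1 ≤ w.1 ∧ w.1 ≤ n ∧ 1 ≤ w.2 ∧ w.2 ≤ n ∧ w.1 ≠ w.2 := mem_vars.1 hw1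
  by_cases hwc : w.2 = c
  · have hxw : x ≤ w.1 := by
      by_contra hlt
      refine hw2 ?_
      have := hbefore w.1 hwv.1 (by omega) (by omega)
      rwa [← hwc] at this
    have hle : scores δ L w ≤ scores δ L (x, c) := by
      refine scores_le_of_occurs hδ fun D hD => ?_
      obtain ⟨j, k, hg, rfl⟩ := hG.learned D hD
      have hb := hG.bounds hg
      rw [occurs_prefixClause hb.1 hb.2.1, occurs_prefixClause hb.1 hb.2.1]
      unfold InRows
      simp only
      omega
    rcases h1 with h1 | ⟨-, h1⟩
    · exact absurd h1 (not_lt.2 hle)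
    · change w.2 < c ∨ (w.2 = c ∧ w.1 < x) at h1
      omega
  · rcases hrec with ⟨rfl, rfl⟩ | ⟨L₁, k, L₂, rfl, hxk, hL₂⟩
    · rcases h1 with h1 | ⟨-, h1⟩
      · exact lt_irrefl _ h1
      · change w.2 < 1 ∨ (w.2 = 1 ∧ w.1 < x) at h1
        omega
    · have hlt : scores δ (L₁ ++ prefixClause n c k :: L₂) w <
          scores δ (L₁ ++ prefixClause n c k :: L₂) (x, c) := by
        refine scores_lt_of_recent hδ hδ' ((occurs_prefixClause hc hcn).2 ⟨hxk, rfl⟩) ?_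
        intro D hD
        obtain ⟨k', rfl⟩ : ∃ k', D = prefixClause n c k' := by
          rcases List.mem_cons.1 hD with rfl | hD
          · exact ⟨k, rfl⟩
          · exact hL₂ D hD
        rw [occurs_prefixClause hc hcn]
        exact fun h => hwc h.2
      rcases h1 with h1 | ⟨h1, -⟩
      · exact absurd hlt (not_lt.2 h1.le)
      · exact absurd hlt (not_lt.2 h1.le)

end OrderingPrinciple

/-! ### The decisions that precede a conflict -/

namespace OrderingPrinciple

open CDCL

variable {n : ℕ} {δ : ℝ} {L : List (Clause Var)} {G : ℕ → ℕ → Prop} {d : Prop} {p q m a : ℕ}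
  {s : State Var} {g : State Var → Prop}

/-- The rows before `x` other than `p`. -/
def Before (p x i : ℕ) : Prop := 1 ≤ i ∧ i < x ∧ i ≠ p

/-- The rows before `x` other than `p` and `q`. -/
def Before₂ (p q x i : ℕ) : Prop := 1 ≤ i ∧ i < x ∧ i ≠ p ∧ i ≠ q

theorem not_assigned_of_iff {P N : ℕ → ℕ → Prop} (h : ∀ l, IsTrue s l ↔ litSet P N l) {x y : ℕ}
    (hP : ¬ P x y) (hN : ¬ N x y) : ¬ Assigned s (x, y) := by
  rintro (h' | h')
  · exact hP (litSet_pos.1 ((h (pos x y)).1 h'))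
  · exact hN (litSet_neg.1 ((h (neg x y)).1 h'))

/-- Decisions in column `p` that end in a conflict. -/
theorem leads_of_column (hG : Describes n L G) (hδ : 0 < δ) (hδ' : δ ≤ 1 / 2)
    (h : Setup n G d p q m a fun _ => False) (hlast : ∀ i, i < m → i ≠ p → i ≤ a)
    (htwo : ∀ {j k}, G j k → j ≠ p → (d → j ≠ q) → 2 ≤ k)
    (hrec : ∀ x, 1 ≤ x → x < m → x ≠ p → Recent n L p x)
    (hfinal : ∀ t : State Var, Sound (config n δ) t → t.learned = L →
      BaseTrail d p q m a (fun _ => False) t.level t.trail → 0 < t.level → t.pending = ∅ →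
        t.focus = some (neg a p) → Leads (config n δ) L g t)
    {x : ℕ} (hx : 1 ≤ x) (hxp : x ≠ p) (hxa : x ≤ a) (hqx : d → q < x)
    (hS : Sound (config n δ) s) (hL : s.learned = L)
    (hw : Within (basePos d p q) (levelNeg p q (fun _ => False) (Before p x)) s)
    (hgs : ∀ S, Closed n G S → (∀ l, IsTrue s l → S l) →
      ∀ l, litSet (basePos d p q) (levelNeg p q (fun _ => False) (Before p x)) l → S l) :
    Leads (config n δ) L g s := by
  obtain ⟨hp, hpm, hmn, ha, ham, hap, hq, hqm, hqp, -, hpiv, hpiv_le, -, hqcol⟩ := id h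
  have hlevel : ∀ y, 1 ≤ y ∧ y ≠ p ∧ (d → q < y) → y ≤ a →
      Level n G d p q (fun _ => False) (Before p y) := by
    rintro y ⟨hy1, hy2, hy3⟩ hya
    refine ⟨hp, by omega, hqp, ?_, by simp, ?_, ?_, hqcol, htwo⟩
    · unfold Before
      omega
    · exact fun hd => ⟨hq hd, hy3 hd, hqp hd⟩
    · intro k hk
      have := hpiv_le hk
      -- The row `y` about to be decided and the row `m` are unassigned; as `y ≤ a < m ≤ k + 1`,
      -- both belong to every available clause of column `p`.
      refine ⟨y, m, by omega, ?_, ?_, ?_, ?_⟩ <;> simp only [InRows, Before] <;> omega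
  refine leads_of_descent (P := fun _ => basePos d p q)
    (N := fun y => levelNeg p q (fun _ => False) (Before p y)) (c := p) (a := a)
    -- Column `p` has no row `p`.
    (next := fun y => if y + 1 = p then y + 2 else y + 1)
    (valid := fun y => 1 ≤ y ∧ y ≠ p ∧ (d → q < y)) hG ?_ (fun y hy hya => (hlevel y hy hya).closed hG)
    (fun y hy hya => (hlevel y hy hya).consistent) ?_ ?_ ?_ ?_ ?_ hxa ⟨hx, hxp, hqx⟩ hS hL hw hgs
  · rintro y ⟨hy1, hy2, hy3⟩ hya
    split_ifs with hif
    · exact ⟨by omega, by omega, by omega, by omega, fun hd => (hy3 hd).trans (by omega)⟩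
    · exact ⟨by omega, by omega, by omega, by omega, fun hd => (hy3 hd).trans (by omega)⟩
  · rintro y ⟨hy1, hy2, hy3⟩ hya
    refine ⟨mem_vars.2 ⟨hy1, ?_, hp, ?_, hy2⟩, ?_, ?_⟩
    · simp only; omega
    · simp only; omega
    · exact fun h => hy2 h.2.1
    · simp only [levelNeg, Before, and_false, or_false]; omega
  · rintro y ⟨hy1, hy2, hy3⟩ hya t hSt hLt htrue w hw'
    refine branchVar_eq hG hδ hδ' hp (by omega) hy1 (by omega) hy2 (hrec y hy1 (by omega) hy2)
      hSt hLt (not_assigned_of_iff htrue ?_ ?_) ?_ hw'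
    · exact fun h => hy2 h.2.1
    · simp only [levelNeg, Before, and_false, or_false]; omega
    · exact fun i h1 h2 h3 => Or.inr ((htrue (neg i p)).2 (litSet_neg.2 (Or.inl ⟨rfl, h1, h2, h3⟩)))
  · rintro y ⟨hy1, hy2, hy3⟩ hya l hl
    obtain ⟨i, j, rfl | rfl⟩ := lit_cases l
    · simpa using hl
    · simp only [neg_inj, litSet_neg, levelNeg, Before, and_false, or_false] at hl ⊢
      split_ifs <;> omega
  · rintro y ⟨hy1, hy2, hy3⟩ hya S - hsub l hl
    refine hsub l ?_
    obtain ⟨i, j, rfl | rfl⟩ := lit_cases l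
    · simpa using hl
    · simp only [neg_inj, litSet_neg, levelNeg, Before, and_false, or_false] at hl ⊢
      split_ifs at hl <;> omega
  · rintro - t hSt hLt htrue hpt hS'
    refine hfinal _ hS' hLt ⟨?_, ?_, ?_, ?_⟩ (Nat.succ_pos _) hpt rfl
    · intro i j
      refine (isTrue_decide t (a, p) (pos i j)).trans ?_
      rw [htrue, litSet_pos]
      simp [pos, basePos]
    · intro i j
      refine (isTrue_decide t (a, p) (neg i j)).trans ?_
      rw [htrue, litSet_neg]
      have := hlast i
      simp only [neg, levelNeg, Before, Prod.mk.injEq, and_true, and_false, or_false]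
      omega
    · exact ⟨_, List.mem_cons_self, rfl, rfl⟩
    · intro e he hl
      rcases List.mem_cons.1 he with rfl | he
      · exact Or.inl rfl
      · have := hSt.level_le e he
        change e.level = t.level + 1 at hl
        omega

/-- The last decision in column `q` makes `P_{a,p}` false, which ends in a conflict. -/
theorem leads_of_last_decision (hG : Describes n L G)
    (h : Setup n G True p q m a (Before₂ p q m)) (ha : a + 1 = m) (hpa : p < a) (hqa : q < a)
    (hfinal : ∀ t : State Var, Sound (config n δ) t → t.learned = L →
      BaseTrail True p q m a (Before₂ p q m) t.level t.trail → 0 < t.level → t.pending = ∅ →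
        t.focus = some (neg a p) → Leads (config n δ) L g t)
    (hS : Sound (config n δ) s) (hL : s.learned = L) (hp : s.pending = ∅)
    (htrue : ∀ l, IsTrue s l ↔
      litSet (basePos True p q) (levelNeg p q (Before₂ p q a) (Before p a)) l)
    (hS' : Sound (config n δ) (s.decide (a, q))) :
    Leads (config n δ) L g (s.decide (a, q)) := by
  obtain ⟨hp1, hpm, hmn, ha1, ham, hap, hq, hqm, hqp, -, hpiv, hpiv_le, -, hqcol⟩ := id h
  replace hq := hq trivial
  replace hqm := hqm trivial
  replace hqp := hqp trivial
  have hqcol := fun k => hqcol (k := k) trivial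
  let D := (s.decide (a, q)).trail
  have hD : ∀ l, (∃ e ∈ D, e.lit = l) ↔ l = neg a q ∨
      litSet (basePos True p q) (levelNeg p q (Before₂ p q a) (Before p a)) l := by
    intro l
    refine (isTrue_decide s (a, q) l).trans ?_
    rw [htrue]
    rfl
  -- The decision implies only `¬ P_{a,p}`, through `A(a, p, q)`. This literal, not the decision,
  -- becomes the implication point: all later implications that matter pass through it.
  let I : State Var → Prop := fun x => x.level = s.level + 1 ∧ x.focus = some (neg a q) ∧
    ((x.trail = D ∧ x.pending = ∅) ∨
      ∃ r, x.trail = ⟨neg a p, s.level + 1, r⟩ :: D ∧ x.pending = {neg a p})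
  have htrueI : ∀ x, I x → (∀ l, IsTrue x l ↔ (l = neg a p ∧ neg a p ∈ x.pending) ∨ l = neg a q ∨
      litSet (basePos True p q) (levelNeg p q (Before₂ p q a) (Before p a)) l) := by
    rintro x ⟨-, -, ⟨h1, h2⟩ | ⟨r, h1, h2⟩⟩ l
    · rw [h2, ← hD l, ← h1]
      simp [IsTrue]
    · rw [isTrue_cons h1, hD, h2]
      simp
  have hwithin : ∀ x, I x → Within (basePos True p q) (baseNeg p q m (Before₂ p q m)) x := by
    intro x hx
    refine ⟨?_, ?_⟩
    · intro i j hij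
      have := (htrueI x hx _).1 hij
      simpa using this
    · intro i j hij
      have := (htrueI x hx _).1 hij
      simp only [neg_inj, litSet_neg, levelNeg, Before, Before₂] at this
      simp only [baseNeg, Before₂]
      omega
  refine Leads.of_invariant I ?_ ?_ ?_ ?_ ⟨rfl, rfl, Or.inl ⟨rfl, hp⟩⟩ hS' hL
  · rintro x hx hSx hLx c l hc he hu -
    obtain ⟨h1, h2, h3⟩ := isUnitClause_iff.1 hu
    have hP := @(hwithin x hx).pos
    have hN := @(hwithin x hx).neg
    have hpq : IsTrue x (pos p q) := (htrueI x hx _).2 (Or.inr (Or.inr (by simp [basePos])))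
    have hl : l = neg a p := by
      have hc' : pos a q ∈ c := by
        rw [hx.2.1] at he
        exact he
      simp only [basePos, baseNeg, Before₂, true_and] at hP hN
      rcases hG.allBut_cases hLx hc h1 with ⟨i, j, k, ht, rfl, h4⟩ | ⟨i, j, ht, rfl, rfl, h4⟩ |
        ⟨j, k, y, hg, rfl, hy, rfl, h4⟩
      · have hik : a = i ∧ q = k := by simpa [clauseA] using hc'
        obtain ⟨rfl, rfl⟩ := hik
        rcases h4 with ⟨rfl, h4, h5⟩ | ⟨rfl, h4, h5⟩ | ⟨rfl, h4, h5⟩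
        · rw [(hP h4).1]
        · have := hP h4
          omega
        · have := hP h4
          omega
      · simp [clauseB] at hc'
      · have hb := hG.bounds hg
        simp only [mem_prefixClause hb.1 hb.2.1, pos_inj] at hc'
        obtain ⟨y', hy', rfl, rfl⟩ := hc'
        by_cases hyp : y = p
        · subst hyp
          exact absurd hpq h2
        · have := hN (h4 p (hqcol k hg) (Ne.symm hyp))
          omega
    subst hl
    refine Or.inl ⟨hx.1, hx.2.1, ?_⟩
    rcases hx.2.2 with ⟨h4, h5⟩ | ⟨r, h4, h5⟩
    · refine Or.inr ⟨some c, ?_, ?_⟩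
      · simp [h4, hx.1]
      · simp [h5]
    · refine absurd ?_ h2
      rw [isTrue_cons h4]
      exact Or.inl rfl
  · rintro x hx hSx hLx hn hsat l hl hSx'
    refine Or.inr ?_
    rcases hx.2.2 with ⟨h4, h5⟩ | ⟨r, h4, h5⟩
    · rw [h5] at hl
      cases hl
    · have hmem : neg a p ∈ x.pending := by simp [h5]
      rw [h5, Finset.mem_singleton] at hl
      subst hl
      refine hfinal _ hSx' hLx ⟨?_, ?_, ?_, ?_⟩ ?_ ?_ rfl
      · intro i j
        refine (htrueI x hx (pos i j)).trans ?_
        simp [basePos]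
      · intro i j
        refine (htrueI x hx (neg i j)).trans ?_
        simp only [neg_inj, litSet_neg, levelNeg, Before, Before₂, hmem, and_true]
        omega
      · refine ⟨⟨neg a p, s.level + 1, r⟩, ?_, rfl, hx.1.symm⟩
        change _ ∈ x.trail
        simp [h4]
      · intro e he hl
        change e ∈ x.trail at he
        change e.level = x.level at hl
        rw [hx.1] at hl
        rw [h4] at he
        rcases List.mem_cons.1 he with rfl | he
        · exact Or.inl rfl
        · rcases List.mem_cons.1 he with rfl | he
          · exact Or.inr ⟨trivial, rfl⟩
          · have := hS.level_le e he
            omega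
      · change 0 < x.level
        rw [hx.1]
        exact Nat.succ_pos _
      · simp [h5]
  · rintro x hx hSx hLx hn hsat hpx
    exfalso
    have hC := Closed.of_sound hG hLx hSx hn hsat hpx
    have hpq : IsTrue x (pos p q) := (htrueI x hx _).2 (Or.inr (Or.inr (by simp [basePos])))
    have haq : IsTrue x (neg a q) := (htrueI x hx _).2 (Or.inr (Or.inl rfl))
    have htr : Triple n a p q := by
      unfold Triple
      omega
    have := hC.clauseA htr ((allBut_clauseA htr).2 (Or.inl ⟨rfl, hpq, haq⟩))
    rw [htrueI x hx, hpx] at this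
    simp only [neg_inj, litSet_neg, levelNeg, Before, Before₂, Finset.notMem_empty,
      and_false, false_or] at this
    omega
  · rintro x hx hSx hLx c hc hf
    exfalso
    have hP := @(hwithin x hx).pos
    have hN := @(hwithin x hx).neg
    simp only [basePos, baseNeg, Before₂, true_and] at hP hN
    rcases hG.falsified_cases hLx hc hf with ⟨i, j, k, ht, h1, h2, h3⟩ | ⟨i, j, ht, rfl, h1, h2⟩ |
      ⟨j, k, hg, rfl, h1⟩
    · have h1 := hP h1
      have h2 := hP h2
      omega
    · have h1 := hP h1
      have h2 := hP h2
      omega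
    · have hb := hG.bounds hg
      by_cases hjp : j = p
      · subst hjp
        have hk := hpiv_le hg
        have := hN (h1 m (by unfold InRows; omega))
        omega
      by_cases hjq : j = q
      · subst hjq
        have := hN (h1 p (hqcol k hg))
        omega
      · by_cases hj1 : j = 1
        · have := hN (h1 2 (by unfold InRows; omega))
          omega
        · have := hN (h1 1 (by unfold InRows; omega))
          omega

/-- Decisions in column `q` while `P_{p,q}` is true. -/
theorem leads_of_second_column (hG : Describes n L G) (hδ : 0 < δ) (hδ' : δ ≤ 1 / 2)
    (h : Setup n G True p q m a (Before₂ p q m)) (ha : a + 1 = m)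
    (htwo : ∀ {j k}, G j k → j ≠ p → j ≠ q → 2 ≤ k)
    (hrec : ∀ x, p < x → q < x → x < m → Recent n L q x)
    (hfinal : ∀ t : State Var, Sound (config n δ) t → t.learned = L →
      BaseTrail True p q m a (Before₂ p q m) t.level t.trail → 0 < t.level → t.pending = ∅ →
        t.focus = some (neg a p) → Leads (config n δ) L g t)
    {x : ℕ} (hpx : p < x) (hqx : q < x) (hxa : x ≤ a)
    (hS : Sound (config n δ) s) (hL : s.learned = L)
    (hw : Within (basePos True p q) (levelNeg p q (Before₂ p q x) (Before p x)) s)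
    (hgs : ∀ S, Closed n G S → (∀ l, IsTrue s l → S l) →
      ∀ l, litSet (basePos True p q) (levelNeg p q (Before₂ p q x) (Before p x)) l → S l) :
    Leads (config n δ) L g s := by
  obtain ⟨hp1, hpm, hmn, ha1, ham, hap, hq, hqm, hqp, -, hpiv, hpiv_le, -, hqcol⟩ := id h
  replace hq := hq trivial
  replace hqm := hqm trivial
  replace hqp := hqp trivial
  have hlevel : ∀ y, p < y ∧ q < y → y ≤ a →
      Level n G True p q (Before₂ p q y) (Before p y) := by
    rintro y ⟨hy1, hy2⟩ hya
    refine ⟨hp1, by omega, fun _ => hqp, ?_, ?_, ?_, ?_, hqcol,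
      fun hg h1 h2 => htwo hg h1 (h2 trivial)⟩
    · unfold Before
      omega
    · simp only [Before, Before₂, true_and]
      omega
    · exact fun _ => ⟨hq, hy2, hqp⟩
    · intro k hk
      have := hpiv_le hk
      refine ⟨y, m, by omega, ?_, ?_, ?_, ?_⟩ <;> simp only [InRows, Before] <;> omega
  refine leads_of_descent (P := fun _ => basePos True p q)
    (N := fun y => levelNeg p q (Before₂ p q y) (Before p y)) (c := q) (a := a)
    (next := fun y => y + 1)
    (valid := fun y => p < y ∧ q < y) hG ?_ (fun y hy hya => (hlevel y hy hya).closed hG)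
    (fun y hy hya => (hlevel y hy hya).consistent) ?_ ?_ ?_ ?_ ?_ hxa ⟨hpx, hqx⟩ hS hL hw hgs
  · rintro y ⟨hy1, hy2⟩ hya
    omega
  · rintro y ⟨hy1, hy2⟩ hya
    refine ⟨mem_vars.2 ⟨?_, ?_, hq, ?_, ?_⟩, ?_, ?_⟩
    · simp only; omega
    · simp only; omega
    · simp only; omega
    · simp only; omega
    · simp only [basePos]; omega
    · simp only [levelNeg, Before, Before₂]; omega
  · rintro y ⟨hy1, hy2⟩ hya t hSt hLt htrue w hw'
    refine branchVar_eq hG hδ hδ' hq (by omega) (by omega) (by omega) (by omega)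
      (hrec y hy1 hy2 (by omega)) hSt hLt (not_assigned_of_iff htrue ?_ ?_) ?_ hw'
    · simp only [basePos]; omega
    · simp only [levelNeg, Before, Before₂]; omega
    · intro i h1 h2 h3
      by_cases hip : i = p
      · subst hip
        exact Or.inl ((htrue (pos i q)).2 (litSet_pos.2 ⟨trivial, rfl, rfl⟩))
      · exact Or.inr ((htrue (neg i q)).2 (litSet_neg.2 (Or.inr ⟨rfl, h1, h2, hip, h3⟩)))
  · rintro y ⟨hy1, hy2⟩ hya l hl
    obtain ⟨i, j, rfl | rfl⟩ := lit_cases l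
    · simpa using hl
    · simp only [neg_inj, litSet_neg, levelNeg, Before, Before₂] at hl ⊢
      omega
  · rintro y ⟨hy1, hy2⟩ hya S hC hsub l hl
    have hpq : S (pos p q) := hsub _ (Or.inr (by simp [basePos]))
    have hyq : S (neg y q) := hsub _ (Or.inl rfl)
    have htr : Triple n y p q := by
      unfold Triple
      omega
    -- The copying step: a false entry of column `q` becomes one of column `p`.
    have hyp : S (neg y p) := hC.clauseA htr ((allBut_clauseA htr).2 (Or.inl ⟨rfl, hpq, hyq⟩))
    obtain ⟨i, j, rfl | rfl⟩ := lit_cases l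
    · exact hsub _ (by simpa using hl)
    · by_cases hij : i = y ∧ j = p
      · obtain ⟨rfl, rfl⟩ := hij
        exact hyp
      · refine hsub _ ?_
        simp only [neg_inj, litSet_neg, levelNeg, Before, Before₂] at hl ⊢
        omega
  · rintro ⟨hy1, hy2⟩ t hSt hLt htrue hpt hS'
    exact leads_of_last_decision hG h ha hy1 hy2 hfinal hSt hLt hpt htrue hS'

/-- The literals implied when the rows before `p` in column `q` are false. -/
theorem Closed.second_column {κ x : ℕ} {S : Lit Var → Prop} (hC : Closed n G S)
    (hp : 1 ≤ p) (hpn : p ≤ n) (hq : 1 ≤ q) (hqn : q ≤ n) (hqp : q ≠ p)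
    (hκ : G q κ) (hrows : ∀ y, InRows n q κ y ↔ 1 ≤ y ∧ y ≤ p ∧ y ≠ q)
    (hx : ∀ i, i < x → i ≤ p ∨ i = q) (h : ∀ i, 1 ≤ i → i < p → i ≠ q → S (neg i q))
    (l : Lit Var) (hl : litSet (basePos True p q) (levelNeg p q (Before₂ p q x) (Before p x)) l) :
    S l := by
  have hpq : S (pos p q) := by
    refine hC.clauseC hκ ((allBut_prefixClause hq hqn).2 ⟨p, (hrows p).2 (by omega), rfl, ?_⟩)
    intro y hy hne
    have := (hrows y).1 hy
    exact h y (by omega) (by omega) (by omega)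
  obtain ⟨i, j, rfl | rfl⟩ := lit_cases l
  · obtain ⟨-, rfl, rfl⟩ := litSet_pos.1 hl
    exact hpq
  · rcases litSet_neg.1 hl with ⟨rfl, h1, h2, h3⟩ | ⟨rfl, h1, h2, h3, h4⟩
    · by_cases hiq : i = q
      · subst hiq
        have hpr : Pair n i j := by
          unfold Pair
          omega
        exact hC.clauseB hpr ((allBut_clauseB hpr).2 (Or.inl ⟨rfl, hpq⟩))
      · have := hx i h2
        have htr : Triple n i j q := by
          unfold Triple
          omega
        exact hC.clauseA htr ((allBut_clauseA htr).2
          (Or.inl ⟨rfl, hpq, h i h1 (by omega) hiq⟩))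
    · have := hx i h2
      exact h i h1 (by omega) h4

/-- From a restart, decisions in column `q` make `P_{p,q}` true; further decisions in column `q`
end in a conflict. -/
theorem leads_of_first_column {κ x₀ y : ℕ} (hG : Describes n L G) (hδ : 0 < δ) (hδ' : δ ≤ 1 / 2)
    (h : Setup n G True p q m a (Before₂ p q m)) (ha : a + 1 = m) (hp : 2 ≤ p)
    (hqp : q = 1 ∨ q = p + 1)
    (hκ : G q κ) (hrows : ∀ y, InRows n q κ y ↔ 1 ≤ y ∧ y ≤ p ∧ y ≠ q)
    (hx₀ : ∀ i, i < x₀ → i ≤ p ∨ i = q) (hpx : p < x₀) (hqx : q < x₀) (hxa : x₀ ≤ a)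
    (htwo : ∀ {j k}, G j k → j ≠ q → 2 ≤ k)
    (hrec : ∀ x, 1 ≤ x → x < m → x ≠ q → Recent n L q x)
    (hfinal : ∀ t : State Var, Sound (config n δ) t → t.learned = L →
      BaseTrail True p q m a (Before₂ p q m) t.level t.trail → 0 < t.level → t.pending = ∅ →
        t.focus = some (neg a p) → Leads (config n δ) L g t)
    (hy : 1 ≤ y) (hyq : y ≠ q) (hyp : y < p) (hymin : ∀ i, 1 ≤ i → i < y → i = q)
    (hS : Sound (config n δ) s) (hL : s.learned = L) (htrail : s.trail = []) :
    Leads (config n δ) L g s := by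
  obtain ⟨hp1, hpm, hmn, ha1, ham, hap, hq, hqm, hqp', -, hpiv, hpiv_le, -, hqcol⟩ := id h
  replace hq := hq trivial
  replace hqm := hqm trivial
  have hlevel : ∀ y, 1 ≤ y ∧ y ≠ q → y ≤ p - 1 →
      Level n G False q 0 (fun _ => False) (Before q y) := by
    rintro y ⟨hy1, hy2⟩ hya
    refine ⟨hq, by omega, by simp, ?_, by simp, by simp, ?_, by simp,
      fun hg h1 _ => htwo hg h1⟩
    · unfold Before
      omega
    · intro k hk
      have := hqcol trivial hk
      -- Before `P_{p,q}` is implied, the rows `y` and `p` are unassigned in each available clause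
      -- of column `q`.
      refine ⟨y, p, by omega, ?_, ?_, ?_, ?_⟩ <;> simp only [InRows, Before] at * <;> omega
  -- In this phase column `q` is the only active one; `0` is a dummy for the second column. Deciding
  -- row `p - 1` leaves row `p` as the last literal of `C(q, κ)`.
  refine leads_of_descent (P := fun _ => basePos False q 0)
    (N := fun y => levelNeg q 0 (fun _ => False) (Before q y)) (c := q) (a := p - 1)
    (next := fun y => y + 1)
    (valid := fun y => 1 ≤ y ∧ y ≠ q) (x := y) hG ?_
    (fun y hy hya => (hlevel y hy hya).closed hG)
    (fun y hy hya => (hlevel y hy hya).consistent) ?_ ?_ ?_ ?_ ?_ (by omega) ⟨hy, hyq⟩ hS hL ?_ ?_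
  · rintro y ⟨hy1, hy2⟩ hya
    omega
  · rintro y ⟨hy1, hy2⟩ hya
    refine ⟨mem_vars.2 ⟨?_, ?_, hq, ?_, ?_⟩, ?_, ?_⟩
    · simp only; omega
    · simp only; omega
    · simp only; omega
    · simp only; omega
    · simp [basePos]
    · simp [levelNeg, Before]
  · rintro y ⟨hy1, hy2⟩ hya t hSt hLt htrue w hw'
    refine branchVar_eq hG hδ hδ' hq (by omega) (by omega) (by omega) (by omega)
      (hrec y hy1 (by omega) hy2) hSt hLt (not_assigned_of_iff htrue ?_ ?_) ?_ hw'
    · simp [basePos]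
    · simp [levelNeg, Before]
    · exact fun i h1 h2 h3 => Or.inr ((htrue (neg i q)).2 (litSet_neg.2 (Or.inl ⟨rfl, h1, h2, h3⟩)))
  · rintro y ⟨hy1, hy2⟩ hya l hl
    obtain ⟨i, j, rfl | rfl⟩ := lit_cases l
    · simpa using hl
    · simp only [neg_inj, litSet_neg, levelNeg, Before, and_false, or_false] at hl ⊢
      omega
  · rintro y ⟨hy1, hy2⟩ hya S - hsub l hl
    refine hsub l ?_
    obtain ⟨i, j, rfl | rfl⟩ := lit_cases l
    · simpa using hl
    · simp only [neg_inj, litSet_neg, levelNeg, Before, and_false, or_false] at hl ⊢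
      omega
  · rintro - t hSt hLt htrue hpt hS'
    have htrue' : ∀ l, IsTrue (t.decide (p - 1, q)) l ↔ l = neg (p - 1) q ∨
        litSet (basePos False q 0) (levelNeg q 0 (fun _ => False) (Before q (p - 1))) l := by
      intro l
      rw [isTrue_decide, htrue]
      rfl
    refine leads_of_second_column hG hδ hδ' h ha (fun hg _ h2 => htwo hg h2)
      (fun x h1 h2 h3 => hrec x (by omega) h3 (by omega)) hfinal hpx hqx hxa hS' hLt ⟨?_, ?_⟩ ?_
    · intro i j hij
      have := (htrue' _).1 hij
      simp [basePos] at this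
    · intro i j hij
      have := (htrue' _).1 hij
      simp only [neg_inj, litSet_neg, levelNeg, Before, Before₂, and_false, or_false] at this ⊢
      omega
    · intro S hC hsub l hl
      refine hC.second_column (by omega) (by omega) hq (by omega) (by omega) hκ hrows hx₀ ?_ l hl
      intro i h1 h2 h3
      refine hsub _ ((htrue' _).2 ?_)
      simp only [neg_inj, litSet_neg, levelNeg, Before, and_false, or_false, true_and, and_true]
      omega
  · refine ⟨fun h' => ?_, fun h' => ?_⟩ <;> simp [IsTrue, htrail] at h'
  · rintro S - - l hl
    exfalso
    obtain ⟨i, j, rfl | rfl⟩ := lit_cases l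
    · simp [basePos] at hl
    · simp only [litSet_neg, levelNeg, Before, and_false, or_false] at hl
      have := hymin i
      omega

end OrderingPrinciple

/-! ### The learned clauses in their order -/

namespace OrderingPrinciple

open CDCL

variable {n : ℕ} {δ : ℝ}

theorem mem_downTo {a b x : ℕ} : x ∈ downTo a b ↔ b ≤ x ∧ x ≤ a := by
  simp only [downTo, List.mem_reverse, List.mem_range'_1]
  omega

theorem downTo_of_lt {a b : ℕ} (h : a < b) : downTo a b = [] := by
  rw [downTo, show a + 1 - b = 0 by omega]
  rfl

theorem downTo_of_le {a b : ℕ} (h : b ≤ a) : downTo a b = downTo a (b + 1) ++ [b] := by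
  rw [downTo, downTo, show a + 1 - b = (a + 1 - (b + 1)) + 1 by omega, List.range'_succ,
    List.reverse_cons]

theorem downTo_eq_cons {a b : ℕ} (h : b ≤ a) : ∃ l, downTo a b = a :: l := by
  refine ⟨(List.range' b (a - b)).reverse, ?_⟩
  rw [downTo, show a + 1 - b = (a - b) + 1 by omega, List.range'_concat, List.reverse_append,
    show b + 1 * (a - b) = a by omega]
  rfl

/-- The clauses `C(j, a), …, C(j, b)`. -/
def block (n j a b : ℕ) : List (Clause Var) := (downTo a b).map fun k => prefixClause n j k

theorem mem_block {j a b : ℕ} {c : Clause Var} :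
    c ∈ block n j a b ↔ ∃ k, (b ≤ k ∧ k ≤ a) ∧ prefixClause n j k = c := by
  simp only [block, List.mem_map, mem_downTo]

theorem block_self (j a : ℕ) : block n j a a = [prefixClause n j a] := by
  rw [block, downTo_of_le le_rfl, downTo_of_lt (Nat.lt_succ_self a)]
  rfl

theorem block_of_lt {j a b : ℕ} (h : a < b) : block n j a b = [] := by
  rw [block, downTo_of_lt h]
  rfl

theorem head_eq (hn : 6 ≤ n) : head n = block n 1 (n - 2) (n - 3) := by
  rw [block, downTo_of_le (by omega), show n - 3 + 1 = n - 2 by omega, List.map_append]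
  change _ = block n 1 (n - 2) (n - 2) ++ _
  rw [block_self]
  rfl

/-- The part of the cascade for the columns `n - 2, …, j`. -/
def cascade (n j : ℕ) : List (Clause Var) :=
  (downTo (n - 2) j).flatMap fun i => block n i (n - 2) (i - 1)

theorem cascade_of_le {j : ℕ} (h : j ≤ n - 2) :
    cascade n j = cascade n (j + 1) ++ block n j (n - 2) (j - 1) := by
  rw [cascade, downTo_of_le h, List.flatMap_append, List.flatMap_singleton]
  rfl

theorem cascade_of_lt {j : ℕ} (h : n - 2 < j) : cascade n j = [] := by
  rw [cascade, downTo_of_lt h]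
  rfl

theorem mem_cascade {j : ℕ} {c : Clause Var} : c ∈ cascade n j ↔
    ∃ i, (j ≤ i ∧ i ≤ n - 2) ∧ ∃ k, (i - 1 ≤ k ∧ k ≤ n - 2) ∧ prefixClause n i k = c := by
  simp only [cascade, List.mem_flatMap, mem_downTo, mem_block]

theorem recent_of_block {L : List (Clause Var)} {j a b x : ℕ} (hb : b ≤ a) (hx : InRows n j a x) :
    Recent n (L ++ block n j a b) j x := by
  obtain ⟨l, hl⟩ := downTo_eq_cons hb
  refine Or.inr ⟨L, a, l.map fun k => prefixClause n j k, ?_, hx, ?_⟩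
  · rw [block, hl, List.map_cons]
  · intro D hD
    obtain ⟨k, -, rfl⟩ := List.mem_map.1 hD
    exact ⟨k, rfl⟩

/-- The prefix clauses `C(i, k)` that are available when the learned clauses are those of column `1`
with `k₁ ≤ k`, those of the columns `i` with `j < i ≤ n - 2` and `i - 1 ≤ k`, and those of column
`j` with `k₀ ≤ k`. -/
def Profile (n k₁ j k₀ i k : ℕ) : Prop :=
  1 ≤ i ∧ i ≤ n ∧ 1 ≤ k ∧ k + 1 ≤ n ∧
    (k = n - 1 ∨ (i = 1 ∧ k₁ ≤ k) ∨ (j < i ∧ i ≤ n - 2 ∧ i - 1 ≤ k) ∨ (i = j ∧ k₀ ≤ k))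

theorem describes_profile {L : List (Clause Var)} {k₁ j k₀ : ℕ} (hn : 2 ≤ n)
    (h1 : ∀ c ∈ L, ∃ i k, Profile n k₁ j k₀ i k ∧ prefixClause n i k = c)
    (h2 : ∀ i k, Profile n k₁ j k₀ i k → k ≤ n - 2 → prefixClause n i k ∈ L) :
    Describes n L (Profile n k₁ j k₀) where
  bounds h := ⟨h.1, h.2.1, h.2.2.1, h.2.2.2.1⟩
  full {i} h h' := ⟨h, h', by omega, by omega, Or.inl rfl⟩
  learned c hc := by
    obtain ⟨i, k, h, rfl⟩ := h1 c hc
    exact ⟨i, k, h, rfl⟩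
  available {i k} h := by
    by_cases hk : k ≤ n - 2
    · exact Or.inr (h2 i k h hk)
    · have hkn : k = n - 1 := by
        have := h.2.2.2.1
        omega
      rw [hkn]
      exact Or.inl (mem_formula.2 (Or.inr (Or.inr ⟨i, h.1, h.2.1, rfl⟩)))

/-- The parameters `n - 2` and `n - 1` empty the cascade part of the profile, so that only column
`1` and the clauses `D(j)` remain. -/
theorem describes_block {b : ℕ} (hn : 6 ≤ n) (hb : n - 3 ≤ b) :
    Describes n (block n 1 (n - 2) b) (Profile n b (n - 2) (n - 1)) := by
  refine describes_profile (by omega) ?_ ?_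
  · intro c hc
    obtain ⟨k, hk, rfl⟩ := mem_block.1 hc
    exact ⟨1, k, by unfold Profile; omega, rfl⟩
  · intro i k h hk
    unfold Profile at h
    obtain rfl : i = 1 := by omega
    exact mem_block.2 ⟨k, by omega, rfl⟩

theorem describes_cascade {j b : ℕ} (hn : 6 ≤ n) (hj : 2 ≤ j) (hjn : j ≤ n - 2) (hb : j - 1 ≤ b) :
    Describes n (head n ++ cascade n (j + 1) ++ block n j (n - 2) b)
      (Profile n (n - 3) j b) := by
  refine describes_profile (by omega) ?_ ?_
  · intro c hc
    simp only [head_eq hn, List.mem_append, mem_block, mem_cascade] at hc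
    rcases hc with (⟨k, hk, rfl⟩ | ⟨i, hi, k, hk, rfl⟩) | ⟨k, hk, rfl⟩
    · exact ⟨1, k, by unfold Profile; omega, rfl⟩
    · exact ⟨i, k, by unfold Profile; omega, rfl⟩
    · exact ⟨j, k, by unfold Profile; omega, rfl⟩
  · intro i k h hk
    unfold Profile at h
    simp only [head_eq hn, List.mem_append, mem_block, mem_cascade]
    by_cases hi : i = 1
    · subst hi
      exact Or.inl (Or.inl ⟨k, by omega, rfl⟩)
    · by_cases hij : i = j
      · subst hij
        exact Or.inr ⟨k, by omega, rfl⟩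
      · exact Or.inl (Or.inr ⟨i, by omega, k, by omega, rfl⟩)

theorem describes_tail {b : ℕ} (hn : 6 ≤ n) (hb : 2 ≤ b) (hbn : b ≤ n - 3) :
    Describes n (head n ++ cascade n 2 ++ block n 1 (n - 4) b) (Profile n b 1 (n - 1)) := by
  refine describes_profile (by omega) ?_ ?_
  · intro c hc
    simp only [head_eq hn, List.mem_append, mem_block, mem_cascade] at hc
    rcases hc with (⟨k, hk, rfl⟩ | ⟨i, hi, k, hk, rfl⟩) | ⟨k, hk, rfl⟩
    · exact ⟨1, k, by unfold Profile; omega, rfl⟩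
    · exact ⟨i, k, by unfold Profile; omega, rfl⟩
    · exact ⟨1, k, by unfold Profile; omega, rfl⟩
  · intro i k h hk
    unfold Profile at h
    simp only [head_eq hn, List.mem_append, mem_block, mem_cascade]
    by_cases hi : i = 1
    · subst hi
      by_cases hk3 : n - 3 ≤ k
      · exact Or.inl (Or.inl ⟨k, by omega, rfl⟩)
      · exact Or.inr ⟨k, by omega, rfl⟩
    · exact Or.inl (Or.inr ⟨i, by omega, k, by omega, rfl⟩)

/-- After learning `L` the solver learns the clauses of `M` in their order. -/
def Learns (n : ℕ) (δ : ℝ) (L M : List (Clause Var)) : Prop :=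
  ∀ M₁ c M₂, M = M₁ ++ c :: M₂ →
    Leads (config n δ) (L ++ M₁) (fun t => t = restarted δ (L ++ M₁ ++ [c]))
      (restarted δ (L ++ M₁))

theorem Learns.nil {L : List (Clause Var)} : Learns n δ L [] := by
  intro M₁ c M₂ h
  simp at h

theorem Learns.singleton {L : List (Clause Var)} {c : Clause Var}
    (h : Leads (config n δ) L (fun t => t = restarted δ (L ++ [c])) (restarted δ L)) :
    Learns n δ L [c] := by
  intro M₁ c' M₂ h'
  obtain ⟨rfl, rfl, rfl⟩ : M₁ = [] ∧ c = c' ∧ M₂ = [] := by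
    cases M₁ with
    | nil => simpa [eq_comm] using h'
    | cons => simp at h'
  simpa using h

theorem Learns.append {L M N : List (Clause Var)} (hM : Learns n δ L M)
    (hN : Learns n δ (L ++ M) N) : Learns n δ L (M ++ N) := by
  intro M₁ c M₂ h
  rcases List.append_eq_append_iff.1 h with ⟨T, rfl, h'⟩ | ⟨T, rfl, h'⟩
  · have := hN T c M₂ h'
    rwa [List.append_assoc] at this
  · cases T with
    | nil =>
      have := hN [] c M₂ (by simpa using h'.symm)
      simpa using this
    | cons x T =>
      obtain ⟨rfl, rfl⟩ := List.cons.inj h'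
      exact hM M₁ c T rfl

theorem Learns.flatMap_downTo {L : List (Clause Var)} {a b : ℕ} {f : ℕ → List (Clause Var)}
    (h : ∀ k, b ≤ k → k ≤ a → Learns n δ (L ++ (downTo a (k + 1)).flatMap f) (f k)) :
    Learns n δ L ((downTo a b).flatMap f) := by
  generalize ht : a + 1 - b = t
  induction t generalizing b with
  | zero =>
    rw [downTo_of_lt (by omega)]
    exact Learns.nil
  | succ t ih =>
    rw [downTo_of_le (by omega), List.flatMap_append, List.flatMap_singleton]
    exact (ih (fun k hk => h k (by omega)) (by omega)).append (h b le_rfl (by omega))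

theorem Learns.block {L : List (Clause Var)} {j a b : ℕ}
    (h : ∀ k, b ≤ k → k ≤ a → Leads (config n δ) (L ++ block n j a (k + 1))
      (fun t => t = restarted δ (L ++ OrderingPrinciple.block n j a (k + 1) ++ [prefixClause n j k]))
      (restarted δ (L ++ OrderingPrinciple.block n j a (k + 1)))) :
    Learns n δ L (block n j a b) := by
  have he : ∀ b, OrderingPrinciple.block n j a b =
      (downTo a b).flatMap fun k => [prefixClause n j k] := fun b => List.map_eq_flatMap
  simp only [he] at h ⊢
  exact Learns.flatMap_downTo fun k h1 h2 => Learns.singleton (h k h1 h2)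

end OrderingPrinciple

/-! ### The run of the solver -/

namespace OrderingPrinciple

open CDCL

variable {n : ℕ} {δ : ℝ} {L : List (Clause Var)} {G : ℕ → ℕ → Prop} {p q m a : ℕ}

theorem Describes.sound_restarted (hG : Describes n L G) :
    Sound (config n δ) (restarted δ L) :=
  Sound.restarted hG.clause_vars

theorem within_restarted (P N : ℕ → ℕ → Prop) : Within P N (restarted δ L) := by
  refine ⟨fun h => ?_, fun h => ?_⟩ <;> simp [IsTrue, restarted] at h

/-- Decisions in column `p` from a restart. -/
theorem leads_of_single_column (hG : Describes n L G) (hδ : 0 < δ) (hδ' : δ ≤ 1 / 2)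
    (h : Setup n G False p q m a fun _ => False) (hlast : ∀ i, i < m → i ≠ p → i ≤ a)
    (htwo : ∀ {j k}, G j k → j ≠ p → 2 ≤ k)
    (hrec : ∀ x, 1 ≤ x → x < m → x ≠ p → Recent n L p x)
    (hend : G m (m - 1) ∨ (m + 1 = n ∧ (∀ {k}, G m k → k = n - 1) ∧ ∀ {k}, G n k → k = n - 1)) :
    Leads (config n δ) L (fun t => t = restarted δ (L ++ [prefixClause n p (m - 2)]))
      (restarted δ L) := by
  obtain ⟨x, hx, hxp, hmin⟩ : ∃ x, 1 ≤ x ∧ x ≠ p ∧ ∀ i, 1 ≤ i → i < x → i = p := by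
    by_cases hp : p = 1
    · exact ⟨2, by omega, by omega, by omega⟩
    · exact ⟨1, by omega, by omega, by omega⟩
  have hxa : x ≤ a := by
    by_contra hlt
    exact h.a_ne (hmin a h.a_pos (by omega))
  refine leads_of_column hG hδ hδ' h hlast (fun hg hj _ => htwo hg hj) hrec ?_ hx hxp hxa
    (by simp) hG.sound_restarted rfl (within_restarted _ _) ?_
  · intro t hS hL hB hlvl hpe hf
    rcases hend with hend | ⟨h1, h2, h3⟩
    · exact leads_of_close h hG hend hS hL hB hlvl hpe hf
    · exact leads_of_penultimate h hG h1 h2 h3 hS hL hB hlvl hpe hf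
  · rintro S - - l hl
    exfalso
    obtain ⟨i, j, rfl | rfl⟩ := lit_cases l
    · simp [basePos] at hl
    · simp only [litSet_neg, levelNeg, Before, and_false, or_false] at hl
      have := hmin i
      omega

/-- The first conflict closes with `D(n)`, where `m = n`; the second has `m = n - 1` and needs the
detour through column `n`. -/
theorem learns_head (hn : 6 ≤ n) (hδ : 0 < δ) (hδ' : δ ≤ 1 / 2) : Learns n δ [] (head n) := by
  rw [head_eq hn]
  refine Learns.block fun k h1 h2 => ?_
  rw [List.nil_append]
  have hG := describes_block (b := k + 1) hn (by omega)
  rw [show prefixClause n 1 k = prefixClause n 1 (k + 2 - 2) from rfl]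
  refine leads_of_single_column (q := 0) (a := k + 1) hG hδ hδ' ?_ ?_ ?_ ?_ ?_
  · refine ⟨le_rfl, by omega, by omega, by omega, by omega, by omega, by simp, by simp, by simp,
      by simp, ?_, ?_, ?_, by simp⟩ <;> unfold Profile <;> intros <;> omega
  · omega
  · unfold Profile
    intros
    omega
  · intro x hx hxm hx1
    by_cases hk : k = n - 2
    · rw [block_of_lt (by omega)]
      exact Or.inl ⟨rfl, rfl⟩
    · exact recent_of_block (L := []) (by omega) (by unfold InRows; omega)
  · by_cases hk : k = n - 2
    · exact Or.inl (by unfold Profile; omega)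
    · refine Or.inr ⟨by omega, ?_, ?_⟩ <;> unfold Profile <;> intros <;> omega

/-- The first clause of column `p` is learned after decisions in column `q`. -/
theorem leads_of_next_column (hn : 6 ≤ n) (hδ : 0 < δ) (hδ' : δ ≤ 1 / 2) {κ x₀ y : ℕ} (hp : 2 ≤ p)
    (hpn : p ≤ n - 2) (hqp : (q = 1 ∧ p = n - 2 ∧ κ = n - 3 ∧ x₀ = n - 1 ∧ y = 2) ∨
      (q = p + 1 ∧ p < n - 2 ∧ κ = p ∧ x₀ = p + 2 ∧ y = 1))
    (hG : Describes n L (Profile n (n - 3) p (n - 1)))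
    (hrec : ∀ x, 1 ≤ x → x < n → x ≠ q → Recent n L q x) :
    Leads (config n δ) L (fun t => t = restarted δ (L ++ [prefixClause n p (n - 2)]))
      (restarted δ L) := by
  have h : Setup n (Profile n (n - 3) p (n - 1)) True p q n (n - 1) (Before₂ p q n) := by
    refine ⟨by omega, by omega, le_rfl, by omega, by omega, by omega, by omega, by omega,
      by omega, ?_, ?_, ?_, ?_, ?_⟩ <;> simp only [Profile, Before₂, InRows, true_and] <;>
        intros <;> omega
  -- `C(q, κ)` ends exactly at row `p`, so the decisions from row `y` on imply `P_{p,q}`; `x₀` is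
  -- the first row of column `q` still to be decided.
  refine leads_of_first_column (κ := κ) (x₀ := x₀) (y := y) hG hδ hδ' h (by omega) hp (by omega)
    ?_ ?_ (by omega) (by omega) (by omega) (by omega) ?_ hrec ?_ (by omega) (by omega) (by omega)
    (by omega) hG.sound_restarted rfl rfl
  · unfold Profile
    omega
  · intro y
    simp only [InRows]
    omega
  · unfold Profile
    intros
    omega
  · intro t hS hL hB hlvl hpe hf
    exact leads_of_close h hG (hG.full (by omega) le_rfl) hS hL hB hlvl hpe hf

/-- Only the first clause requires decisions in another column; it bumps column `j`, which is then
decided directly. The closing clauses `C(k + 2, k + 1)` with `k + 2 ≤ n - 2` were learned earlier,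
since `k + 2 > j`. -/
theorem learns_cascade_column (hn : 6 ≤ n) (hδ : 0 < δ) (hδ' : δ ≤ 1 / 2) {j : ℕ} (hj : 2 ≤ j)
    (hjn : j ≤ n - 2) :
    Learns n δ (head n ++ cascade n (j + 1)) (block n j (n - 2) (j - 1)) := by
  refine Learns.block fun k h1 h2 => ?_
  have hG := describes_cascade (b := k + 1) hn hj hjn (by omega)
  by_cases hk : k = n - 2
  · subst hk
    rw [show n - 2 + 1 = n - 1 by omega] at hG ⊢
    rw [block_of_lt (by omega), List.append_nil] at hG ⊢
    by_cases hjn' : j = n - 2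
    · refine leads_of_next_column (q := 1) (κ := n - 3) (x₀ := n - 1) (y := 2) hn hδ hδ' hj hjn
        (by omega) hG ?_
      intro x hx hxn hx1
      rw [cascade_of_lt (by omega), List.append_nil, head_eq hn]
      exact recent_of_block (L := []) (by omega) (by unfold InRows; omega)
    · refine leads_of_next_column (q := j + 1) (κ := j) (x₀ := j + 2) (y := 1) hn hδ hδ' hj hjn
        (by omega) hG ?_
      intro x hx hxn hx1
      rw [cascade_of_le (by omega), ← List.append_assoc]
      exact recent_of_block (by omega) (by unfold InRows; omega)
  · rw [show prefixClause n j k = prefixClause n j (k + 2 - 2) from rfl]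
    -- The last row below `m = k + 2` other than `j`; the exception is the final clause `C(j, j -
    -- 1)`, where row `k + 1` is `j` itself.
    refine leads_of_single_column (q := 0) (a := if k + 1 = j then k else k + 1) hG hδ hδ'
      ?_ ?_ ?_ ?_ ?_
    · refine ⟨by omega, by omega, by omega, ?_, ?_, ?_, by simp, by simp, by simp,
        by simp, ?_, ?_, ?_, by simp⟩
      · split_ifs <;> omega
      · split_ifs <;> omega
      · split_ifs <;> omega
      all_goals
        unfold Profile
        intros
        omega
    · intro i hi hij
      split_ifs <;> omega
    · unfold Profile
      intros
      omega
    · intro x hx hxm hxj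
      exact recent_of_block (by omega) (by unfold InRows; omega)
    · by_cases hk' : k = n - 3
      · refine Or.inr ⟨by omega, ?_, ?_⟩ <;> unfold Profile <;> intros <;> omega
      · exact Or.inl (by unfold Profile; omega)

theorem learns_cascade (hn : 6 ≤ n) (hδ : 0 < δ) (hδ' : δ ≤ 1 / 2) :
    Learns n δ (head n) (cascade n 2) :=
  Learns.flatMap_downTo fun _ h1 h2 => learns_cascade_column hn hδ hδ' h1 h2

/-- The unit clause `C(2, 1)` fixes `P_{1,2}` and thus `¬ P_{2,1}` at level `0`. Since 1UIP keeps
literals of level `0`, `P_{2,1}` still appears in the learned clauses. -/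
theorem learns_tail (hn : 6 ≤ n) (hδ : 0 < δ) (hδ' : δ ≤ 1 / 2) :
    Learns n δ (head n ++ cascade n 2) (block n 1 (n - 4) 2) := by
  refine Learns.block fun k h1 h2 => ?_
  have hG := describes_tail (b := k + 1) hn (by omega) (by omega)
  have hκ : Profile n (k + 1) 1 (n - 1) 2 1 := by
    unfold Profile
    omega
  have hrows : ∀ y, InRows n 2 1 y ↔ 1 ≤ y ∧ y ≤ 1 ∧ y ≠ 2 := by
    intro y
    simp only [InRows]
    omega
  rw [show prefixClause n 1 k = prefixClause n 1 (k + 2 - 2) from rfl]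
  have hsetup : ∀ Q : ℕ → Prop, (∀ x, Q x → Before₂ 1 2 (k + 2) x) →
      Setup n (Profile n (k + 1) 1 (n - 1)) True 1 2 (k + 2) (k + 1) Q := by
    intro Q hQ
    refine ⟨le_rfl, by omega, by omega, by omega, by omega, by omega, by omega, by omega,
      by omega, fun x hx => ⟨trivial, (hQ x hx)⟩, ?_, ?_, ?_, ?_⟩ <;>
      simp only [Profile, InRows, true_and] <;> intros <;> omega
  have hclose : Profile n (k + 1) 1 (n - 1) (k + 2) (k + 2 - 1) := by
    unfold Profile
    omega
  have hsecond : ∀ S, Closed n (Profile n (k + 1) 1 (n - 1)) S → ∀ l,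
      litSet (basePos True 1 2) (levelNeg 1 2 (Before₂ 1 2 3) (Before 1 3)) l → S l :=
    fun S hC => hC.second_column le_rfl (by omega) (by omega) (by omega) (by omega) hκ hrows
      (by omega) (by omega)
  -- For the first clause of the tail column `2` is the recent one, and its decisions are copied to
  -- column `1`. Afterwards column `1` is decided directly, from row `3` on.
  by_cases hk : k = n - 4
  · have h := hsetup _ fun x hx => hx
    refine leads_of_second_column (x := 3) hG hδ hδ' h rfl ?_ ?_ ?_ (by omega) (by omega) (by omega)
      hG.sound_restarted rfl (within_restarted _ _) fun S hC _ => hsecond S hC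
    · unfold Profile
      intros
      omega
    · intro x h1 h2 h3
      rw [block_of_lt (by omega), List.append_nil, cascade_of_le (by omega), ← List.append_assoc]
      exact recent_of_block (by omega) (by unfold InRows; omega)
    · intro t hS hL hB hlvl hpe hf
      exact leads_of_close h hG hclose hS hL hB hlvl hpe hf
  · have h := hsetup (fun _ => False) fun _ h => h.elim
    refine leads_of_column (x := 3) hG hδ hδ' h (by omega) ?_ ?_ ?_ (by omega) (by omega) (by omega)
      (by omega) hG.sound_restarted rfl (within_restarted _ _) ?_
    · intro j k hg h1 h2
      have := h2 trivial
      unfold Profile at hg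
      omega
    · intro x h1 h2 h3
      exact recent_of_block (by omega) (by unfold InRows; omega)
    · intro t hS hL hB hlvl hpe hf
      exact leads_of_close h hG hclose hS hL hB hlvl hpe hf
    · intro S hC _ l hl
      refine hsecond S hC l ?_
      obtain ⟨i, j, rfl | rfl⟩ := lit_cases l
      · simpa using hl
      · simp only [litSet_neg, levelNeg, and_false, or_false] at hl ⊢
        exact Or.inl hl

/-- When all clauses have been learned, unit propagation without decisions ends in a conflict. -/
theorem leads_refuted (hn : 6 ≤ n) (hG : Describes n L (Profile n 2 1 (n - 1))) :
    Leads (config n δ) L (Refuted L) (restarted δ L) := by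
  refine Leads.of_invariant (fun s => s.level = 0) ?_ ?_ ?_ ?_ rfl hG.sound_restarted rfl
  · exact fun x hx _ _ c l _ _ _ _ => Or.inl hx
  · exact fun x hx _ _ _ _ l _ _ => Or.inl hx
  · intro x hx hS hL hno hsat hpe
    exfalso
    have hC := Closed.of_sound hG hL hS hno hsat hpe
    -- The refutation uses `C(2, 1)`, `C(1, 2)` and `C(3, 2)`: they imply `P_{1,2}`, `P_{3,1}` and
    -- `P_{2,3}` in turn, a cycle on which `A(2, 3, 1)` fails.
    have h12 : IsTrue x (pos 1 2) := by
      refine hC.clauseC (j := 2) (k := 1) (by unfold Profile; omega)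
        ((allBut_prefixClause (by omega) (by omega)).2 ⟨1, ?_, rfl, ?_⟩)
      · unfold InRows; omega
      · unfold InRows; omega
    have hB : ∀ {i j}, Pair n i j → IsTrue x (pos i j) → IsTrue x (neg j i) := by
      intro i j hpr h
      rw [Pair] at hpr
      have hpr' : Pair n j i := by
        unfold Pair
        omega
      exact hC.clauseB hpr' ((allBut_clauseB hpr').2 (Or.inl ⟨rfl, h⟩))
    have h21 : IsTrue x (neg 2 1) := hB (by unfold Pair; omega) h12
    have h31 : IsTrue x (pos 3 1) := by
      refine hC.clauseC (j := 1) (k := 2) (by unfold Profile; omega)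
        ((allBut_prefixClause (by omega) (by omega)).2 ⟨3, ?_, rfl, ?_⟩)
      · unfold InRows; omega
      · intro y hy hne
        obtain rfl : y = 2 := by
          unfold InRows at hy
          omega
        exact h21
    have h13 : IsTrue x (neg 1 3) := hB (by unfold Pair; omega) h31
    have h23 : IsTrue x (pos 2 3) := by
      refine hC.clauseC (j := 3) (k := 2) (by unfold Profile; omega)
        ((allBut_prefixClause (by omega) (by omega)).2 ⟨2, ?_, rfl, ?_⟩)
      · unfold InRows; omega
      · intro y hy hne
        obtain rfl : y = 1 := by
          unfold InRows at hy
          omega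
        exact h13
    have ht : Triple n 2 3 1 := by
      unfold Triple
      omega
    exact hno _ (inDatabase_clauseA ht) (allFalse_clauseA.2 ⟨h23, h31, h21⟩)
  · intro x hx hS hL c _ _
    exact ⟨fun h => absurd hx (by omega), fun h => ⟨hL, rfl, h⟩⟩

theorem exists_isBranchVar (s : State Var) (h : ∃ v ∈ (config n δ).vars, ¬ Assigned s v) :
    ∃ v, IsBranchVar (config n δ) s v := by
  classical
  let U := (config n δ).vars.filter fun v => ¬ Assigned s v
  -- Score first, then the reversed column-major order, so that a maximum of the key is the
  -- branching variable.
  let key : Var → ℝ ×ₗ (ℕ ×ₗ ℕ)ᵒᵈ := fun v =>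
    toLex (s.score v, OrderDual.toDual (toLex (v.2, v.1)))
  obtain ⟨v, hv, hmax⟩ := U.exists_max_image key (by
    obtain ⟨v, h1, h2⟩ := h
    exact ⟨v, Finset.mem_filter.2 ⟨h1, h2⟩⟩)
  rw [Finset.mem_filter] at hv
  refine ⟨v, hv.1, hv.2, fun w hw hw' hne => ?_⟩
  have := hmax w (Finset.mem_filter.2 ⟨hw, hw'⟩)
  rcases Prod.Lex.toLex_le_toLex.1 this with h1 | ⟨h1, h2⟩
  · exact Or.inl h1
  · refine Or.inr ⟨h1, ?_⟩
    rcases Prod.Lex.toLex_le_toLex.1 (OrderDual.toDual_le_toDual.1 h2) with h3 | ⟨h3, h4⟩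
    · exact Or.inl h3
    · refine Or.inr ⟨h3, lt_of_le_of_ne h4 fun h5 => hne (Prod.ext h5.symm h3.symm)⟩

end OrderingPrinciple

theorem theorem4 (n : ℕ) (hn : 6 ≤ n) (δ : ℝ) (hδ_pos : 0 < δ) (hδ_le : δ ≤ 1 / 2) :
    CDCL.AlwaysHalts (OrderingPrinciple.config n δ) ∧
    ∀ s : CDCL.State OrderingPrinciple.Var,
      CDCL.Reachable (OrderingPrinciple.config n δ) s →
      CDCL.Halted (OrderingPrinciple.config n δ) s →
        s.learned = OrderingPrinciple.head n ++ OrderingPrinciple.descendingCascade n ++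
          OrderingPrinciple.tail n ∧
        s.status = CDCL.Status.unsat ∧ s.level = 0 := by
  refine CDCL.halts_of_leads rfl ?_ ?_ OrderingPrinciple.exists_isBranchVar
  · intro L' c L'' h
    have := (((OrderingPrinciple.learns_head hn hδ_pos hδ_le).append
      (OrderingPrinciple.learns_cascade hn hδ_pos hδ_le)).append
        (OrderingPrinciple.learns_tail hn hδ_pos hδ_le)) L' c L'' h
    rwa [List.nil_append] at this
  · exact OrderingPrinciple.leads_refuted hn
      (OrderingPrinciple.describes_tail hn le_rfl (by omega))
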